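/- **Setting.** Let $\mathcal N$ be a finite non-empty set, $n=|\mathcal N|$, let $f\colon 2^{\mathcal N}\to\mathbb R_{\ge 0}$ be submodular (not necessarily monotone), i.e. $f(X)+f(Y)\ge f(X\cup Y)+f(X\cap Y)$, and let $(\mathcal N,\mathcal I)$ be a $k$-system with an integer $k\ge 1$: $\emptyset\in\mathcal I$, $\mathcal I$ is closed under subsets, and $|X_1|\le k|X_2|$ for any two bases $X_1,X_2$ of any $Y\subseteq\mathcal N$, where $X\subseteq Y$ is a base of $Y$ if $X\in\mathcal I$ and $X\cup\{u\}\notin\mathcal I$ for all $u\in Y\setminus X$. Assume $\{u\}\in\mathcal I$ for all $u\in\mathcal N$. Let $r=\max_{X\in\mathcal I}|X|$, let $O$ maximize $f$ over $\mathcal I$, and write $f(u\mid X)=f(X\cup\{u\})-f(X)$. The function $f$ is accessed through a value oracle. The query complexity of an algorithm is its expected number of oracle queries; its adaptive complexity is its expected number of adaptive rounds, where in each round a number of queries polynomial in $n$ is made simultaneously, depending only on the answers in earlier rounds. Tests of membership in $\mathcal I$ are free. **Algorithm $\mathsf{ParSSP}(p,\epsilon,f)$.** Put $M=\lceil(\log_{1-\epsilon}\frac{\epsilon}{r}+2)/\epsilon^2\rceil$,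 $\ell=\lceil\log_{1-\epsilon}\frac{\epsilon}{r}\rceil+1$, $u^*\in\arg\max_{u\in\mathcal N}f(\{u\})$, $T=\emptyset$, $I=\mathcal N$. For $i=1,\dots,\ell$: let $\rho=f(\{u^*\})(1-\epsilon)^{i-1}$, let $(A,U,L)$ be the result of $\mathsf{RandBatch}$ for the current $T,I,\rho$, and replace $T$ by $T\cup A$ and $I$ by $I\setminus(U\cup L)$. Return the better of $T$ and $\{u^*\}$. $\mathsf{RandBatch}$: start with $A=U=\emptyset$, $count=0$, $L=\{u\in I: f(u\mid T)\ge\rho,\ T\cup\{u\}\in\mathcal I\}$. While $L\ne\emptyset$ and $count<M$: 1. Draw a sequence $v_1,\dots,v_d$: start with the empty sequence $V$ and $J=L$; while $J\neq\emptyset$, order $J$ uniformly at random, append to $V$ the longest prefix that keeps $T\cup A\cup V$ in $\mathcal I$, and replace $J$ by $\{u\in J\setminus V: T\cup A\cup V\cup\{u\}\in\mathcal I\}$. 2. For $0\le i\le d$ let $G_i=T\cup A\cup\{v_1,\dots,v_i\}$, $E_i^+=\{u\in L: f(u\mid G_i)\ge\rho,\ G_i\cup\{u\}\in\mathcal I\}$,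 $E_i^-=\{u\in L: f(u\mid G_i)<0\}$, $D_i=\{j\le i: f(v_j\mid G_{j-1})<0\}$. Let $t_1$ be the least $i\le d$ with $|E_i^+|\le(1-\epsilon)|L|$, let $t_2$ be the least $i\le d$ with $\epsilon\sum_{u\in E_i^+}f(u\mid G_i)\le\sum_{u\in E_i^-}|f(u\mid G_i)|+\sum_{j\in D_i}|f(v_j\mid G_{j-1})|$ (a minimum over the empty set is $d+1$), and let $t^*=\min\{t_1,t_2\}$. 3. Add $v_1,\dots,v_{t^*}$ to $U$. With probability $p$, add them also to $A$ and, if $t_2<t_1$, increase $count$ by $1$. Replace $L$ by $\{u\in L\setminus U: f(u\mid T\cup A)\ge\rho,\ T\cup A\cup\{u\}\in\mathcal I\}$. Return $(A,U,L)$. The indices $t_1,t_2$ are found either by testing all $i\le d$ in parallel in a single round, or by binary search. **Theorem.** Let $p=(1+\sqrt{k+1})^{-1}$ and $0<\epsilon<1$. With either way of searching, $\mathsf{ParSSP}$ terminates almost surely, makes at most $(n+1)^2$ queries in each round and returns a set $S\in\mathcal I$; if $\epsilon<2/5$, then $$\mathbb E[f(S)]\ \ge\ (1-\epsilon)^5\,(\sqrt{k+1}+1)^{-2}\,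 f(O).$$ Moreover there is a constant $C>0$ depending only on $\epsilon$ such that, for all instances, the adaptive complexity and the query complexity are at most, respectively, - $C\sqrt k\,\log^2(n+1)$ and $C\sqrt k\,n\,r\log^2(n+1)$ if all indices are tested in parallel; - $C\sqrt k\,\log^2(n+1)\log(r+1)$ and $C\sqrt k\,n\log^2(n+1)\log(r+1)$ if binary search is used. -/

import Mathlib

open scoped ENNReal

noncomputable section

universe u v w

namespace ParSSP

/-! ### The optimization problem -/

/-- Submodularity of a set function on a finite ground set. -/
def Submodular {N : Type u} [DecidableEq N] (f : Finset N → ℝ) : Prop :=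
  ∀ X Y : Finset N, f (X ∪ Y) + f (X ∩ Y) ≤ f X + f Y

/-- `indep` is the collection of independent sets of an independence system. -/
structure IsIndependenceSystem {N : Type u} (indep : Finset N → Prop) : Prop where
  empty : indep ∅
  subset : ∀ X Y : Finset N, X ⊆ Y → indep Y → indep X

/-- `X` is a base of `Y`. -/
def IsBase {N : Type u} [DecidableEq N] (indep : Finset N → Prop) (X Y : Finset N) : Prop :=
  X ⊆ Y ∧ indep X ∧ ∀ u ∈ Y \ X, ¬ indep (insert u X)

/-- The `k`-systems (`k ≥ 1`). -/
structure IsKSystem {N : Type u} [DecidableEq N] (k : ℕ) (indep : Finset N → Prop) : Prop where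
  one_le : 1 ≤ k
  system : IsIndependenceSystem indep
  card_base_le : ∀ Y X₁ X₂ : Finset N, IsBase indep X₁ Y → IsBase indep X₂ Y →
    X₁.card ≤ k * X₂.card

/-- `O` is an optimal solution of `max {f(S) : S ∈ 𝓘}`. -/
def IsOptimal {N : Type u} (indep : Finset N → Prop) (f : Finset N → ℝ) (O : Finset N) : Prop :=
  indep O ∧ ∀ X : Finset N, indep X → f X ≤ f O

open Classical in
/-- `r`, the maximum cardinality of a feasible solution. -/
def rank {N : Type u} [Fintype N] (indep : Finset N → Prop) : ℕ :=
  (Finset.univ.filter indep).sup Finset.card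

/-! ### Randomized algorithms with parallel access to a value oracle -/

/-- Randomized computations with access to a value oracle for a set function on `N`.
`ask Q k` is one adaptive round: the sets in `Q` are queried simultaneously, and the computation
continues with `k` applied to the answers. `flip p` tosses a coin that is `true` with
probability `p`, `shuffle s` draws a uniformly random ordering of `s`. `abort` marks a run that was
cut off before termination. -/
inductive Comp (N : Type u) (α : Type v) : Type (max u v)
  | pure (a : α)
  | abort
  | ask (Q : Finset (Finset N)) (next : (Finset N → ℝ) → Comp N α)
  | flip (p : unitInterval) (next : Bool → Comp N α)
  | shuffle (s : Finset N) (next : List N → Comp N α)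

/-- Sequential composition. -/
def Comp.bind {N : Type u} {α : Type v} {β : Type w} (c : Comp N α) (g : α → Comp N β) :
    Comp N β :=
  match c with
  | .pure a => g a
  | .abort => .abort
  | .ask Q next => .ask Q fun ans => (next ans).bind g
  | .flip p next => .flip p fun b => (next b).bind g
  | .shuffle s next => .shuffle s fun l => (next l).bind g

/-- Cost of a run: the number of adaptive rounds, the total number of oracle queries, and the
largest number of oracle queries made in a single round. -/
structure Cost where
  rounds : ℕ
  queries : ℕ
  width : ℕ

/-- Add one round with `q` queries in front. -/
def Cost.addRound (q : ℕ) (c : Cost) : Cost := ⟨c.rounds + 1, c.queries + q, max q c.width⟩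

/-- The toss of a coin that shows `true` with probability `p`. -/
def coin (p : unitInterval) : PMF Bool :=
  PMF.ofFintype (fun b => if b then ENNReal.ofReal p else ENNReal.ofReal (1 - p)) (by
    rw [Fintype.sum_bool]
    simp only [if_true, Bool.false_eq_true, if_false]
    rw [← ENNReal.ofReal_add p.2.1 (sub_nonneg.2 p.2.2)]
    simp)

open Classical in
/-- The uniform distribution on all orderings of a finite set. -/
def uniformOrdering {N : Type u} (s : Finset N) : PMF (List N) :=
  PMF.uniformOfFinset s.toList.permutations.toFinset ⟨s.toList, by simp⟩

/-- What an oracle for `f` tells in a round in which the sets in `Q` are queried: the values of `f`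
on `Q` (and nothing about `f` outside `Q`). -/
def answers {N : Type u} [DecidableEq N] (f : Finset N → ℝ) (Q : Finset (Finset N)) :
    Finset N → ℝ :=
  fun S => if S ∈ Q then f S else 0

/-- The joint law of the result (`none` for an aborted run) and of the cost of a computation, run
with the oracle for `f`. -/
def Comp.run {N : Type u} {α : Type v} [DecidableEq N] (f : Finset N → ℝ) :
    Comp N α → PMF (Option α × Cost)
  | .pure a => PMF.pure (some a, ⟨0, 0, 0⟩)
  | .abort => PMF.pure (none, ⟨0, 0, 0⟩)
  | .ask Q next =>
      (Comp.run f (next (answers f Q))).map fun ω => (ω.1, ω.2.addRound Q.card)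
  | .flip p next => (coin p).bind fun b => Comp.run f (next b)
  | .shuffle s next => (uniformOrdering s).bind fun l => Comp.run f (next l)

/-! A computation with unbounded while-loops is given by its approximations `prog t`, in which every
while-loop is cut off (by `abort`) when its condition is about to be tested for the `(t+1)`-st time.
The following are the corresponding limits (monotone in `t`). -/

/-- The probability that the computation halts with result `a`. -/
def outputProb {N : Type u} {α : Type v} [DecidableEq N] (f : Finset N → ℝ) (prog : ℕ → Comp N α)
    (a : α) : ℝ≥0∞ :=
  ⨆ t : ℕ, ∑' c : Cost, (prog t).run f (some a, c)

/-- The expectation of a cost measure (the number of rounds, or of queries) of the computation. -/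
def expectedCost {N : Type u} {α : Type v} [DecidableEq N] (f : Finset N → ℝ)
    (prog : ℕ → Comp N α) (cost : Cost → ℕ) : ℝ≥0∞ :=
  ⨆ t : ℕ, ∑' ω : Option α × Cost, (prog t).run f ω * (cost ω.2 : ℝ≥0∞)

/-- No run of the computation makes more than `b` queries in a single round. -/
def WidthAtMost {N : Type u} {α : Type v} [DecidableEq N] (f : Finset N → ℝ)
    (prog : ℕ → Comp N α) (b : ℕ) : Prop :=
  ∀ t : ℕ, ∀ ω ∈ ((prog t).run f).support, ω.2.width ≤ b

/-! ### The algorithm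

Below, `g` stands for the answers of the oracle in the current round. In `RandBatch` the objective
is `f_T(·) = f(T ∪ ·)` and a set `X` is feasible if `T ∪ X` is independent; so all sets are written
with `T` included, `B = T ∪ A` being the current base set. -/

/-- The marginal gain of `u` with respect to `X`. -/
def marg {N : Type u} [DecidableEq N] (g : Finset N → ℝ) (u : N) (X : Finset N) : ℝ :=
  g (insert u X) - g X

/-- The queries that determine the marginal gains with respect to `X` of all elements of `L`. -/
def margQueries {N : Type u} [DecidableEq N] (X L : Finset N) : Finset (Finset N) :=
  insert X (L.image fun u => insert u X)

open Classical in
/-- The elements of `L` that can be added to `X` with marginal gain at least `ρ`. -/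
def valuable {N : Type u} [DecidableEq N] (indep : Finset N → Prop) (g : Finset N → ℝ) (ρ : ℝ)
    (X L : Finset N) : Finset N :=
  L.filter fun u => ρ ≤ marg g u X ∧ indep (insert u X)

open Classical in
/-- The while-loop of `GetSEQ`; the first argument bounds the number of passes. -/
def getSEQLoop {N : Type u} [DecidableEq N] (indep : Finset N → Prop) (B : Finset N) :
    ℕ → Finset N → List N → Comp N (List N)
  | 0, _, V => .pure V
  | m + 1, I, V =>
    if I.Nonempty then
      .shuffle I fun l =>
        let s := Nat.findGreatest (fun i => indep (B ∪ V.toFinset ∪ (l.take i).toFinset)) l.length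
        let V' := V ++ l.take s
        getSEQLoop indep B m
          (I.filter fun u => u ∉ V' ∧ indep (insert u (B ∪ V'.toFinset))) V'
    else .pure V

/-- `GetSEQ`: a random sequence of elements of `I` that can be added to `B`. Every pass of the
while-loop removes at least one element from `I`, so `|I|` passes always suffice. -/
def getSEQ {N : Type u} [DecidableEq N] (indep : Finset N → Prop) (B I : Finset N) :
    Comp N (List N) :=
  getSEQLoop indep B I.card I []

/-- `G_i = B ∪ {v_1, …, v_i}`. -/
def prefixSet {N : Type u} [DecidableEq N] (B : Finset N) (V : List N) (i : ℕ) : Finset N :=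
  B ∪ (V.take i).toFinset

/-- `E_i^+`. -/
def Eplus {N : Type u} [DecidableEq N] (indep : Finset N → Prop) (g : Finset N → ℝ) (ρ : ℝ)
    (B : Finset N) (V : List N) (L : Finset N) (i : ℕ) : Finset N :=
  valuable indep g ρ (prefixSet B V i) L

/-- `E_i^-`. -/
def Eminus {N : Type u} [DecidableEq N] (g : Finset N → ℝ) (B : Finset N) (V : List N)
    (L : Finset N) (i : ℕ) : Finset N :=
  L.filter fun u => marg g u (prefixSet B V i) < 0

/-- The marginal gain `f(v_{j+1} ∣ B ∪ {v_1, …, v_j})` for `j < |V|`. -/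
def stepGain {N : Type u} [DecidableEq N] (g : Finset N → ℝ) (B : Finset N) (V : List N)
    (j : ℕ) : ℝ :=
  g (prefixSet B V (j + 1)) - g (prefixSet B V j)

/-- `D_i`, given by the indices (counted from `0`) of its elements in the sequence `V`. -/
def Dneg {N : Type u} [DecidableEq N] (g : Finset N → ℝ) (B : Finset N) (V : List N)
    (i : ℕ) : Finset ℕ :=
  (Finset.range i).filter fun j => stepGain g B V j < 0

/-- The condition that defines `t₁`. -/
def cond₁ {N : Type u} [DecidableEq N] (indep : Finset N → Prop) (ρ ε : ℝ) (B : Finset N)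
    (V : List N) (L : Finset N) (g : Finset N → ℝ) (i : ℕ) : Prop :=
  ((Eplus indep g ρ B V L i).card : ℝ) ≤ (1 - ε) * (L.card : ℝ)

/-- The condition that defines `t₂`. -/
def cond₂ {N : Type u} [DecidableEq N] (indep : Finset N → Prop) (ρ ε : ℝ) (B : Finset N)
    (V : List N) (L : Finset N) (g : Finset N → ℝ) (i : ℕ) : Prop :=
  ε * ∑ u ∈ Eplus indep g ρ B V L i, marg g u (prefixSet B V i) ≤
    ∑ u ∈ Eminus g B V L i, |marg g u (prefixSet B V i)| +
      ∑ j ∈ Dneg g B V i, |stepGain g B V j|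

/-- The queries that determine both conditions at the index `i`. -/
def queriesAt {N : Type u} [DecidableEq N] (B : Finset N) (V : List N) (L : Finset N) (i : ℕ) :
    Finset (Finset N) :=
  margQueries (prefixSet B V i) L ∪ (Finset.range (i + 1)).image (prefixSet B V)

open Classical in
/-- The least `i ≤ d` with `P i`, or `d + 1` if there is none. -/
def leastIndex (d : ℕ) (P : ℕ → Prop) : ℕ :=
  if h : ∃ i ≤ d, P i then Nat.find h else d + 1

/-- Find `(t₁, t₂)` in one round, testing all `i ≤ d` in parallel. -/
def searchAll {N : Type u} [DecidableEq N] (indep : Finset N → Prop) (ρ ε : ℝ) (B : Finset N)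
    (V : List N) (L : Finset N) : Comp N (ℕ × ℕ) :=
  .ask ((Finset.range (V.length + 1)).biUnion fun i => queriesAt B V L i) fun g =>
    .pure (leastIndex V.length (cond₁ indep ρ ε B V L g),
      leastIndex V.length (cond₂ indep ρ ε B V L g))

open Classical in
/-- Binary search for the least index in `[lo, hi)` with `P g i` (`hi` if there is none), with one
round for each index that is tested. -/
def bisect {N : Type u} (queries : ℕ → Finset (Finset N)) (P : (Finset N → ℝ) → ℕ → Prop)
    (lo hi : ℕ) : Comp N ℕ :=
  if lo < hi then
    .ask (queries ((lo + hi) / 2)) fun g =>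
      if P g ((lo + hi) / 2) then bisect queries P lo ((lo + hi) / 2)
      else bisect queries P ((lo + hi) / 2 + 1) hi
  else .pure lo
termination_by hi - lo
decreasing_by all_goals omega

/-- Find `t₁` and then `t₂` by binary search. -/
def searchBinary {N : Type u} [DecidableEq N] (indep : Finset N → Prop) (ρ ε : ℝ) (B : Finset N)
    (V : List N) (L : Finset N) : Comp N (ℕ × ℕ) :=
  (bisect (queriesAt B V L) (cond₁ indep ρ ε B V L) 0 (V.length + 1)).bind fun t₁ =>
  (bisect (queriesAt B V L) (cond₂ indep ρ ε B V L) 0 (V.length + 1)).bind fun t₂ =>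
    .pure (t₁, t₂)

/-- The two ways of searching for `t₁` and `t₂` in `RandBatch`. -/
inductive SearchMode
  | parallel
  | binary

/-- The search for `(t₁, t₂)` in the given mode. -/
def search {N : Type u} [DecidableEq N] (mode : SearchMode) (indep : Finset N → Prop) (ρ ε : ℝ)
    (B : Finset N) (V : List N) (L : Finset N) : Comp N (ℕ × ℕ) :=
  match mode with
  | .parallel => searchAll indep ρ ε B V L
  | .binary => searchBinary indep ρ ε B V L

open Classical in
/-- The while-loop of `RandBatch`, with current sets `A`, `U`, `L` and current value of `count`.
The first explicit number is the cut-off for the loop. -/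
def randBatchLoop {N : Type u} [DecidableEq N] (mode : SearchMode) (indep : Finset N → Prop)
    (T : Finset N) (ρ : ℝ) (M : ℕ) (p : unitInterval) (ε : ℝ) :
    ℕ → Finset N → Finset N → Finset N → ℕ → Comp N (Finset N × Finset N × Finset N)
  | 0, _, _, _, _ => .abort
  | t + 1, A, U, L, count =>
    if L.Nonempty ∧ count < M then
      (getSEQ indep (T ∪ A) L).bind fun V =>
      (search mode indep ρ ε (T ∪ A) V L).bind fun τ =>
      let batch := (V.take (min τ.1 τ.2)).toFinset
      let U' := U ∪ batch
      .flip p fun accept =>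
      let A' := if accept then A ∪ batch else A
      let count' := if accept ∧ τ.2 < τ.1 then count + 1 else count
      .ask (margQueries (T ∪ A') (L \ U')) fun g =>
      randBatchLoop mode indep T ρ M p ε t A' U'
        (valuable indep g ρ (T ∪ A') (L \ U')) count'
    else .pure (A, U, L)

/-- `RandBatch(ρ, I, M, p, ε, f_T)`, returning `(A, U, L)`. -/
def randBatch {N : Type u} [DecidableEq N] (mode : SearchMode) (indep : Finset N → Prop)
    (T : Finset N) (ρ : ℝ) (I : Finset N) (M : ℕ) (p : unitInterval) (ε : ℝ) (t : ℕ) :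
    Comp N (Finset N × Finset N × Finset N) :=
  .ask (margQueries T I) fun g =>
    randBatchLoop mode indep T ρ M p ε t ∅ ∅ (valuable indep g ρ T I) 0

/-- The for-loop of `ParSSP`: the remaining number of iterations, the number `i` of iterations
already made, and the current sets `T` and `I`. -/
def parSSPLoop {N : Type u} [DecidableEq N] (mode : SearchMode) (indep : Finset N → Prop)
    (ρmax : ℝ) (M : ℕ) (p : unitInterval) (ε : ℝ) (t : ℕ) :
    ℕ → ℕ → Finset N → Finset N → Comp N (Finset N)
  | 0, _, T, _ => .pure T
  | m + 1, i, T, I =>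
    (randBatch mode indep T (ρmax * (1 - ε) ^ i) I M p ε t).bind fun R =>
      parSSPLoop mode indep ρmax M p ε t m (i + 1) (T ∪ R.1) (I \ (R.2.1 ∪ R.2.2))

/-- The number `M` of `ParSSP`. -/
def paramM (r : ℕ) (ε : ℝ) : ℕ := ⌈(Real.logb (1 - ε) (ε / r) + 2) / ε ^ 2⌉₊

/-- The number `ℓ` of `ParSSP`. -/
def paramL (r : ℕ) (ε : ℝ) : ℕ := ⌈Real.logb (1 - ε) (ε / r)⌉₊ + 1

/-- An element `u` that maximizes `g {u}`. -/
def bestElement {N : Type u} [Fintype N] [Nonempty N] (g : Finset N → ℝ) : N :=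
  (Finite.exists_max fun u : N => g {u}).choose

open Classical in
/-- `ParSSP(p, ε, f)` for the constraint `indep`, with every while-loop of `RandBatch` cut off
according to `t`. -/
def parSSP {N : Type u} [Fintype N] [DecidableEq N] [Nonempty N] (mode : SearchMode)
    (indep : Finset N → Prop) (p : unitInterval) (ε : ℝ) (t : ℕ) : Comp N (Finset N) :=
  .ask (Finset.univ.image fun u : N => {u}) fun g =>
  let ustar := bestElement g
  (parSSPLoop mode indep (g {ustar}) (paramM (rank indep) ε) p ε t
    (paramL (rank indep) ε) 0 ∅ Finset.univ).bind fun T =>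
  .ask {T, {ustar}} fun g' =>
  .pure (if g' {ustar} ≤ g' T then T else {ustar})

end ParSSP

end

open scoped ENNReal

noncomputable section

namespace ParSSP

/-! ### Averages over the orderings of a finite set -/

/-! Write `s = √(k+1)`, so `p = 1/(1+s)`. For the output `T` of the for-loop, submodularity gives
`f(O ∪ T) ≤ f(T) + ∑_{u ∈ O \ T} f(u ∣ T)`. Every element is considered for acceptance at most once
and then kept with probability `p`, so `Submodular.sampling`, applied to `f(O ∪ ·)`, bounds the
expected left side below by `(1 - p) f(O)`. It remains to bound the sum of marginals by about `κ
f(T)` in expectation, with `κ = (k + s)/(1 - ε)^3`.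

This is the task of `potential`. Let `B` be the current solution, `J` the candidates not yet
considered or discarded, and `σ = ρ/(1 - ε)` a bound on the marginals of the candidates that still
fit. The potential is `κ f(B)`, minus the marginals of the elements of `O` that are settled (no
longer in `J`, or blocked), minus `σ (k|B| - |blocked|)`. Accepting a batch `R` changes it by at
least `κ (f(B ∪ R) - f(B)) - σk|R|`, because every newly blocked element costs at most `σ` and is
refunded `σ`; rejecting costs at most `σ|R|`. By `le_ex_getSEQ_batch` the gain from adding the batch
to `B` is in expectation at least `(1 - ε)^2 ρ` times its expected size, and `κ` is the value for
which the two effects cancel (`Batch.potential_step`). In a k-system `|blocked| ≤ k|B|`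
(`IsKSystem.card_blocked_le`), so the last term only helps at the end and lowering `σ` between
phases never hurts.

The expected gain is an optional stopping argument. `GetSEQ` continues a sequence by a uniformly
random feasible element. As long as neither stopping condition holds, more than a fraction `1 - ε`
of `L` has gain at least `ρ`, and the negative gains consume less than a fraction `ε` of the total,
so the average gain is at least `(1 - ε)^2 ρ`. Whether to stop at `i` depends only on the first `i`
elements.

A phase may end with candidates left because the counter has reached `M`. Each increment of the
counter certifies negative marginals worth `ε ∑_L f(u ∣ B)`. `Batch.exists_charge` collects them
into sets `W ⊆ B ⊆ X` with `f(W) - f(X)` at least the collected amount. Since `f(W) ≤ f(O)` and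
`f(X) ≥ 0`, the leftover is worth at most `f(O)/(Mε)`, and `M` is so large that the `ℓ` phases lose
at most `ε f(O)`. Candidates that survive the last threshold lose another `ε f(u*)`. `ratio_bound`
turns the resulting inequality into the stated ratio.

For the cost, an accepted batch either increments the counter or shrinks `L` by the factor `1 - ε`,
so a phase accepts `O(log n)` batches. Each iteration accepts with probability `p`, which gives
`O(log n / p)` expected iterations per phase (`Batch.cst_loop_le`). A run cut off at `t` has made at
least `t` rounds, so by Markov's inequality aborts become negligible; this yields almost sure
termination and carries the guarantee from the truncated programs to the limit. -/

open Classical in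
/-- The finite set of all orderings of `s`. -/
def orderings {N : Type u} (s : Finset N) : Finset (List N) :=
  s.toList.permutations.toFinset

/-- The average of `h` over all orderings of `s`. -/
def ordAvg {N : Type u} (s : Finset N) (h : List N → ℝ) : ℝ :=
  ∑ l ∈ orderings s, ((orderings s).card : ℝ)⁻¹ * h l

theorem mem_orderings {N : Type u} {s : Finset N} {l : List N} :
    l ∈ orderings s ↔ l.Perm s.toList := by
  simp [orderings, List.mem_permutations]

theorem orderings_nonempty {N : Type u} (s : Finset N) : (orderings s).Nonempty :=
  ⟨s.toList, mem_orderings.2 (List.Perm.refl _)⟩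

theorem uniformOrdering_eq {N : Type u} (s : Finset N) :
    uniformOrdering s = PMF.uniformOfFinset (orderings s) (orderings_nonempty s) := rfl

theorem nodup_of_mem_orderings {N : Type u} {s : Finset N} {l : List N} (h : l ∈ orderings s) :
    l.Nodup :=
  (mem_orderings.1 h).nodup_iff.2 s.nodup_toList

theorem mem_iff_of_mem_orderings {N : Type u} {s : Finset N} {l : List N} (h : l ∈ orderings s)
    (a : N) : a ∈ l ↔ a ∈ s := by
  rw [(mem_orderings.1 h).mem_iff, Finset.mem_toList]

theorem mem_orderings_iff {N : Type u} {s : Finset N} {l : List N} :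
    l ∈ orderings s ↔ l.Nodup ∧ ∀ a, a ∈ l ↔ a ∈ s := by
  refine ⟨fun h => ⟨nodup_of_mem_orderings h, mem_iff_of_mem_orderings h⟩, fun h => ?_⟩
  rw [mem_orderings, List.perm_ext_iff_of_nodup h.1 s.nodup_toList]
  simpa using h.2

theorem card_orderings_pos {N : Type u} (s : Finset N) : 0 < ((orderings s).card : ℝ) := by
  exact_mod_cast (orderings_nonempty s).card_pos

theorem card_orderings {N : Type u} (s : Finset N) : (orderings s).card = s.card.factorial := by
  classical
  rw [orderings, List.toFinset_card_of_nodup (List.nodup_permutations _ s.nodup_toList),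
    List.length_permutations, Finset.length_toList]

theorem ordAvg_const {N : Type u} (s : Finset N) (x : ℝ) : ordAvg s (fun _ => x) = x := by
  have := card_orderings_pos s
  rw [ordAvg, Finset.sum_const, nsmul_eq_mul]
  field_simp

theorem ordAvg_mono {N : Type u} (s : Finset N) {h h' : List N → ℝ}
    (hh : ∀ l ∈ orderings s, h l ≤ h' l) : ordAvg s h ≤ ordAvg s h' :=
  Finset.sum_le_sum fun l hl =>
    mul_le_mul_of_nonneg_left (hh l hl) (inv_nonneg.2 (card_orderings_pos s).le)

theorem ordAvg_linear {N : Type u} (s : Finset N) (h h' : List N → ℝ) (x y : ℝ) :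
    ordAvg s (fun l => x * h l + y * h' l) = x * ordAvg s h + y * ordAvg s h' := by
  simp only [ordAvg, Finset.mul_sum, ← Finset.sum_add_distrib]
  exact Finset.sum_congr rfl fun l _ => by ring

/-- A uniformly random ordering starts with a uniformly random element, which is followed by a
uniformly random ordering of the others. -/
theorem card_mul_ordAvg {N : Type u} [DecidableEq N] (s : Finset N) (hs : s.Nonempty)
    (h : List N → ℝ) :
    (s.card : ℝ) * ordAvg s h = ∑ a ∈ s, ordAvg (s.erase a) fun l => h (a :: l) := by
  have hsum : ∑ l ∈ orderings s, h l = ∑ a ∈ s, ∑ l ∈ orderings (s.erase a), h (a :: l) := by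
    rw [Finset.sum_sigma']
    symm
    refine Finset.sum_bij (fun x _ => x.1 :: x.2) ?_ ?_ ?_ ?_
    · rintro ⟨a, l⟩ hx
      obtain ⟨ha, hl⟩ := Finset.mem_sigma.1 hx
      rw [mem_orderings_iff] at hl ⊢
      refine ⟨List.nodup_cons.2 ⟨fun h => ?_, hl.1⟩, fun b => ?_⟩
      · simpa using (hl.2 a).1 h
      · by_cases hb : b = a
        · subst hb; simpa using ha
        · simp [hb, hl.2 b]
    · rintro ⟨a, l⟩ _ ⟨b, l'⟩ _ hab
      simp only [List.cons.injEq] at hab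
      obtain ⟨rfl, rfl⟩ := hab
      rfl
    · intro l hl
      rw [mem_orderings_iff] at hl
      obtain ⟨b, hb⟩ := hs
      cases l with
      | nil => exact absurd ((hl.2 b).2 hb) (by simp)
      | cons a l =>
        have hn := List.nodup_cons.1 hl.1
        refine ⟨⟨a, l⟩, Finset.mem_sigma.2 ⟨(hl.2 a).1 (by simp), mem_orderings_iff.2
          ⟨hn.2, fun c => ?_⟩⟩, rfl⟩
        simp only [Finset.mem_erase, ← hl.2 c, List.mem_cons]
        constructor
        · intro hc
          exact ⟨fun h => hn.1 (h ▸ hc), Or.inr hc⟩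
        · rintro ⟨h1, h2⟩
          exact h2.resolve_left h1
    · intro x _
      rfl
  have hpos : 0 < s.card := hs.card_pos
  simp only [ordAvg, ← Finset.mul_sum, hsum]
  have hc : ∀ a ∈ s, ((orderings (s.erase a)).card : ℝ)⁻¹ * ∑ l ∈ orderings (s.erase a), h (a :: l)
      = ((s.card - 1).factorial : ℝ)⁻¹ * ∑ l ∈ orderings (s.erase a), h (a :: l) := by
    intro a ha
    rw [card_orderings, Finset.card_erase_of_mem ha]
  rw [Finset.sum_congr rfl hc, ← Finset.mul_sum, card_orderings, ← mul_assoc]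
  congr 1
  rw [← Nat.mul_factorial_pred hpos.ne']
  have h1 : (s.card : ℝ) ≠ 0 := by exact_mod_cast hpos.ne'
  push_cast
  field_simp

/-! ### Expectations -/

namespace Comp

variable {N : Type u} {α : Type v} {β : Type w} [DecidableEq N]

/-- The expectation of `h` applied to the result, where an aborted run counts with the value `z`. -/
def ex (f : Finset N → ℝ) (z : ℝ) : Comp N α → (α → ℝ) → ℝ
  | .pure a, h => h a
  | .abort, _ => z
  | .ask Q next, h => ex f z (next (answers f Q)) h
  | .flip p next, h => (p : ℝ) * ex f z (next true) h + (1 - p) * ex f z (next false) h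
  | .shuffle s next, h => ordAvg s fun l => ex f z (next l) h

/-- The expectation of the sum of `w q` over all rounds, where `q` is the number of queries made in
the round. -/
def cst (f : Finset N → ℝ) (w : ℕ → ℝ) : Comp N α → ℝ
  | .pure _ => 0
  | .abort => 0
  | .ask Q next => w Q.card + cst f w (next (answers f Q))
  | .flip p next => (p : ℝ) * cst f w (next true) + (1 - p) * cst f w (next false)
  | .shuffle s next => ordAvg s fun l => cst f w (next l)

/-- In every run, each round has at most `b` queries, and the result satisfies `P`. -/
def Safe (f : Finset N → ℝ) (b : ℕ) (P : α → Prop) : Comp N α → Prop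
  | .pure a => P a
  | .abort => True
  | .ask Q next => Q.card ≤ b ∧ Safe f b P (next (answers f Q))
  | .flip _ next => ∀ x, Safe f b P (next x)
  | .shuffle s next => ∀ l ∈ orderings s, Safe f b P (next l)

/-- Every aborted run has at least `t` rounds. -/
def AbortsAfter (f : Finset N → ℝ) : ℕ → Comp N α → Prop
  | _, .pure _ => True
  | t, .abort => t = 0
  | t, .ask Q next => AbortsAfter f (t - 1) (next (answers f Q))
  | t, .flip _ next => ∀ x, AbortsAfter f t (next x)
  | t, .shuffle s next => ∀ l ∈ orderings s, AbortsAfter f t (next l)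

variable {f : Finset N → ℝ}

theorem ex_bind (z : ℝ) (c : Comp N α) (g : α → Comp N β) (h : β → ℝ) :
    (c.bind g).ex f z h = c.ex f z fun a => (g a).ex f z h := by
  induction c with
  | pure a => rfl
  | abort => rfl
  | ask Q next ih => simp only [bind, ex, ih]
  | flip p next ih => simp only [bind, ex, ih]
  | shuffle s next ih => simp only [bind, ex, ih]

/-- `Safe` serves as a description of the support: a comparison is needed only for results that can
occur. -/
theorem ex_mono {b : ℕ} {P : α → Prop} {z z' : ℝ} (hz : z ≤ z') {c : Comp N α}
    (hc : c.Safe f b P) {h h' : α → ℝ} (hh : ∀ a, P a → h a ≤ h' a) :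
    c.ex f z h ≤ c.ex f z' h' := by
  induction c with
  | pure a => exact hh a hc
  | abort => exact hz
  | ask Q next ih => exact ih _ hc.2
  | flip p next ih =>
    have := p.2.1
    have := p.2.2
    exact add_le_add (mul_le_mul_of_nonneg_left (ih _ (hc _)) p.2.1)
      (mul_le_mul_of_nonneg_left (ih _ (hc _)) (sub_nonneg.2 p.2.2))
  | shuffle s next ih => exact ordAvg_mono s fun l hl => ih l (hc l hl)

theorem ex_congr {b : ℕ} {P : α → Prop} {z : ℝ} {c : Comp N α}
    (hc : c.Safe f b P) {h h' : α → ℝ} (hh : ∀ a, P a → h a = h' a) :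
    c.ex f z h = c.ex f z h' :=
  le_antisymm (ex_mono le_rfl hc fun a ha => (hh a ha).le)
    (ex_mono le_rfl hc fun a ha => (hh a ha).ge)

theorem ex_mono' {z z' : ℝ} (hz : z ≤ z') (c : Comp N α) {h h' : α → ℝ} (hh : ∀ a, h a ≤ h' a) :
    c.ex f z h ≤ c.ex f z' h' := by
  induction c with
  | pure a => exact hh a
  | abort => exact hz
  | ask Q next ih => exact ih _
  | flip p next ih =>
    exact add_le_add (mul_le_mul_of_nonneg_left (ih _) p.2.1)
      (mul_le_mul_of_nonneg_left (ih _) (sub_nonneg.2 p.2.2))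
  | shuffle s next ih => exact ordAvg_mono s fun l hl => ih l

theorem ex_const (z : ℝ) (c : Comp N α) : c.ex f z (fun _ => z) = z := by
  induction c with
  | pure a => rfl
  | abort => rfl
  | ask Q next ih => exact ih _
  | flip p next ih => simp only [ex, ih]; ring
  | shuffle s next ih => simp only [ex, ih, ordAvg_const]

theorem ex_linear (c : Comp N α) (h h' : α → ℝ) (z z' x y : ℝ) :
    c.ex f (x * z + y * z') (fun a => x * h a + y * h' a) =
      x * c.ex f z h + y * c.ex f z' h' := by
  induction c with
  | pure a => rfl
  | abort => rfl
  | ask Q next ih => exact ih _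
  | flip p next ih => simp only [ex, ih]; ring
  | shuffle s next ih => simp only [ex, ih, ordAvg_linear]

theorem ex_nonneg (c : Comp N α) {h : α → ℝ} (hh : ∀ a, 0 ≤ h a) : 0 ≤ c.ex f 0 h := by
  have := ex_mono' (f := f) (le_refl (0 : ℝ)) c hh
  rwa [ex_const] at this

theorem ex_add (c : Comp N α) (h h' : α → ℝ) (z z' : ℝ) :
    c.ex f (z + z') (fun a => h a + h' a) = c.ex f z h + c.ex f z' h' := by
  simpa using ex_linear (f := f) c h h' z z' 1 1

theorem ex_mul (c : Comp N α) (h : α → ℝ) (z x : ℝ) :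
    c.ex f (x * z) (fun a => x * h a) = x * c.ex f z h := by
  simpa using ex_linear (f := f) c h h z z x 0

/-- Splitting off the probability `c.ex f 1 0` of an abort. -/
theorem ex_eq_add_abort (c : Comp N α) (h : α → ℝ) (z : ℝ) :
    c.ex f z h = c.ex f 0 h + z * c.ex f 1 fun _ => 0 := by
  simpa using ex_linear (f := f) c h (fun _ => 0) 0 1 1 z

theorem ex_one_add_abort (c : Comp N α) :
    (c.ex f 0 fun _ => 1) + (c.ex f 1 fun _ => 0) = 1 := by
  have h := ex_eq_add_abort (f := f) c (fun _ => 1) 1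
  rw [ex_const] at h
  linarith

theorem ex_finset_sum {ι : Type*} (t : Finset ι) (c : Comp N α) (h : ι → α → ℝ) :
    c.ex f 0 (fun a => ∑ i ∈ t, h i a) = ∑ i ∈ t, c.ex f 0 (h i) := by
  classical
  induction t using Finset.induction_on with
  | empty => simpa using ex_const (f := f) 0 c
  | insert i t hi ih =>
    simp only [Finset.sum_insert hi]
    rw [← ih, ← ex_add, add_zero]

/-- An aborted run never reaches the continuation, hence the abort value `0` in the second term. -/
theorem cst_bind (w : ℕ → ℝ) (c : Comp N α) (g : α → Comp N β) :
    (c.bind g).cst f w = c.cst f w + c.ex f 0 fun a => (g a).cst f w := by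
  induction c with
  | pure a => simp [bind, cst, ex]
  | abort => simp [bind, cst, ex]
  | ask Q next ih => simp only [bind, cst, ex, ih]; ring
  | flip p next ih => simp only [bind, cst, ex, ih]; ring
  | shuffle s next ih =>
    simp only [bind, cst, ex, ih]
    simpa using ordAvg_linear s (fun l => (next l).cst f w)
      (fun l => (next l).ex f 0 fun a => (g a).cst f w) 1 1

theorem cst_nonneg {w : ℕ → ℝ} (hw : ∀ q, 0 ≤ w q) (c : Comp N α) : 0 ≤ c.cst f w := by
  induction c with
  | pure a => exact le_rfl
  | abort => exact le_rfl
  | ask Q next ih => exact add_nonneg (hw _) (ih _)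
  | flip p next ih =>
    exact add_nonneg (mul_nonneg p.2.1 (ih _)) (mul_nonneg (sub_nonneg.2 p.2.2) (ih _))
  | shuffle s next ih =>
    have := ordAvg_mono s (h := fun _ => 0) fun l _ => ih l
    rwa [ordAvg_const] at this

theorem Safe.bind {b : ℕ} {P : α → Prop} {P' : β → Prop} {c : Comp N α} {g : α → Comp N β}
    (hc : c.Safe f b P) (hg : ∀ a, P a → (g a).Safe f b P') : (c.bind g).Safe f b P' := by
  induction c with
  | pure a => exact hg a hc
  | abort => trivial
  | ask Q next ih => exact ⟨hc.1, ih _ hc.2⟩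
  | flip p next ih => exact fun x => ih x (hc x)
  | shuffle s next ih => exact fun l hl => ih l (hc l hl)

theorem AbortsAfter.mono {c : Comp N α} : ∀ {t t' : ℕ}, t' ≤ t → c.AbortsAfter f t →
    c.AbortsAfter f t' := by
  induction c with
  | pure a => intros; trivial
  | abort => intro t t' h h'; simp only [AbortsAfter] at *; omega
  | ask Q next ih => intro t t' h h'; exact ih _ (by omega) h'
  | flip p next ih => intro t t' h h' x; exact ih _ h (h' x)
  | shuffle s next ih => intro t t' h h' l hl; exact ih _ h (h' l hl)

theorem AbortsAfter.bind {c : Comp N α} {g : α → Comp N β} : ∀ {t : ℕ}, c.AbortsAfter f t →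
    (∀ a, (g a).AbortsAfter f t) → (c.bind g).AbortsAfter f t := by
  induction c with
  | pure a => exact fun _ hg => hg a
  | abort => exact fun h _ => h
  | ask Q next ih => exact fun h hg => ih _ h fun a => (hg a).mono (Nat.sub_le _ _)
  | flip p next ih => exact fun h hg x => ih _ (h x) hg
  | shuffle s next ih => exact fun h hg l hl => ih _ (h l hl) hg

theorem ex_abort_nonneg (c : Comp N α) : 0 ≤ c.ex f 1 fun _ => 0 := by
  have := ex_mono' (f := f) (zero_le_one (α := ℝ)) c (h := fun _ => 0) fun _ => le_rfl
  rwa [ex_const] at this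

theorem ex_abort_le_one (c : Comp N α) : (c.ex f 1 fun _ => 0) ≤ 1 := by
  have := ex_mono' (f := f) (le_refl (1 : ℝ)) c (h := fun _ => 0) (h' := fun _ => 1)
    fun _ => zero_le_one
  rwa [ex_const] at this

/-- Markov's inequality for the number of rounds. -/
theorem AbortsAfter.mul_ex_le {c : Comp N α} : ∀ {t : ℕ}, c.AbortsAfter f t →
    (t : ℝ) * (c.ex f 1 fun _ => 0) ≤ c.cst f fun _ => 1 := by
  induction c with
  | pure a => intro t _; simp [ex, cst]
  | abort => intro t h; simp only [AbortsAfter] at h; simp [h, cst]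
  | ask Q next ih =>
    intro t h
    have h1 := ih _ h
    have h2 := ex_abort_le_one (f := f) (next (answers f Q))
    have h3 := ex_abort_nonneg (f := f) (next (answers f Q))
    simp only [ex, cst]
    -- Only an inequality, because the subtraction truncates at `t = 0`. The abort probability is at
    -- most `1`, so the unit lost from `t` is paid by the present round.
    have h4 : (t : ℝ) ≤ ((t - 1 : ℕ) : ℝ) + 1 := by exact_mod_cast (by omega : t ≤ t - 1 + 1)
    nlinarith
  | flip p next ih =>
    intro t h
    have h1 := mul_le_mul_of_nonneg_left (ih _ (h true)) p.2.1
    have h2 := mul_le_mul_of_nonneg_left (ih _ (h false)) (sub_nonneg.2 p.2.2)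
    simp only [ex, cst]
    linarith
  | shuffle s next ih =>
    intro t h
    simp only [ex, cst]
    have h1 := ordAvg_mono s fun l hl => ih l (h l hl)
    have h2 := ordAvg_linear s (fun l => (next l).ex f 1 fun _ => 0) (fun _ => 0) t 0
    simp only [zero_mul, add_zero] at h2
    linarith

/-- A computation that never aborts. -/
theorem ex_eq_of_abortsAfter {c : Comp N α} (hc : ∀ t, c.AbortsAfter f t) (z z' : ℝ) {h : α → ℝ} :
    c.ex f z h = c.ex f z' h := by
  have h0 : (c.ex f 1 fun _ => 0) = 0 := by
    refine le_antisymm (le_of_not_gt fun hpos => ?_) (ex_abort_nonneg c)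
    obtain ⟨t, ht⟩ := exists_nat_gt ((c.cst f fun _ => 1) / c.ex f 1 fun _ => 0)
    rw [div_lt_iff₀ hpos] at ht
    exact absurd (hc t).mul_ex_le (not_le.2 ht)
  rw [ex_eq_add_abort c h z, ex_eq_add_abort c h z', h0, mul_zero, mul_zero]

/-! ### The law of a run -/

theorem tsum_run_pure (a : α) (F : Option α × Cost → ℝ≥0∞) :
    ∑' ω, (Comp.pure a : Comp N α).run f ω * F ω = F (some a, ⟨0, 0, 0⟩) := by
  rw [tsum_eq_single (some a, ⟨0, 0, 0⟩)]
  · simp [run]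
  · intro ω hω
    simp [run, PMF.pure_apply, hω]

theorem tsum_bind_mul {γ δ : Type*} (q : PMF γ) (g : γ → PMF δ) (F : δ → ℝ≥0∞) :
    ∑' y, (q.bind g) y * F y = ∑' x, q x * ∑' y, g x y * F y := by
  simp only [PMF.bind_apply, ← ENNReal.tsum_mul_right, ← ENNReal.tsum_mul_left]
  rw [ENNReal.tsum_comm]
  simp only [mul_assoc]

theorem tsum_map_mul {γ δ : Type*} (q : PMF γ) (g : γ → δ) (F : δ → ℝ≥0∞) :
    ∑' y, (q.map g) y * F y = ∑' x, q x * F (g x) := by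
  rw [PMF.map, tsum_bind_mul]
  refine tsum_congr fun x => ?_
  congr 1
  rw [tsum_eq_single (g x)]
  · simp
  · intro y hy
    simp [PMF.pure_apply, hy]

theorem tsum_coin_mul (p : unitInterval) (F : Bool → ℝ) (hF : ∀ x, 0 ≤ F x) :
    ∑' x, coin p x * ENNReal.ofReal (F x) =
      ENNReal.ofReal ((p : ℝ) * F true + (1 - p) * F false) := by
  have h0 := p.2.1
  have h1 := sub_nonneg.2 p.2.2
  rw [tsum_bool, ENNReal.ofReal_add (mul_nonneg h0 (hF _)) (mul_nonneg h1 (hF _)),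
    ENNReal.ofReal_mul h0, ENNReal.ofReal_mul h1, add_comm]
  simp [coin]

theorem tsum_uniformOrdering_mul {M : Type u} (s : Finset M) (F : List M → ℝ) (hF : ∀ l, 0 ≤ F l) :
    ∑' l, uniformOrdering s l * ENNReal.ofReal (F l) = ENNReal.ofReal (ordAvg s F) := by
  have hc := card_orderings_pos s
  rw [ordAvg, ENNReal.ofReal_sum_of_nonneg fun l _ => mul_nonneg (inv_nonneg.2 hc.le) (hF l),
    tsum_eq_sum (s := orderings s)]
  · refine Finset.sum_congr rfl fun l hl => ?_
    rw [ENNReal.ofReal_mul (inv_nonneg.2 hc.le), ENNReal.ofReal_inv_of_pos hc,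
      ENNReal.ofReal_natCast, uniformOrdering_eq, PMF.uniformOfFinset_apply_of_mem _ hl]
  · intro l hl
    rw [uniformOrdering_eq, PMF.uniformOfFinset_apply_of_notMem _ hl, zero_mul]

/-- Together with `tsum_run_cost` this is the bridge between the measure-theoretic semantics `run`
and the real-valued recursions `ex` and `cst`, in which everything else is done. -/
theorem tsum_run_result (c : Comp N α) (h : α → ℝ) (hh : ∀ a, 0 ≤ h a) :
    ∑' ω, c.run f ω * (ω.1.elim 0 fun a => ENNReal.ofReal (h a)) =
      ENNReal.ofReal (c.ex f 0 h) := by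
  induction c with
  | pure a => rw [tsum_run_pure]; rfl
  | abort =>
    rw [tsum_eq_single (none, ⟨0, 0, 0⟩)]
    · simp [ex]
    · intro ω hω
      simp [run, PMF.pure_apply, hω]
  | ask Q next ih => rw [run, tsum_map_mul]; exact ih _
  | flip p next ih =>
    rw [run, tsum_bind_mul]
    simp only [ih]
    exact tsum_coin_mul p _ fun x => ex_nonneg _ hh
  | shuffle s next ih =>
    rw [run, tsum_bind_mul]
    simp only [ih]
    exact tsum_uniformOrdering_mul s _ fun x => ex_nonneg _ hh

/-- Covers both cost measures: `w = 1` counts rounds and `w = id` counts queries. -/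
theorem tsum_run_cost (cost : Cost → ℕ) (w : ℕ → ℕ) (h0 : cost ⟨0, 0, 0⟩ = 0)
    (hadd : ∀ q c, cost (Cost.addRound q c) = w q + cost c) (c : Comp N α) :
    ∑' ω, c.run f ω * (cost ω.2 : ℝ≥0∞) = ENNReal.ofReal (c.cst f fun q => (w q : ℝ)) := by
  have hw : ∀ q, (0 : ℝ) ≤ w q := fun q => Nat.cast_nonneg _
  induction c with
  | pure a => rw [tsum_run_pure]; simp [cst, h0]
  | abort =>
    rw [tsum_eq_single (none, ⟨0, 0, 0⟩)]
    · simp [cst, h0]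
    · intro ω hω
      simp [run, PMF.pure_apply, hω]
  | ask Q next ih =>
    rw [run, tsum_map_mul]
    simp only [hadd, Nat.cast_add, mul_add]
    rw [ENNReal.tsum_add, ih, ENNReal.tsum_mul_right, PMF.tsum_coe, one_mul, cst,
      ENNReal.ofReal_add (hw _) (cst_nonneg hw _), ENNReal.ofReal_natCast]
  | flip p next ih =>
    rw [run, tsum_bind_mul]
    simp only [ih]
    exact tsum_coin_mul p _ fun x => cst_nonneg hw _
  | shuffle s next ih =>
    rw [run, tsum_bind_mul]
    simp only [ih]
    exact tsum_uniformOrdering_mul s _ fun x => cst_nonneg hw _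

theorem Safe.of_mem_support {b : ℕ} {P : α → Prop} {c : Comp N α} (hc : c.Safe f b P) :
    ∀ ω ∈ (c.run f).support, ω.2.width ≤ b ∧ ∀ a, ω.1 = some a → P a := by
  induction c with
  | pure a =>
    intro ω hω
    simp only [run, PMF.support_pure, Set.mem_singleton_iff] at hω
    subst hω
    refine ⟨Nat.zero_le _, fun a' h => ?_⟩
    simp only [Option.some.injEq] at h
    exact h ▸ hc
  | abort =>
    intro ω hω
    simp only [run, PMF.support_pure, Set.mem_singleton_iff] at hω
    subst hω
    exact ⟨Nat.zero_le _, fun a' h => by simp at h⟩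
  | ask Q next ih =>
    intro ω hω
    simp only [run, PMF.support_map, Set.mem_image] at hω
    obtain ⟨ω', hω', rfl⟩ := hω
    have := ih _ hc.2 ω' hω'
    exact ⟨max_le hc.1 this.1, this.2⟩
  | flip p next ih =>
    intro ω hω
    rw [run, PMF.mem_support_bind_iff] at hω
    obtain ⟨x, _, hx⟩ := hω
    exact ih x (hc x) ω hx
  | shuffle s next ih =>
    intro ω hω
    rw [run, PMF.mem_support_bind_iff] at hω
    obtain ⟨l, hl, hx⟩ := hω
    refine ih l (hc l ?_) ω hx
    rwa [uniformOrdering_eq, PMF.mem_support_uniformOfFinset_iff] at hl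

end Comp

/-! ### Submodular functions and independence systems -/

theorem card_le_rank {N : Type u} [Fintype N] {indep : Finset N → Prop} {X : Finset N}
    (hX : indep X) : X.card ≤ rank indep := by
  classical
  exact Finset.le_sup (f := Finset.card) (Finset.mem_filter.2 ⟨Finset.mem_univ _, hX⟩)

theorem rank_le_card {N : Type u} [Fintype N] (indep : Finset N → Prop) :
    rank indep ≤ Fintype.card N := by
  classical
  exact Finset.sup_le fun X _ => Finset.card_le_univ X

section Basic

variable {N : Type u} [DecidableEq N] {f : Finset N → ℝ} {indep : Finset N → Prop}

/-- That `u` lies outside `Y` is essential: inside `Y` the marginal is `0`, which exceeds a negative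
marginal at `X`. This is why disjointness is tracked throughout. -/
theorem Submodular.marg_anti (hf : Submodular f) {X Y : Finset N} (hXY : X ⊆ Y) {u : N}
    (hu : u ∉ Y) : marg f u Y ≤ marg f u X := by
  have h := hf (insert u X) Y
  have h1 : insert u X ∪ Y = insert u Y := by
    rw [Finset.insert_union, Finset.union_eq_right.2 hXY]
  have h2 : insert u X ∩ Y = X := by
    rw [Finset.insert_inter_of_notMem hu, Finset.inter_eq_left.2 hXY]
  rw [h1, h2] at h
  unfold marg
  linarith

theorem marg_of_mem {u : N} {X : Finset N} (h : u ∈ X) : marg f u X = 0 := by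
  simp [marg, h]

/-- Adding a set changes the value by at most the sum of the marginal gains. -/
theorem Submodular.union_le (hf : Submodular f) (X S : Finset N) :
    f (X ∪ S) ≤ f X + ∑ u ∈ S \ X, marg f u X := by
  have key : ∀ R : Finset N, Disjoint R X → f (X ∪ R) ≤ f X + ∑ u ∈ R, marg f u X := by
    intro R
    induction R using Finset.induction_on with
    | empty => simp
    | insert a R ha ih =>
      intro hd
      rw [Finset.disjoint_insert_left] at hd
      rw [Finset.sum_insert ha, Finset.union_insert]
      have h1 := ih hd.2
      have h2 := hf.marg_anti (u := a) (Finset.subset_union_left (s₁ := X) (s₂ := R))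
        (by simp [hd.1, ha])
      have h3 : marg f a (X ∪ R) = f (insert a (X ∪ R)) - f (X ∪ R) := rfl
      linarith
  have := key (S \ X) Finset.sdiff_disjoint
  rwa [Finset.union_sdiff_self_eq_union] at this

theorem exists_isBase {X Y : Finset N}
    (hX : indep X) (hXY : X ⊆ Y) : ∃ Z, X ⊆ Z ∧ IsBase indep Z Y := by
  classical
  have hne : (Y.powerset.filter fun Z => indep Z ∧ X ⊆ Z).Nonempty :=
    ⟨X, by simp [hX, hXY]⟩
  obtain ⟨Z, hZ, hmax⟩ := Finset.exists_max_image _ Finset.card hne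
  simp only [Finset.mem_filter, Finset.mem_powerset] at hZ hmax
  refine ⟨Z, hZ.2.2, hZ.1, hZ.2.1, fun u hu hind => ?_⟩
  rw [Finset.mem_sdiff] at hu
  have := hmax (insert u Z) ⟨Finset.insert_subset hu.1 hZ.1, hind,
    hZ.2.2.trans (Finset.subset_insert _ _)⟩
  rw [Finset.card_insert_of_notMem hu.2] at this
  omega

open Classical in
/-- The elements of `O` outside `B` that cannot be added to `B`. -/
def blocked (indep : Finset N → Prop) (O B : Finset N) : Finset N :=
  O.filter fun u => u ∉ B ∧ ¬ indep (insert u B)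

theorem mem_blocked {O B : Finset N} {u : N} :
    u ∈ blocked indep O B ↔ u ∈ O ∧ u ∉ B ∧ ¬ indep (insert u B) := by
  simp [blocked]

/-- The blocked elements cannot be added, so `B` is a base of `B ∪ blocked`. The blocked elements
are independent as a subset of `O` and extend to another base of the same set; the two sizes differ
by a factor of at most `k`. -/
theorem IsKSystem.card_blocked_le {k : ℕ} (hk : IsKSystem k indep) {O B : Finset N}
    (hO : indep O) (hB : indep B) : (blocked indep O B).card ≤ k * B.card := by
  have hb : indep (blocked indep O B) :=
    hk.system.subset _ O (fun u hu => (mem_blocked.1 hu).1) hO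
  obtain ⟨Z, hZ, hbase⟩ := exists_isBase (Y := B ∪ blocked indep O B) hb
    Finset.subset_union_right
  refine (Finset.card_le_card hZ).trans (hk.card_base_le _ _ _ hbase
    ⟨Finset.subset_union_left, hB, fun u hu => ?_⟩)
  rw [Finset.mem_sdiff, Finset.mem_union] at hu
  exact (mem_blocked.1 (hu.1.resolve_left hu.2)).2.2

end Basic

/-! ### The random sequences of `GetSEQ` -/

section GetSEQ

variable {N : Type u} [DecidableEq N] {f : Finset N → ℝ} {indep : Finset N → Prop}
  {B L : Finset N}

open Classical in
/-- The elements of `L` by which the sequence `V` can be continued. -/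
def extensions (indep : Finset N → Prop) (B L : Finset N) (V : List N) : Finset N :=
  L.filter fun u => u ∉ V ∧ indep (insert u (B ∪ V.toFinset))

theorem mem_extensions {V : List N} {u : N} :
    u ∈ extensions indep B L V ↔ u ∈ L ∧ u ∉ V ∧ indep (insert u (B ∪ V.toFinset)) := by
  simp [extensions]

/-- `V` consists of distinct elements of `L` that can be added to `B`. -/
structure IsSeq (indep : Finset N → Prop) (B L : Finset N) (V : List N) : Prop where
  nodup : V.Nodup
  mem : ∀ u ∈ V, u ∈ L
  indep : indep (B ∪ V.toFinset)

theorem union_toFinset_append (B : Finset N) (V : List N) (l : List N) :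
    B ∪ (V ++ l).toFinset = B ∪ V.toFinset ∪ l.toFinset := by
  rw [List.toFinset_append, Finset.union_assoc]

theorem union_toFinset_concat (B : Finset N) (V : List N) (u : N) :
    B ∪ (V ++ [u]).toFinset = insert u (B ∪ V.toFinset) := by
  ext a; simp

theorem IsSeq.concat {V : List N} (hV : IsSeq indep B L V) {u : N}
    (hu : u ∈ extensions indep B L V) : IsSeq indep B L (V ++ [u]) := by
  rw [mem_extensions] at hu
  refine ⟨?_, ?_, ?_⟩
  · rw [List.nodup_append]
    refine ⟨hV.nodup, List.nodup_singleton _, ?_⟩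
    rintro a ha b hb rfl
    rw [List.mem_singleton] at hb
    exact hu.2.1 (hb ▸ ha)
  · intro a ha
    rw [List.mem_append, List.mem_singleton] at ha
    rcases ha with ha | rfl
    exacts [hV.mem a ha, hu.1]
  · rw [union_toFinset_concat]
    exact hu.2.2

open Classical in
/-- The length of the longest prefix of `l` that can be added to `C`. -/
def passLength (indep : Finset N → Prop) (C : Finset N) (l : List N) : ℕ :=
  Nat.findGreatest (fun i => indep (C ∪ (l.take i).toFinset)) l.length

theorem passLength_cons {C : Finset N} {a : N} (l : List N)
    (h : indep (insert a C)) :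
    passLength indep C (a :: l) = passLength indep (insert a C) l + 1 := by
  classical
  have hset : ∀ i, C ∪ ((a :: l).take (i + 1)).toFinset = insert a C ∪ (l.take i).toFinset := by
    intro i; ext b; simp
  unfold passLength
  rw [Nat.findGreatest_eq_iff]
  refine ⟨by simpa using Nat.findGreatest_le _, fun _ => ?_, fun n hn hn' => ?_⟩
  · rw [hset]
    exact Nat.findGreatest_spec (P := fun i => indep (insert a C ∪ (l.take i).toFinset))
      (Nat.zero_le _) (by simpa using h)
  · obtain ⟨m, rfl⟩ : ∃ m, n = m + 1 := ⟨n - 1, by omega⟩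
    rw [hset]
    exact Nat.findGreatest_is_greatest (P := fun i => indep (insert a C ∪ (l.take i).toFinset))
      (Nat.lt_of_succ_lt_succ hn) (by simpa using hn')

theorem passLength_cons_of_not (hI : IsIndependenceSystem indep) {C : Finset N} {a : N}
    (l : List N) (h : ¬ indep (insert a C)) : passLength indep C (a :: l) = 0 := by
  classical
  unfold passLength
  rw [Nat.findGreatest_eq_zero_iff]
  intro n hn _ hind
  obtain ⟨m, rfl⟩ : ∃ m, n = m + 1 := ⟨n - 1, by omega⟩
  exact h (hI.subset _ _ (by intro b; simp; tauto) hind)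

theorem indep_take_passLength {C : Finset N} (hC : indep C) (l : List N) :
    indep (C ∪ (l.take (passLength indep C l)).toFinset) := by
  classical
  exact Nat.findGreatest_spec (P := fun i => indep (C ∪ (l.take i).toFinset))
    (Nat.zero_le _) (by simpa using hC)

/-- What the sequence becomes after a pass of the loop of `GetSEQ` with the ordering `l`. -/
def afterPass (indep : Finset N → Prop) (B : Finset N) (V l : List N) : List N :=
  V ++ l.take (passLength indep (B ∪ V.toFinset) l)

theorem afterPass_cons {V : List N} {a : N} (l : List N)
    (h : indep (insert a (B ∪ V.toFinset))) :
    afterPass indep B V (a :: l) = afterPass indep B (V ++ [a]) l := by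
  rw [afterPass, passLength_cons l h, afterPass, union_toFinset_concat]
  simp

theorem afterPass_cons_of_not (hI : IsIndependenceSystem indep) {V : List N} {a : N} (l : List N)
    (h : ¬ indep (insert a (B ∪ V.toFinset))) : afterPass indep B V (a :: l) = V := by
  rw [afterPass, passLength_cons_of_not hI l h]
  simp

theorem extensions_append_subset (hI : IsIndependenceSystem indep) (V l : List N) :
    extensions indep B L (V ++ l) ⊆ extensions indep B L V := by
  intro u hu
  rw [mem_extensions] at hu ⊢
  refine ⟨hu.1, fun h => hu.2.1 (by simp [h]), hI.subset _ _ ?_ hu.2.2⟩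
  intro b; simp; tauto

/-- By heredity an element that has become infeasible stays so. Hence the set kept by the loop of
`GetSEQ` is always the full set of extensions of the current sequence, although it is filtered only
from its predecessor. -/
theorem filter_extensions (hI : IsIndependenceSystem indep) (V l : List N) :
    extensions indep B (extensions indep B L V) (V ++ l) = extensions indep B L (V ++ l) := by
  ext u
  rw [mem_extensions (L := extensions indep B L V), mem_extensions (V := V ++ l)]
  constructor
  · exact fun h => ⟨(mem_extensions.1 h.1).1, h.2⟩
  · exact fun h => ⟨extensions_append_subset hI V l (mem_extensions.2 h), h.2⟩

theorem getSEQLoop_succ_of_empty (m : ℕ) (V : List N) (h : extensions indep B L V = ∅) :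
    getSEQLoop indep B (m + 1) (extensions indep B L V) V = .pure V := by
  rw [getSEQLoop, h]
  simp

theorem getSEQLoop_succ (hI : IsIndependenceSystem indep) (m : ℕ) (V : List N)
    (h : (extensions indep B L V).Nonempty) :
    getSEQLoop indep B (m + 1) (extensions indep B L V) V =
      .shuffle (extensions indep B L V) fun l =>
        getSEQLoop indep B m (extensions indep B L (afterPass indep B V l))
          (afterPass indep B V l) := by
  rw [getSEQLoop, if_pos h]
  congr 1
  funext l
  have := filter_extensions (B := B) (L := L) hI V
    (l.take (passLength indep (B ∪ V.toFinset) l))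
  rw [afterPass, ← this]
  rfl

theorem extensions_nil (hI : ∀ u ∈ L, indep (insert u B)) : extensions indep B L [] = L := by
  ext u
  rw [mem_extensions]
  simp only [List.not_mem_nil, not_false_eq_true, List.toFinset_nil, Finset.union_empty, true_and]
  exact ⟨fun h => h.1, fun h => ⟨h, hI u h⟩⟩

/-- In a random pass of `GetSEQ` through `J`, a submartingale does not decrease in expectation. -/
theorem le_ordAvg_afterPass (hI : IsIndependenceSystem indep) {Y F : List N → ℝ}
    (hY : ∀ V, IsSeq indep B L V → (extensions indep B L V).Nonempty →
      ((extensions indep B L V).card : ℝ) * Y V ≤ ∑ u ∈ extensions indep B L V, Y (V ++ [u]))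
    (hF : ∀ V, IsSeq indep B L V → Y V ≤ F V) :
    ∀ (J : Finset N) (V : List N), IsSeq indep B L V → extensions indep B L V ⊆ J → J ⊆ L →
      (∀ u ∈ J, u ∉ V) → Y V ≤ ordAvg J fun l => F (afterPass indep B V l) := by
  intro J
  induction J using Finset.strongInduction with
  | H J ih =>
    intro V hV hJ hJL hJV
    rcases J.eq_empty_or_nonempty with rfl | hne
    · calc Y V = ordAvg (∅ : Finset N) fun _ => Y V := (ordAvg_const _ _).symm
        _ ≤ _ := by
          refine ordAvg_mono _ fun l hl => ?_
          have : l = [] := by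
            rw [mem_orderings_iff] at hl
            exact List.eq_nil_iff_forall_not_mem.2 fun a ha => by simpa using (hl.2 a).1 ha
          subst this
          simpa [afterPass] using hF V hV
    · have hcard : (0 : ℝ) < J.card := by exact_mod_cast hne.card_pos
      refine le_of_mul_le_mul_left ?_ hcard
      rw [card_mul_ordAvg J hne]
      -- Condition on the first element of the ordering. An extension is appended and the pass goes
      -- on with the rest of `J`; any other element ends the pass and leaves `V` as it is. Given
      -- that the pass goes on, the new element is uniform on the extensions, because all of them
      -- lie in `J`.
      have h1 : ∀ a ∈ J, (if a ∈ extensions indep B L V then Y (V ++ [a]) else Y V) ≤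
          ordAvg (J.erase a) fun l => F (afterPass indep B V (a :: l)) := by
        intro a ha
        by_cases hind : indep (insert a (B ∪ V.toFinset))
        · have hmem : a ∈ extensions indep B L V := mem_extensions.2 ⟨hJL ha, hJV a ha, hind⟩
          rw [if_pos hmem]
          simp only [afterPass_cons _ hind]
          refine ih _ (Finset.erase_ssubset ha) _ (hV.concat hmem) ?_
            ((Finset.erase_subset _ _).trans hJL) ?_
          · intro b hb
            rw [Finset.mem_erase]
            refine ⟨?_, hJ (extensions_append_subset hI V [a] hb)⟩
            rintro rfl
            exact (mem_extensions.1 hb).2.1 (by simp)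
          · intro b hb hbV
            rw [Finset.mem_erase] at hb
            rw [List.mem_append, List.mem_singleton] at hbV
            exact hbV.elim (hJV b hb.2) hb.1
        · rw [if_neg fun h => hind (mem_extensions.1 h).2.2]
          simp only [afterPass_cons_of_not hI _ hind, ordAvg_const]
          exact hF V hV
      refine le_trans ?_ (Finset.sum_le_sum h1)
      rw [Finset.sum_ite, Finset.sum_const, nsmul_eq_mul]
      have h2 : J.filter (· ∈ extensions indep B L V) = extensions indep B L V := by
        ext b; simp only [Finset.mem_filter]; exact ⟨fun h => h.2, fun h => ⟨hJ h, h⟩⟩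
      have h3 := Finset.card_filter_add_card_filter_not (s := J) (· ∈ extensions indep B L V)
      rw [h2] at h3 ⊢
      have h4 : (J.card : ℝ) = (extensions indep B L V).card +
          (J.filter (· ∉ extensions indep B L V)).card := by exact_mod_cast h3.symm
      have h5 : ((extensions indep B L V).card : ℝ) * Y V ≤
          ∑ u ∈ extensions indep B L V, Y (V ++ [u]) := by
        rcases (extensions indep B L V).eq_empty_or_nonempty with h | h
        · simp [h]
        · exact hY V hV h
      rw [h4, add_mul]
      linarith

theorem le_ex_getSEQLoop (hI : IsIndependenceSystem indep) {Y : List N → ℝ} (z : ℝ)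
    (hY : ∀ V, IsSeq indep B L V → (extensions indep B L V).Nonempty →
      ((extensions indep B L V).card : ℝ) * Y V ≤ ∑ u ∈ extensions indep B L V, Y (V ++ [u])) :
    ∀ (m : ℕ) (V : List N), IsSeq indep B L V →
      Y V ≤ (getSEQLoop indep B m (extensions indep B L V) V).ex f z Y := by
  intro m
  induction m with
  | zero => intro V _; exact le_rfl
  | succ m ih =>
    intro V hV
    rcases (extensions indep B L V).eq_empty_or_nonempty with h | h
    · rw [getSEQLoop_succ_of_empty m V h]
      exact le_rfl
    · rw [getSEQLoop_succ hI m V h]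
      exact le_ordAvg_afterPass hI hY ih _ V hV subset_rfl
        (fun u hu => (mem_extensions.1 hu).1) fun u hu => (mem_extensions.1 hu).2.1

theorem isSeq_nil (hB : indep B) : IsSeq indep B L [] :=
  ⟨List.nodup_nil, fun _ h => by simp at h, by simpa using hB⟩

/-- A function on sequences that does not decrease, on average, when the sequence is continued by a
uniformly random element does not decrease in expectation over `GetSEQ`. -/
theorem le_ex_getSEQ (hI : IsIndependenceSystem indep) {Y : List N → ℝ} (z : ℝ)
    (hY : ∀ V, IsSeq indep B L V → (extensions indep B L V).Nonempty →
      ((extensions indep B L V).card : ℝ) * Y V ≤ ∑ u ∈ extensions indep B L V, Y (V ++ [u]))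
    (hB : indep B) (hL : ∀ u ∈ L, indep (insert u B)) :
    Y [] ≤ (getSEQ indep B L).ex f z Y := by
  have := le_ex_getSEQLoop (f := f) hI z hY L.card [] (isSeq_nil hB)
  rwa [extensions_nil hL] at this

theorem IsSeq.afterPass {V : List N} (hV : IsSeq indep B L V) {l : List N}
    (hl : l ∈ orderings (extensions indep B L V)) :
    IsSeq indep B L (afterPass indep B V l) := by
  rw [mem_orderings_iff] at hl
  refine ⟨?_, ?_, ?_⟩
  · rw [ParSSP.afterPass, List.nodup_append]
    refine ⟨hV.nodup, hl.1.sublist (List.take_sublist _ _), ?_⟩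
    rintro a ha b hb rfl
    exact (mem_extensions.1 ((hl.2 a).1 (List.mem_of_mem_take hb))).2.1 ha
  · intro a ha
    rw [ParSSP.afterPass, List.mem_append] at ha
    rcases ha with ha | ha
    · exact hV.mem a ha
    · exact (mem_extensions.1 ((hl.2 a).1 (List.mem_of_mem_take ha))).1
  · rw [ParSSP.afterPass, union_toFinset_append]
    exact indep_take_passLength hV.indep l

/-- The first element of the ordering always fits, so every pass uses up at least one extension. A
bound `m` on the number of extensions therefore suffices as fuel, and the final sequence is maximal.
-/
theorem safe_getSEQLoop (hI : IsIndependenceSystem indep) (b : ℕ) : ∀ (m : ℕ) (V : List N),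
    IsSeq indep B L V → (extensions indep B L V).card ≤ m →
    (getSEQLoop indep B m (extensions indep B L V) V).Safe f b
      fun V' => IsSeq indep B L V' ∧ extensions indep B L V' = ∅ := by
  intro m
  induction m with
  | zero =>
    intro V hV hm
    exact ⟨hV, Finset.card_eq_zero.1 (Nat.le_zero.1 hm)⟩
  | succ m ih =>
    intro V hV hm
    rcases (extensions indep B L V).eq_empty_or_nonempty with h | h
    · rw [getSEQLoop_succ_of_empty m V h]
      exact ⟨hV, h⟩
    · rw [getSEQLoop_succ hI m V h]
      intro l hl
      refine ih _ (hV.afterPass hl) ?_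
      obtain ⟨b, hb⟩ := h
      have hlb := (mem_iff_of_mem_orderings hl b).2 hb
      have hmem := mem_iff_of_mem_orderings hl
      cases l with
      | nil => simp at hlb
      | cons a l =>
        have ha := (hmem a).1 (by simp)
        have hss : extensions indep B L (afterPass indep B V (a :: l)) ⊂
            extensions indep B L V := by
          refine (Finset.ssubset_iff_of_subset (extensions_append_subset hI _ _)).2 ?_
          refine ⟨a, ha, fun h => ?_⟩
          change a ∈ extensions indep B L (afterPass indep B V (a :: l)) at h
          rw [afterPass_cons l (mem_extensions.1 ha).2.2] at h
          exact (mem_extensions.1 h).2.1 (by simp [afterPass])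
        have := Finset.card_lt_card hss
        omega

theorem safe_getSEQ (hI : IsIndependenceSystem indep) (b : ℕ) (hB : indep B)
    (hL : ∀ u ∈ L, indep (insert u B)) :
    (getSEQ indep B L).Safe f b
      fun V' => IsSeq indep B L V' ∧ extensions indep B L V' = ∅ := by
  have := safe_getSEQLoop (f := f) (L := L) hI b L.card [] (isSeq_nil hB)
    (Finset.card_le_card fun u hu => (mem_extensions.1 hu).1)
  rwa [extensions_nil hL] at this

theorem cst_getSEQLoop (w : ℕ → ℝ) : ∀ (m : ℕ) (J : Finset N) (V : List N),
    (getSEQLoop indep B m J V).cst f w = 0 := by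
  intro m
  induction m with
  | zero => intro J V; rfl
  | succ m ih =>
    intro J V
    rw [getSEQLoop]
    split_ifs with h
    · simp only [Comp.cst, ih, ordAvg_const]
    · rfl

theorem cst_getSEQ (w : ℕ → ℝ) : (getSEQ indep B L).cst f w = 0 := cst_getSEQLoop w _ _ _

theorem abortsAfter_getSEQLoop (t : ℕ) : ∀ (m : ℕ) (J : Finset N) (V : List N),
    (getSEQLoop indep B m J V).AbortsAfter f t := by
  intro m
  induction m with
  | zero => intro J V; trivial
  | succ m ih =>
    intro J V
    rw [getSEQLoop]
    split_ifs with h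
    · exact fun l _ => ih _ _
    · trivial

theorem abortsAfter_getSEQ (t : ℕ) : (getSEQ indep B L).AbortsAfter f t :=
  abortsAfter_getSEQLoop t _ _ _

end GetSEQ

/-! ### The search for the stopping index -/

section LeastIndex

theorem leastIndex_le (d : ℕ) (P : ℕ → Prop) : leastIndex d P ≤ d + 1 := by
  classical
  unfold leastIndex
  split_ifs with h
  · exact (Nat.find_spec h).1.trans (Nat.le_succ _)
  · exact le_rfl

theorem leastIndex_le_iff {d i : ℕ} {P : ℕ → Prop} (hi : i ≤ d) :
    leastIndex d P ≤ i ↔ ∃ j ≤ i, P j := by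
  classical
  unfold leastIndex
  split_ifs with h
  · rw [Nat.find_le_iff]
    exact ⟨fun ⟨j, hj, hP⟩ => ⟨j, hj, hP.2⟩, fun ⟨j, hj, hP⟩ => ⟨j, hj, hj.trans hi, hP⟩⟩
  · exact ⟨fun h' => by omega, fun ⟨j, hj, hP⟩ => absurd ⟨j, hj.trans hi, hP⟩ h⟩

theorem leastIndex_spec {d : ℕ} {P : ℕ → Prop} (h : leastIndex d P ≤ d) : P (leastIndex d P) := by
  classical
  unfold leastIndex at h ⊢
  split_ifs at h ⊢ with h'
  · exact (Nat.find_spec h').2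
  · omega

theorem leastIndex_congr {d : ℕ} {P P' : ℕ → Prop} (h : ∀ i ≤ d, P i ↔ P' i) :
    leastIndex d P = leastIndex d P' := by
  have key : ∀ i ≤ d, leastIndex d P ≤ i ↔ leastIndex d P' ≤ i := by
    intro i hi
    rw [leastIndex_le_iff hi, leastIndex_le_iff hi]
    exact exists_congr fun j => and_congr_right fun hj => h j (hj.trans hi)
  have h1 := leastIndex_le d P
  have h2 := leastIndex_le d P'
  rcases le_or_gt (leastIndex d P) d with h3 | h3
  · have h4 := (key _ h3).1 le_rfl
    exact le_antisymm ((key _ (h4.trans h3)).2 le_rfl) h4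
  · rcases le_or_gt (leastIndex d P') d with h4 | h4
    · have := (key _ h4).2 le_rfl
      omega
    · omega

/-- The default value `d + 1` is consistent with lengthening the range. This is what makes the
stopping index of a sequence the truncation of that of its continuation. -/
theorem min_leastIndex_succ (d : ℕ) (P : ℕ → Prop) :
    min (leastIndex (d + 1) P) (d + 1) = leastIndex d P := by
  have key : ∀ i ≤ d, leastIndex (d + 1) P ≤ i ↔ leastIndex d P ≤ i := by
    intro i hi
    rw [leastIndex_le_iff hi, leastIndex_le_iff (hi.trans (Nat.le_succ _))]
  have h1 := leastIndex_le d P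
  rcases le_or_gt (leastIndex d P) d with h3 | h3
  · have h4 := (key _ h3).2 le_rfl
    have h5 := (key _ (h4.trans h3)).1 le_rfl
    omega
  · have h4 : ¬ leastIndex (d + 1) P ≤ d := fun h => by
      have := (key _ le_rfl).1 h
      omega
    omega

end LeastIndex

/-- The threshold is positive, or both the threshold and the objective are zero. -/
def Regular {N : Type u} (f : Finset N → ℝ) (ρ : ℝ) : Prop := 0 < ρ ∨ (ρ = 0 ∧ ∀ X, f X = 0)

theorem Regular.nonneg {N : Type u} {f : Finset N → ℝ} {ρ : ℝ} (h : Regular f ρ) : 0 ≤ ρ :=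
  h.elim le_of_lt fun h => h.1.ge

/-! ### The stopping conditions: monotonicity, search, and the stopped random sequence. -/

section Conditions

variable {N : Type u} [DecidableEq N] {f g : Finset N → ℝ} {indep : Finset N → Prop} {ρ ε : ℝ}
  {B L : Finset N} {V : List N}

theorem mem_valuable {X : Finset N} {u : N} :
    u ∈ valuable indep f ρ X L ↔ u ∈ L ∧ ρ ≤ marg f u X ∧ indep (insert u X) := by
  simp [valuable]

theorem answers_of_mem {Q : Finset (Finset N)} {S : Finset N} (h : S ∈ Q) :
    answers f Q S = f S := by simp [answers, h]

theorem self_mem_margQueries (X L : Finset N) : X ∈ margQueries X L :=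
  Finset.mem_insert_self _ _

theorem insert_mem_margQueries {X L : Finset N} {u : N} (hu : u ∈ L) :
    insert u X ∈ margQueries X L :=
  Finset.mem_insert_of_mem (Finset.mem_image_of_mem _ hu)

theorem marg_congr {X : Finset N} (h : ∀ S ∈ margQueries X L, g S = f S) {u : N} (hu : u ∈ L) :
    marg g u X = marg f u X := by
  rw [marg, marg, h _ (self_mem_margQueries X L), h _ (insert_mem_margQueries hu)]

theorem valuable_congr {X : Finset N} (h : ∀ S ∈ margQueries X L, g S = f S) :
    valuable indep g ρ X L = valuable indep f ρ X L := by
  ext u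
  rw [mem_valuable, mem_valuable]
  exact and_congr_right fun hu => by rw [marg_congr h hu]

theorem valuable_answers (X L : Finset N) :
    valuable indep (answers f (margQueries X L)) ρ X L = valuable indep f ρ X L :=
  valuable_congr fun _ hS => answers_of_mem hS

/-- The sum of the absolute values of the negative terms in the condition that defines `t₂`. -/
def negSum (f : Finset N → ℝ) (B : Finset N) (V : List N) (L : Finset N) (i : ℕ) : ℝ :=
  ∑ u ∈ L, max (-marg f u (prefixSet B V i)) 0 + ∑ j ∈ Finset.range i, max (-stepGain f B V j) 0

theorem cond₂_iff (i : ℕ) : cond₂ indep ρ ε B V L f i ↔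
    ε * ∑ u ∈ Eplus indep f ρ B V L i, marg f u (prefixSet B V i) ≤ negSum f B V L i := by
  have h : ∀ x : ℝ, (if x < 0 then |x| else 0) = max (-x) 0 := by
    intro x
    split_ifs with hx
    · rw [abs_of_neg hx, max_eq_left (by linarith)]
    · rw [max_eq_right (by linarith)]
  unfold cond₂ negSum Eminus Dneg
  rw [Finset.sum_filter, Finset.sum_filter]
  simp only [h]

theorem cond₁_congr {i : ℕ} (h : ∀ S ∈ queriesAt B V L i, g S = f S) :
    cond₁ indep ρ ε B V L g i ↔ cond₁ indep ρ ε B V L f i := by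
  unfold cond₁ Eplus
  rw [valuable_congr fun S hS => h S (Finset.mem_union_left _ hS)]

theorem cond₂_congr {i : ℕ} (h : ∀ S ∈ queriesAt B V L i, g S = f S) :
    cond₂ indep ρ ε B V L g i ↔ cond₂ indep ρ ε B V L f i := by
  have h1 : ∀ S ∈ margQueries (prefixSet B V i) L, g S = f S :=
    fun S hS => h S (Finset.mem_union_left _ hS)
  have h2 : ∀ j ≤ i, g (prefixSet B V j) = f (prefixSet B V j) := fun j hj =>
    h _ (Finset.mem_union_right _ (Finset.mem_image_of_mem _ (Finset.mem_range_succ_iff.2 hj)))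
  rw [cond₂_iff, cond₂_iff, negSum, negSum, Eplus, Eplus, valuable_congr h1]
  have e1 : ∑ u ∈ valuable indep f ρ (prefixSet B V i) L, marg g u (prefixSet B V i) =
      ∑ u ∈ valuable indep f ρ (prefixSet B V i) L, marg f u (prefixSet B V i) :=
    Finset.sum_congr rfl fun u hu => marg_congr h1 (mem_valuable.1 hu).1
  have e2 : ∑ u ∈ L, max (-marg g u (prefixSet B V i)) 0 =
      ∑ u ∈ L, max (-marg f u (prefixSet B V i)) 0 :=
    Finset.sum_congr rfl fun u hu => by rw [marg_congr h1 hu]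
  have e3 : ∑ j ∈ Finset.range i, max (-stepGain g B V j) 0 =
      ∑ j ∈ Finset.range i, max (-stepGain f B V j) 0 :=
    Finset.sum_congr rfl fun j hj => by
      have := Finset.mem_range.1 hj
      rw [stepGain, stepGain, h2 _ this, h2 _ this.le]
  rw [e1, e2, e3]

theorem cond₁_prefix {V' : List N} {i : ℕ} (h : ∀ j ≤ i, prefixSet B V' j = prefixSet B V j) :
    cond₁ indep ρ ε B V' L f i ↔ cond₁ indep ρ ε B V L f i := by
  unfold cond₁ Eplus
  rw [h i le_rfl]

theorem cond₂_prefix {V' : List N} {i : ℕ} (h : ∀ j ≤ i, prefixSet B V' j = prefixSet B V j) :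
    cond₂ indep ρ ε B V' L f i ↔ cond₂ indep ρ ε B V L f i := by
  rw [cond₂_iff, cond₂_iff, negSum, negSum, Eplus, Eplus, h i le_rfl]
  rw [Finset.sum_congr (g := fun j => max (-stepGain f B V j) 0) rfl fun j hj => by
    have := Finset.mem_range.1 hj
    rw [stepGain, stepGain, h _ this, h _ this.le]]

theorem prefixSet_mono {i j : ℕ} (h : i ≤ j) : prefixSet B V i ⊆ prefixSet B V j := by
  refine Finset.union_subset_union_right fun a ha => ?_
  rw [List.mem_toFinset] at ha ⊢
  exact List.take_subset_take_left V h ha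

theorem prefixSet_append (l : List N) {i : ℕ} (h : i ≤ V.length) :
    prefixSet B (V ++ l) i = prefixSet B V i := by
  rw [prefixSet, List.take_append_of_le_length h, prefixSet]

theorem prefixSet_of_length_le {i : ℕ} (h : V.length ≤ i) :
    prefixSet B V i = B ∪ V.toFinset := by
  rw [prefixSet, List.take_of_length_le h]

theorem prefixSet_succ {i : ℕ} (h : i < V.length) :
    prefixSet B V (i + 1) = insert V[i] (prefixSet B V i) := by
  ext a
  simp only [prefixSet, List.take_succ_eq_append_getElem h, Finset.mem_union, List.mem_toFinset,
    List.mem_append, List.mem_singleton, Finset.mem_insert]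
  tauto

theorem IsSeq.getElem_notMem (hV : IsSeq indep B L V) (hBL : Disjoint L B) {i : ℕ}
    (h : i < V.length) : V[i] ∉ prefixSet B V i := by
  intro hmem
  rw [prefixSet, Finset.mem_union, List.mem_toFinset] at hmem
  rcases hmem with h1 | h1
  · exact Finset.disjoint_left.1 hBL (hV.mem _ (List.getElem_mem h)) h1
  · obtain ⟨j, hj, hj'⟩ := List.getElem_of_mem h1
    rw [List.length_take] at hj
    rw [List.getElem_take, hV.nodup.getElem_inj_iff] at hj'
    omega

/-- A positive threshold excludes elements already in the prefix, whose marginal is `0`, so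
submodularity applies to the others. If `ρ = 0`, elements inside the prefix would pass the test;
regularity then makes all marginals vanish. -/
theorem Eplus_anti (hf : Submodular f) (hI : IsIndependenceSystem indep) (hr : Regular f ρ)
    {i j : ℕ} (hij : i ≤ j) {u : N} (hu : u ∈ Eplus indep f ρ B V L j) :
    u ∈ Eplus indep f ρ B V L i ∧
      marg f u (prefixSet B V j) ≤ marg f u (prefixSet B V i) := by
  unfold Eplus at *
  rw [mem_valuable] at hu ⊢
  have hind := hI.subset _ _ (Finset.insert_subset_insert u (prefixSet_mono (B := B) (V := V) hij))
    hu.2.2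
  rcases hr with hr | hr
  · have hnot : u ∉ prefixSet B V j := fun h => by
      rw [marg_of_mem h] at hu
      linarith
    have := hf.marg_anti (prefixSet_mono (B := B) (V := V) hij) hnot
    exact ⟨⟨hu.1, hu.2.1.trans this, hind⟩, this⟩
  · have hm : ∀ X, marg f u X = 0 := fun X => by simp [marg, hr.2]
    exact ⟨⟨hu.1, by rw [hm, hr.1], hind⟩, by rw [hm, hm]⟩

theorem cond₁_mono (hf : Submodular f) (hI : IsIndependenceSystem indep) (hr : Regular f ρ)
    {i j : ℕ} (hij : i ≤ j) (h : cond₁ indep ρ ε B V L f i) : cond₁ indep ρ ε B V L f j := by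
  unfold cond₁ at *
  refine le_trans ?_ h
  exact_mod_cast Finset.card_le_card fun u hu => (Eplus_anti hf hI hr hij hu).1

/-- When `V[j]` joins the prefix its term in the sum over `L` becomes `0`, but exactly the same
amount reappears as a step gain. All other negative parts can only grow, by submodularity. -/
theorem negSum_mono (hf : Submodular f) (hV : IsSeq indep B L V) (hBL : Disjoint L B)
    {i j : ℕ} (hij : i ≤ j) (hj : j ≤ V.length) : negSum f B V L i ≤ negSum f B V L j := by
  induction j, hij using Nat.le_induction with
  | base => exact le_rfl
  | succ j hij ih =>
    refine (ih (Nat.le_of_succ_le hj)).trans ?_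
    have hnot := hV.getElem_notMem hBL hj
    have hmem := hV.mem _ (List.getElem_mem hj)
    have hstep : stepGain f B V j = marg f V[j] (prefixSet B V j) := by
      rw [stepGain, marg, prefixSet_succ hj]
    unfold negSum
    rw [Finset.sum_range_succ, hstep, ← Finset.add_sum_erase L _ hmem,
      ← Finset.add_sum_erase L (fun u => max (-marg f u (prefixSet B V (j + 1))) 0) hmem]
    have h1 : ∑ u ∈ L.erase V[j], max (-marg f u (prefixSet B V j)) 0 ≤
        ∑ u ∈ L.erase V[j], max (-marg f u (prefixSet B V (j + 1))) 0 := by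
      refine Finset.sum_le_sum fun u hu => ?_
      rw [Finset.mem_erase] at hu
      by_cases huG : u ∈ prefixSet B V (j + 1)
      · have : u ∈ prefixSet B V j := by
          rw [prefixSet_succ hj, Finset.mem_insert] at huG
          exact huG.resolve_left hu.1
        rw [marg_of_mem this, marg_of_mem huG]
      · exact max_le_max_right _ (neg_le_neg (hf.marg_anti
          (prefixSet_mono (Nat.le_succ j)) huG))
    have h2 := le_max_right (-marg f V[j] (prefixSet B V (j + 1))) 0
    linarith

/-- The left side decreases since both `E_i^+` and its marginals do, and the right side increases.
With `cond₁_mono` this justifies binary search. -/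
theorem cond₂_mono (hf : Submodular f) (hI : IsIndependenceSystem indep) (hr : Regular f ρ)
    (hε : 0 ≤ ε) (hV : IsSeq indep B L V) (hBL : Disjoint L B)
    {i j : ℕ} (hij : i ≤ j) (hj : j ≤ V.length) (h : cond₂ indep ρ ε B V L f i) :
    cond₂ indep ρ ε B V L f j := by
  rw [cond₂_iff] at *
  refine le_trans (mul_le_mul_of_nonneg_left ?_ hε) (h.trans (negSum_mono hf hV hBL hij hj))
  refine (Finset.sum_le_sum fun u hu => (Eplus_anti hf hI hr hij hu).2).trans
    (Finset.sum_le_sum_of_subset_of_nonneg (fun u hu => (Eplus_anti hf hI hr hij hu).1) ?_)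
  intro u hu _
  exact hr.nonneg.trans (mem_valuable.1 hu).2.1

/-! The two searches -/

theorem cst_bisect_le {queries : ℕ → Finset (Finset N)} {P : (Finset N → ℝ) → ℕ → Prop}
    {w : ℕ → ℝ} {b : ℝ} (hb : 0 ≤ b) :
    ∀ (n lo hi : ℕ), hi - lo < 2 ^ n → (∀ i < hi, w (queries i).card ≤ b) →
      (bisect queries P lo hi).cst f w ≤ n * b := by
  intro n
  induction n with
  | zero =>
    intro lo hi hn _
    rw [bisect, if_neg (by rw [pow_zero] at hn; omega)]
    simp [Comp.cst]
  | succ n ih =>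
    intro lo hi hn hw
    rw [pow_succ] at hn
    rw [bisect]
    split_ifs with hlt
    · simp only [Comp.cst]
      have h1 := hw ((lo + hi) / 2) (by omega)
      push_cast
      split_ifs
      · have := ih lo ((lo + hi) / 2) (by omega) fun i hi => hw i (by omega)
        linarith
      · have := ih ((lo + hi) / 2 + 1) hi (by omega) hw
        linarith
    · simp only [Comp.cst]
      positivity

/-- For a condition that switches from false to true at `τ`, the interval always satisfies `lo ≤ τ ≤
hi`, and it shrinks to the point `τ`. -/
theorem safe_bisect {queries : ℕ → Finset (Finset N)} {P : (Finset N → ℝ) → ℕ → Prop}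
    {P' : ℕ → Prop} (hP : ∀ i, P (answers f (queries i)) i ↔ P' i) {b : ℕ} (τ : ℕ) :
    ∀ (n lo hi : ℕ), hi - lo ≤ n → lo ≤ τ → τ ≤ hi → (∀ i, lo ≤ i → i < hi → (P' i ↔ τ ≤ i)) →
      (∀ i < hi, (queries i).card ≤ b) →
      (bisect queries P lo hi).Safe f b fun i => i = τ := by
  intro n
  induction n with
  | zero =>
    intro lo hi hn h1 h2 _ _
    rw [bisect, if_neg (by omega)]
    simp only [Comp.Safe]
    omega
  | succ n ih =>
    intro lo hi hn h1 h2 hτ hb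
    rw [bisect]
    split_ifs with hlt
    · have h3 := hτ ((lo + hi) / 2) (by omega) (by omega)
      refine ⟨hb _ (by omega), ?_⟩
      beta_reduce
      by_cases hc : P' ((lo + hi) / 2)
      · rw [if_pos ((hP _).2 hc)]
        exact ih _ _ (by omega) h1 (h3.1 hc) (fun i hi1 hi2 => hτ i hi1 (by omega))
          fun i hi => hb i (by omega)
      · rw [if_neg fun h' => hc ((hP _).1 h')]
        have := mt h3.2 hc
        exact ih _ _ (by omega) (by omega) h2 (fun i hi1 hi2 => hτ i (by omega) hi2) hb
    · simp only [Comp.Safe]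
      omega

theorem abortsAfter_bisect {queries : ℕ → Finset (Finset N)} {P : (Finset N → ℝ) → ℕ → Prop} :
    ∀ (n lo hi : ℕ), hi - lo ≤ n → ∀ t, (bisect queries P lo hi).AbortsAfter f t := by
  intro n
  induction n with
  | zero =>
    intro lo hi hn t
    rw [bisect, if_neg (by omega)]
    trivial
  | succ n ih =>
    intro lo hi hn t
    rw [bisect]
    split_ifs with hlt
    · simp only [Comp.AbortsAfter]
      split_ifs
      · exact ih _ _ (by omega) _
      · exact ih _ _ (by omega) _
    · trivial

theorem abortsAfter_search (mode : SearchMode) (t : ℕ) :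
    (search mode indep ρ ε B V L).AbortsAfter f t := by
  cases mode with
  | parallel => trivial
  | binary =>
    exact (abortsAfter_bisect _ _ _ le_rfl t).bind fun _ =>
      (abortsAfter_bisect _ _ _ le_rfl t).bind fun _ => trivial

/-- The pair `(t₁, t₂)`. -/
def searchResult (indep : Finset N → Prop) (ρ ε : ℝ) (B : Finset N) (L : Finset N)
    (f : Finset N → ℝ) (V : List N) : ℕ × ℕ :=
  (leastIndex V.length (cond₁ indep ρ ε B V L f), leastIndex V.length (cond₂ indep ρ ε B V L f))

theorem card_margQueries_le (X L : Finset N) : (margQueries X L).card ≤ L.card + 1 :=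
  (Finset.card_insert_le _ _).trans (Nat.succ_le_succ Finset.card_image_le)

theorem card_queriesAt_le (i : ℕ) : (queriesAt B V L i).card ≤ L.card + 1 + (i + 1) :=
  (Finset.card_union_le _ _).trans (add_le_add (card_margQueries_le _ _)
    (Finset.card_image_le.trans (Finset.card_range _).le))

theorem card_searchAll_queries_le :
    ((Finset.range (V.length + 1)).biUnion fun i => queriesAt B V L i).card ≤
      (V.length + 1) * (L.card + 1) := by
  -- The prefix sets queried for `D_i` are already queried as base sets for the smaller indices, so
  -- they cost nothing extra.
  have hsub : ((Finset.range (V.length + 1)).biUnion fun i => queriesAt B V L i) ⊆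
      (Finset.range (V.length + 1)).biUnion fun i => margQueries (prefixSet B V i) L := by
    intro S hS
    simp only [Finset.mem_biUnion, queriesAt, Finset.mem_union, Finset.mem_image] at hS ⊢
    obtain ⟨i, hi, hS | ⟨j, hj, rfl⟩⟩ := hS
    · exact ⟨i, hi, hS⟩
    · refine ⟨j, ?_, self_mem_margQueries _ _⟩
      rw [Finset.mem_range] at *
      omega
  refine (Finset.card_le_card hsub).trans (Finset.card_biUnion_le.trans ?_)
  refine (Finset.sum_le_sum fun i _ => card_margQueries_le _ _).trans ?_
  simp

/-- In both modes, the search finds `(t₁, t₂)`. -/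
theorem safe_search (hf : Submodular f) (hI : IsIndependenceSystem indep) (hr : Regular f ρ)
    (hε : 0 ≤ ε) (hV : IsSeq indep B L V) (hBL : Disjoint L B) (mode : SearchMode) {n : ℕ}
    (hn : 1 ≤ n) (hL : L.card ≤ n) (hVn : V.length ≤ n) :
    (search mode indep ρ ε B V L).Safe f ((n + 1) ^ 2)
      fun τ => τ = searchResult indep ρ ε B L f V := by
  have hadm : ∀ P : ℕ → Prop, (∀ i j, i ≤ j → j ≤ V.length → P i → P j) → ∀ i, 0 ≤ i →
      i < V.length + 1 → (P i ↔ leastIndex V.length P ≤ i) := by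
    intro P hP i _ hi
    rw [leastIndex_le_iff (Nat.lt_succ_iff.1 hi)]
    exact ⟨fun h => ⟨i, le_rfl, h⟩, fun ⟨j, hj, h⟩ => hP j i hj (Nat.lt_succ_iff.1 hi) h⟩
  cases mode with
  | parallel =>
    refine ⟨?_, ?_⟩
    · refine card_searchAll_queries_le.trans ?_
      rw [sq]
      exact Nat.mul_le_mul (by omega) (by omega)
    · have hans : ∀ i ≤ V.length, ∀ S ∈ queriesAt B V L i, answers f
          ((Finset.range (V.length + 1)).biUnion fun i => queriesAt B V L i) S = f S :=
        fun i hi S hS => answers_of_mem (Finset.mem_biUnion.2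
          ⟨i, Finset.mem_range.2 (Nat.lt_succ_of_le hi), hS⟩)
      exact Prod.ext (leastIndex_congr fun i hi => cond₁_congr (hans i hi))
        (leastIndex_congr fun i hi => cond₂_congr (hans i hi))
  | binary =>
    have hcard : ∀ i < V.length + 1, (queriesAt B V L i).card ≤ (n + 1) ^ 2 := by
      intro i hi
      refine (card_queriesAt_le i).trans ?_
      nlinarith
    have h1 := safe_bisect (f := f) (queries := queriesAt B V L) (P := cond₁ indep ρ ε B V L)
      (P' := cond₁ indep ρ ε B V L f) (fun i => cond₁_congr fun S hS => answers_of_mem hS)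
      (leastIndex V.length (cond₁ indep ρ ε B V L f)) _ 0 (V.length + 1) le_rfl (Nat.zero_le _)
      (leastIndex_le _ _) (hadm _ fun i j hij _ => cond₁_mono hf hI hr hij) hcard
    have h2 := safe_bisect (f := f) (queries := queriesAt B V L) (P := cond₂ indep ρ ε B V L)
      (P' := cond₂ indep ρ ε B V L f) (fun i => cond₂_congr fun S hS => answers_of_mem hS)
      (leastIndex V.length (cond₂ indep ρ ε B V L f)) _ 0 (V.length + 1) le_rfl (Nat.zero_le _)
      (leastIndex_le _ _) (hadm _ fun i j hij hj => cond₂_mono hf hI hr hε hV hBL hij hj) hcard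
    refine h1.bind fun t₁ ht₁ => h2.bind fun t₂ ht₂ => ?_
    subst ht₁ ht₂
    rfl

theorem ex_search (hf : Submodular f) (hI : IsIndependenceSystem indep) (hr : Regular f ρ)
    (hε : 0 ≤ ε) (hV : IsSeq indep B L V) (hBL : Disjoint L B) (mode : SearchMode) (z : ℝ)
    (h : ℕ × ℕ → ℝ) :
    (search mode indep ρ ε B V L).ex f z h = h (searchResult indep ρ ε B L f V) := by
  have hs := safe_search (f := f) (n := L.card + V.length + 1) hf hI hr hε hV hBL mode (by omega)
    (by omega) (by omega)
  rw [Comp.ex_eq_of_abortsAfter (fun t => abortsAfter_search mode t) z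
    (h (searchResult indep ρ ε B L f V)),
    Comp.ex_congr hs (h' := fun _ => h (searchResult indep ρ ε B L f V)) fun τ hτ => by rw [hτ],
    Comp.ex_const]

theorem cst_search_parallel_le {w : ℕ → ℝ} (hw : Monotone w) :
    (search .parallel indep ρ ε B V L).cst f w ≤ w ((V.length + 1) * (L.card + 1)) := by
  simp only [search, searchAll, Comp.cst, add_zero]
  exact hw card_searchAll_queries_le

theorem cst_search_binary_le {w : ℕ → ℝ} (hw : Monotone w) (hw0 : ∀ q, 0 ≤ w q) {n : ℕ}
    (hn : V.length + 1 < 2 ^ n) :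
    (search .binary indep ρ ε B V L).cst f w ≤
      2 * (n * w (L.card + 1 + (V.length + 1))) := by
  have hb : ∀ P : (Finset N → ℝ) → ℕ → Prop,
      (bisect (queriesAt B V L) P 0 (V.length + 1)).cst f w ≤
        n * w (L.card + 1 + (V.length + 1)) := fun P =>
    cst_bisect_le (hw0 _) n 0 _ hn fun i hi =>
      hw ((card_queriesAt_le i).trans (by omega))
  simp only [search, searchBinary, Comp.cst_bind, Comp.cst]
  have h1 := hb (cond₁ indep ρ ε B V L)
  have h2 := hb (cond₂ indep ρ ε B V L)
  have h0 : ∀ c : Comp N ℕ, (c.ex f 0 fun _ => (0 : ℝ)) = 0 := fun c => Comp.ex_const 0 c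
  simp only [h0, add_zero]
  have h3 : ((bisect (queriesAt B V L) (cond₁ indep ρ ε B V L) 0 (V.length + 1)).ex f 0
      fun _ => (bisect (queriesAt B V L) (cond₂ indep ρ ε B V L) 0 (V.length + 1)).cst f w) =
      (bisect (queriesAt B V L) (cond₂ indep ρ ε B V L) 0 (V.length + 1)).cst f w := by
    rw [Comp.ex_eq_of_abortsAfter (fun t => abortsAfter_bisect _ _ _ le_rfl t) 0
      ((bisect (queriesAt B V L) (cond₂ indep ρ ε B V L) 0 (V.length + 1)).cst f w),
      Comp.ex_const]
  rw [h3]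
  linarith

/-! The expected gain of a batch -/

/-- The batch that is considered in an iteration of `RandBatch`, as a sequence. -/
def batchSeq (indep : Finset N → Prop) (ρ ε : ℝ) (B L : Finset N) (f : Finset N → ℝ)
    (V : List N) : List N :=
  V.take (min (searchResult indep ρ ε B L f V).1 (searchResult indep ρ ε B L f V).2)

/-- The stopping-time property: whether a condition holds at `i` depends only on the first `i`
elements, so continuing the sequence changes only indices beyond its end. -/
theorem searchResult_concat (u : N) :
    min (searchResult indep ρ ε B L f (V ++ [u])).1 (V.length + 1) =
        (searchResult indep ρ ε B L f V).1 ∧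
      min (searchResult indep ρ ε B L f (V ++ [u])).2 (V.length + 1) =
        (searchResult indep ρ ε B L f V).2 := by
  have h : ∀ i ≤ V.length, ∀ j ≤ i, prefixSet B (V ++ [u]) j = prefixSet B V j :=
    fun i hi j hj => prefixSet_append _ (hj.trans hi)
  simp only [searchResult, List.length_append, List.length_singleton]
  rw [min_leastIndex_succ, min_leastIndex_succ]
  exact ⟨leastIndex_congr fun i hi => cond₁_prefix (h i hi),
    leastIndex_congr fun i hi => cond₂_prefix (h i hi)⟩

theorem batchSeq_concat_of_le (u : N)
    (h : min (searchResult indep ρ ε B L f V).1 (searchResult indep ρ ε B L f V).2 ≤ V.length) :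
    batchSeq indep ρ ε B L f (V ++ [u]) = batchSeq indep ρ ε B L f V := by
  obtain ⟨h1, h2⟩ := searchResult_concat (indep := indep) (ρ := ρ) (ε := ε) (B := B) (L := L)
    (f := f) (V := V) u
  unfold batchSeq
  rw [← List.take_append_of_le_length (l₂ := [u]) h]
  congr 1
  omega

theorem batchSeq_concat_of_lt (u : N)
    (h : V.length < min (searchResult indep ρ ε B L f V).1 (searchResult indep ρ ε B L f V).2) :
    batchSeq indep ρ ε B L f (V ++ [u]) = V ++ [u] := by
  obtain ⟨h1, h2⟩ := searchResult_concat (indep := indep) (ρ := ρ) (ε := ε) (B := B) (L := L)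
    (f := f) (V := V) u
  unfold batchSeq
  refine List.take_of_length_le ?_
  rw [List.length_append, List.length_singleton]
  omega

theorem Eplus_subset_extensions (hρ : 0 < ρ) :
    Eplus indep f ρ B V L V.length ⊆ extensions indep B L V := by
  intro u hu
  unfold Eplus at hu
  rw [mem_valuable, prefixSet_of_length_le le_rfl] at hu
  refine mem_extensions.2 ⟨hu.1, fun h => ?_, hu.2.2⟩
  have : marg f u (B ∪ V.toFinset) = 0 := marg_of_mem (by simp [h])
  rw [this] at hu
  linarith

/-- If no stopping condition holds, a random continuation has a large expected gain. -/
theorem card_extensions_mul_le (hρ : 0 < ρ) (hε1 : ε < 1)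
    (h1 : ¬ cond₁ indep ρ ε B V L f V.length) (h2 : ¬ cond₂ indep ρ ε B V L f V.length) :
    ((extensions indep B L V).card : ℝ) * ((1 - ε) ^ 2 * ρ) ≤
      ∑ u ∈ extensions indep B L V, marg f u (B ∪ V.toFinset) := by
  classical
  have hsub := Eplus_subset_extensions (indep := indep) (f := f) (B := B) (L := L) (V := V) hρ
  have hext : extensions indep B L V ⊆ L := fun u hu => (mem_extensions.1 hu).1
  rw [cond₂_iff, negSum, not_le] at h2
  rw [cond₁, not_le] at h1
  set E := Eplus indep f ρ B V L V.length with hE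
  rw [prefixSet_of_length_le le_rfl] at h2
  set G := B ∪ V.toFinset with hG
  have hD : 0 ≤ ∑ j ∈ Finset.range V.length, max (-stepGain f B V j) 0 :=
    Finset.sum_nonneg fun j _ => le_max_right _ _
  have hEρ : (E.card : ℝ) * ρ ≤ ∑ u ∈ E, marg f u G := by
    rw [← nsmul_eq_mul]
    refine Finset.card_nsmul_le_sum _ _ _ fun u hu => ?_
    rw [hE, Eplus, mem_valuable, prefixSet_of_length_le le_rfl] at hu
    exact hu.2.1
  have hneg : ∑ u ∈ extensions indep B L V \ E, -max (-marg f u G) 0 ≤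
      ∑ u ∈ extensions indep B L V \ E, marg f u G :=
    Finset.sum_le_sum fun u _ => by
      have := le_max_left (-marg f u G) 0
      linarith
  -- Extensions outside `E_i^+` lose at most all negative parts over `L`. By the failure of the
  -- second condition these are below `ε` times the sum over `E_i^+`, so a fraction `1 - ε` of that
  -- sum survives. The failure of the first condition, `|E_i^+| > (1 - ε)|L|`, supplies the second
  -- factor `1 - ε`.
  have hL : ∑ u ∈ extensions indep B L V \ E, max (-marg f u G) 0 ≤
      ∑ u ∈ L, max (-marg f u G) 0 :=
    Finset.sum_le_sum_of_subset_of_nonneg (Finset.sdiff_subset.trans hext)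
      fun u _ _ => le_max_right _ _
  have hsplit := Finset.sum_sdiff hsub (f := fun u => marg f u G)
  rw [Finset.sum_neg_distrib] at hneg
  have hc : ((extensions indep B L V).card : ℝ) ≤ L.card := by
    exact_mod_cast Finset.card_le_card hext
  have h3 : (1 - ε) * ((E.card : ℝ) * ρ) ≤ (1 - ε) * ∑ u ∈ E, marg f u G :=
    mul_le_mul_of_nonneg_left hEρ (by linarith)
  have h4 : (1 - ε) * (L.card : ℝ) * ((1 - ε) * ρ) ≤ E.card * ((1 - ε) * ρ) :=
    mul_le_mul_of_nonneg_right h1.le (mul_nonneg (by linarith) hρ.le)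
  have h5 : ((extensions indep B L V).card : ℝ) * ((1 - ε) ^ 2 * ρ) ≤
      L.card * ((1 - ε) ^ 2 * ρ) := mul_le_mul_of_nonneg_right hc (by positivity)
  nlinarith

/-- Optional stopping: the value minus `(1 - ε)^2 ρ` per element, frozen at the stopping index, is a
submartingale along the random sequence. Once stopped it is constant; before that
`card_extensions_mul_le` gives the drift. -/
theorem le_ex_getSEQ_batch (hI : IsIndependenceSystem indep) (hr : Regular f ρ) (hε1 : ε < 1)
    (z : ℝ) (hB : indep B) (hL : ∀ u ∈ L, indep (insert u B)) :
    f B ≤ (getSEQ indep B L).ex f z fun V =>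
      f (B ∪ (batchSeq indep ρ ε B L f V).toFinset) -
        (1 - ε) ^ 2 * ρ * (batchSeq indep ρ ε B L f V).length := by
  have key := le_ex_getSEQ (f := f) hI (B := B) (L := L) (Y := fun V =>
    f (B ∪ (batchSeq indep ρ ε B L f V).toFinset) -
        (1 - ε) ^ 2 * ρ * (batchSeq indep ρ ε B L f V).length) z ?_ hB hL
  · simpa [batchSeq] using key
  · intro V hV hne
    rcases le_or_gt (min (searchResult indep ρ ε B L f V).1 (searchResult indep ρ ε B L f V).2)
      V.length with h | h
    · rw [Finset.sum_congr rfl fun u _ => by rw [batchSeq_concat_of_le u h], Finset.sum_const,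
        nsmul_eq_mul]
    · have hb : batchSeq indep ρ ε B L f V = V := List.take_of_length_le h.le
      rw [Finset.sum_congr rfl fun u _ => by rw [batchSeq_concat_of_lt u h], hb]
      rcases hr with hρ | hρ
      · have h1 : ¬ cond₁ indep ρ ε B V L f V.length := fun hc => by
          have := (leastIndex_le_iff (le_refl V.length)).2 ⟨_, le_rfl, hc⟩
          simp only [searchResult] at h
          omega
        have h2 : ¬ cond₂ indep ρ ε B V L f V.length := fun hc => by
          have := (leastIndex_le_iff (le_refl V.length)).2 ⟨_, le_rfl, hc⟩
          simp only [searchResult] at h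
          omega
        have h3 := card_extensions_mul_le hρ hε1 h1 h2
        have h4 : ∑ u ∈ extensions indep B L V,
            (f (B ∪ (V ++ [u]).toFinset) - (1 - ε) ^ 2 * ρ * ((V ++ [u]).length : ℕ)) =
            ∑ u ∈ extensions indep B L V, marg f u (B ∪ V.toFinset) +
              (extensions indep B L V).card * (f (B ∪ V.toFinset) -
                (1 - ε) ^ 2 * ρ * V.length - (1 - ε) ^ 2 * ρ) := by
          rw [← nsmul_eq_mul, ← Finset.sum_const, ← Finset.sum_add_distrib]
          refine Finset.sum_congr rfl fun u _ => ?_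
          rw [union_toFinset_concat, marg, List.length_append, List.length_singleton]
          push_cast
          ring
        rw [h4]
        nlinarith
      · simp [hρ.1, hρ.2]

/-- For a maximal sequence the default `d + 1` is never used: no extension is left, so `E_d^+` is
empty and the first condition holds at `d`. In the degenerate case the second condition reads `0 ≤
0`. -/
theorem min_searchResult_le (hr : Regular f ρ) (hε1 : ε < 1)
    (hV : extensions indep B L V = ∅) :
    min (searchResult indep ρ ε B L f V).1 (searchResult indep ρ ε B L f V).2 ≤ V.length := by
  rcases hr with hρ | hρ
  · refine (min_le_left _ _).trans ((leastIndex_le_iff le_rfl).2 ⟨V.length, le_rfl, ?_⟩)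
    have h := Finset.subset_empty.1 (hV ▸ Eplus_subset_extensions (indep := indep) (f := f)
      (B := B) (L := L) (V := V) hρ)
    rw [cond₁, h]
    have : 0 ≤ 1 - ε := by linarith
    simp only [Finset.card_empty, Nat.cast_zero]
    positivity
  · refine (min_le_right _ _).trans ((leastIndex_le_iff le_rfl).2 ⟨V.length, le_rfl, ?_⟩)
    rw [cond₂_iff, negSum]
    simp [marg, stepGain, hρ.2]

end Conditions

/-! ### The while-loop of `RandBatch` -/

/-- The data of a call of `RandBatch`. -/
structure Batch (N : Type u) where
  f : Finset N → ℝ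
  indep : Finset N → Prop
  ε : ℝ
  ρ : ℝ
  T : Finset N
  I : Finset N

/-- The variables of the while-loop of `RandBatch`. -/
structure State (N : Type u) where
  A : Finset N
  U : Finset N
  L : Finset N
  count : ℕ

namespace Batch

variable {N : Type u} [DecidableEq N] (c : Batch N)

/-- The standing assumptions on a call of `RandBatch`. -/
structure Valid : Prop where
  submodular : Submodular c.f
  nonneg : ∀ X, 0 ≤ c.f X
  system : IsIndependenceSystem c.indep
  eps_pos : 0 < c.ε
  eps_lt_one : c.ε < 1
  rho_nonneg : 0 ≤ c.ρ
  singleton_eq_zero : c.ρ = 0 → ∀ u, c.f {u} = 0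
  disjoint : Disjoint c.I c.T

/-- The invariant of the while-loop of `RandBatch`. -/
structure Inv (s : State N) : Prop where
  indep : c.indep (c.T ∪ s.A)
  A_subset : s.A ⊆ s.U
  U_subset : s.U ⊆ c.I
  L_subset : s.L ⊆ c.I
  disjoint : Disjoint s.L s.U
  large : ∀ u ∈ s.L, c.ρ ≤ marg c.f u (c.T ∪ s.A) ∧ c.indep (insert u (c.T ∪ s.A))
  small : ∀ u ∈ c.I, u ∉ s.U → u ∉ s.L → c.indep (insert u (c.T ∪ s.A)) →
    marg c.f u (c.T ∪ s.A) < c.ρ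
  charge : ∃ W X, W ⊆ c.T ∪ s.A ∧ c.T ∪ s.A ⊆ X ∧ Disjoint X s.L ∧
    s.count * (c.ε * ∑ u ∈ s.L, marg c.f u (c.T ∪ s.A)) ≤ c.f W - c.f X

/-- The indices `(t₁, t₂)` for the sequence `V`. -/
def indices (s : State N) (V : List N) : ℕ × ℕ :=
  searchResult c.indep c.ρ c.ε (c.T ∪ s.A) s.L c.f V

/-- The batch considered for the sequence `V`. -/
def batch (s : State N) (V : List N) : Finset N :=
  (batchSeq c.indep c.ρ c.ε (c.T ∪ s.A) s.L c.f V).toFinset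

/-- The state after an iteration in which the batch is accepted. -/
def accept (s : State N) (V : List N) : State N where
  A := s.A ∪ c.batch s V
  U := s.U ∪ c.batch s V
  L := valuable c.indep c.f c.ρ (c.T ∪ (s.A ∪ c.batch s V)) (s.L \ (s.U ∪ c.batch s V))
  count := if (c.indices s V).2 < (c.indices s V).1 then s.count + 1 else s.count

/-- The state after an iteration in which the batch is rejected. -/
def reject (s : State N) (V : List N) : State N where
  A := s.A
  U := s.U ∪ c.batch s V
  L := valuable c.indep c.f c.ρ (c.T ∪ s.A) (s.L \ (s.U ∪ c.batch s V))
  count := s.count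

/-- The possible results of `GetSEQ`. -/
def IsMaxSeq (s : State N) (V : List N) : Prop :=
  IsSeq c.indep (c.T ∪ s.A) s.L V ∧ extensions c.indep (c.T ∪ s.A) s.L V = ∅

variable {c} {s : State N} {V : List N}

theorem Inv.disjoint_base (hc : c.Valid) (hs : c.Inv s) : Disjoint s.L (c.T ∪ s.A) := by
  rw [Finset.disjoint_union_right]
  exact ⟨hc.disjoint.mono_left hs.L_subset, hs.disjoint.mono_right hs.A_subset⟩

/-- If `ρ = 0` all singletons have value `0`. A candidate has nonnegative marginal at the base,
hence at `∅`, which forces `f ∅ = 0`; then subadditivity of the gains makes `f` vanish. Without a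
candidate `f ∅` could be positive. -/
theorem Inv.regular (hc : c.Valid) (hs : c.Inv s) (hL : s.L.Nonempty) : Regular c.f c.ρ := by
  rcases hc.rho_nonneg.lt_or_eq with h | h
  · exact Or.inl h
  · refine Or.inr ⟨h.symm, fun X => le_antisymm ?_ (hc.nonneg X)⟩
    have hz := hc.singleton_eq_zero h.symm
    obtain ⟨u, hu⟩ := hL
    have h1 := hc.submodular.marg_anti (Finset.empty_subset (c.T ∪ s.A))
      (Finset.disjoint_left.1 (hs.disjoint_base hc) hu)
    have h2 := (hs.large u hu).1
    have h3 : c.f ∅ = 0 := by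
      refine le_antisymm ?_ (hc.nonneg _)
      have : marg c.f u ∅ = c.f {u} - c.f ∅ := rfl
      have := hz u
      linarith
    have h4 := hc.submodular.union_le ∅ X
    have h5 : ∀ v, marg c.f v ∅ = 0 := fun v => by
      have : marg c.f v ∅ = c.f {v} - c.f ∅ := rfl
      rw [this, hz, h3, sub_zero]
    simpa [h3, h5] using h4

theorem batch_subset (hV : c.IsMaxSeq s V) : c.batch s V ⊆ s.L := by
  intro u hu
  rw [batch, List.mem_toFinset] at hu
  exact hV.1.mem u (List.mem_of_mem_take hu)

theorem card_batch (hV : c.IsMaxSeq s V) :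
    (c.batch s V).card = (batchSeq c.indep c.ρ c.ε (c.T ∪ s.A) s.L c.f V).length :=
  List.toFinset_card_of_nodup (hV.1.nodup.sublist (List.take_sublist _ _))

theorem union_batch :
    c.T ∪ (s.A ∪ c.batch s V) =
      prefixSet (c.T ∪ s.A) V (min (c.indices s V).1 (c.indices s V).2) := by
  rw [← Finset.union_assoc]
  rfl

theorem indep_accept (hc : c.Valid) (hV : c.IsMaxSeq s V) :
    c.indep (c.T ∪ (s.A ∪ c.batch s V)) := by
  refine hc.system.subset _ _ ?_ hV.1.indep
  rw [union_batch]
  refine Finset.union_subset_union_right fun a ha => ?_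
  rw [List.mem_toFinset] at ha ⊢
  exact List.mem_of_mem_take ha

theorem accept_L_subset : (c.accept s V).L ⊆
    Eplus c.indep c.f c.ρ (c.T ∪ s.A) V s.L (min (c.indices s V).1 (c.indices s V).2) := by
  intro u hu
  unfold accept at hu
  simp only at hu
  rw [mem_valuable, union_batch, Finset.mem_sdiff] at hu
  unfold Eplus
  rw [mem_valuable]
  exact ⟨hu.1.1, hu.2⟩

theorem accept_L_subset_L : (c.accept s V).L ⊆ s.L := fun _ hu =>
  (Finset.mem_sdiff.1 (mem_valuable.1 hu).1).1

theorem reject_L_subset_L : (c.reject s V).L ⊆ s.L := fun _ hu =>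
  (Finset.mem_sdiff.1 (mem_valuable.1 hu).1).1

/-- If an accepted batch does not increase the counter, it shrinks the candidate set. -/
theorem card_accept_L_le (hc : c.Valid) (hs : c.Inv s) (hL : s.L.Nonempty) (hV : c.IsMaxSeq s V)
    (h : (c.indices s V).1 ≤ (c.indices s V).2) :
    ((c.accept s V).L.card : ℝ) ≤ (1 - c.ε) * s.L.card := by
  have h1 := min_searchResult_le (hs.regular hc hL) hc.eps_lt_one hV.2
  have h2 : (c.indices s V).1 ≤ V.length := by
    rwa [← min_eq_left h]
  have h3 := leastIndex_spec h2
  refine le_trans ?_ h3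
  have h4 := accept_L_subset (c := c) (s := s) (V := V)
  rw [min_eq_left h] at h4
  exact_mod_cast Finset.card_le_card h4

/-- Every `v_j` is put into `X`, but into `W` only if its step gain is nonnegative. An element put
into both does not decrease `f(W) - f(X)`, because `W ⊆ X`; an element put only into `X` lowers
`f(X)` by at least its negative gain. -/
theorem exists_charge_prefix (hf : Submodular c.f) {B L W X : Finset N}
    (hV : IsSeq c.indep B L V) (hWB : W ⊆ B) (hBX : B ⊆ X) (hX : Disjoint X L) :
    ∀ i ≤ V.length, ∃ W' ⊆ prefixSet B V i,
      c.f W - c.f X + ∑ j ∈ Finset.range i, max (-stepGain c.f B V j) 0 ≤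
        c.f W' - c.f (X ∪ (V.take i).toFinset) := by
  intro i
  induction i with
  | zero => intro _; exact ⟨W, by simpa [prefixSet] using hWB, by simp⟩
  | succ i ih =>
    intro hi
    obtain ⟨W', hW', h⟩ := ih (Nat.le_of_succ_le hi)
    have hBL : Disjoint L B := (hX.mono_left hBX).symm
    have hnot := hV.getElem_notMem hBL hi
    have hmem := hV.mem _ (List.getElem_mem hi)
    have hGX : prefixSet B V i ⊆ X ∪ (V.take i).toFinset := Finset.union_subset_union_left hBX
    have hnX : V[i] ∉ X ∪ (V.take i).toFinset := by
      rw [Finset.mem_union]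
      rintro (h' | h')
      · exact Finset.disjoint_left.1 hX h' hmem
      · exact hnot (Finset.mem_union_right _ h')
    have hXs : X ∪ (V.take (i + 1)).toFinset = insert V[i] (X ∪ (V.take i).toFinset) :=
      prefixSet_succ (B := X) hi
    have hstep : stepGain c.f B V i = marg c.f V[i] (prefixSet B V i) := by
      rw [stepGain, marg, prefixSet_succ hi]
    rw [Finset.sum_range_succ, hXs, hstep, prefixSet_succ hi]
    rcases le_or_gt 0 (marg c.f V[i] (prefixSet B V i)) with h0 | h0
    · refine ⟨insert V[i] W', Finset.insert_subset_insert _ hW', ?_⟩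
      rw [max_eq_right (by linarith)]
      have := hf.marg_anti (hW'.trans hGX) hnX
      unfold marg at this
      linarith
    · refine ⟨W', hW'.trans (Finset.subset_insert _ _), ?_⟩
      rw [max_eq_left (by linarith)]
      have := hf.marg_anti hGX hnX
      have h2 : marg c.f V[i] (X ∪ (V.take i).toFinset) =
        c.f (insert V[i] (X ∪ (V.take i).toFinset)) - c.f (X ∪ (V.take i).toFinset) := rfl
      linarith

theorem exists_charge (hf : Submodular c.f) {B L W X : Finset N}
    (hV : IsSeq c.indep B L V) (hWB : W ⊆ B) (hBX : B ⊆ X) (hX : Disjoint X L) {i : ℕ}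
    (hi : i ≤ V.length) : ∃ W' X', W' ⊆ prefixSet B V i ∧ prefixSet B V i ⊆ X' ∧
      (∀ u ∈ X', u ∈ L → u ∈ prefixSet B V i ∨ marg c.f u (prefixSet B V i) < 0) ∧
      c.f W - c.f X + negSum c.f B V L i ≤ c.f W' - c.f X' := by
  obtain ⟨W', hW', h⟩ := exists_charge_prefix hf hV hWB hBX hX i hi
  have hGX : prefixSet B V i ⊆ X ∪ (V.take i).toFinset := Finset.union_subset_union_left hBX
  set G := prefixSet B V i with hG
  set Z := X ∪ (V.take i).toFinset with hZ
  -- Enlarging `X` by the elements of negative marginal collects the other half of `negSum`. They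
  -- lie outside `Z`: the old `X` is disjoint from `L`, and prefix elements have marginal `0`.
  set E := L.filter fun u => marg c.f u G < 0 with hE
  refine ⟨W', Z ∪ E, hW', hGX.trans Finset.subset_union_left, ?_, ?_⟩
  · intro u hu huL
    rw [Finset.mem_union, hZ, Finset.mem_union] at hu
    rcases hu with (hu | hu) | hu
    · exact absurd huL (Finset.disjoint_left.1 hX hu)
    · exact Or.inl (Finset.mem_union_right _ hu)
    · exact Or.inr (Finset.mem_filter.1 hu).2
  · have hnot : ∀ u ∈ E, u ∉ Z := by
      intro u hu huZ
      rw [hE, Finset.mem_filter] at hu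
      rw [hZ, Finset.mem_union] at huZ
      rcases huZ with h' | h'
      · exact Finset.disjoint_left.1 hX h' hu.1
      · have h0 : marg c.f u G = 0 := marg_of_mem (Finset.mem_union_right _ h')
        exact lt_irrefl _ (h0 ▸ hu.2)
    have h1 := hf.union_le Z E
    have h2 : E \ Z = E := Finset.sdiff_eq_self_of_disjoint (Finset.disjoint_left.2 hnot)
    rw [h2] at h1
    have h3 : ∑ u ∈ E, marg c.f u Z ≤ ∑ u ∈ E, marg c.f u G :=
      Finset.sum_le_sum fun u hu => hf.marg_anti hGX (hnot u hu)
    have h4 : ∑ u ∈ E, marg c.f u G = -∑ u ∈ L, max (-marg c.f u G) 0 := by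
      rw [hE, Finset.sum_filter, ← Finset.sum_neg_distrib]
      refine Finset.sum_congr rfl fun u _ => ?_
      split_ifs with h0
      · rw [max_eq_left (by linarith), neg_neg]
      · rw [max_eq_right (by linarith), neg_zero]
    unfold negSum
    linarith

theorem negSum_nonneg (f : Finset N → ℝ) (B : Finset N) (V : List N) (L : Finset N) (i : ℕ) :
    0 ≤ negSum f B V L i :=
  add_nonneg (Finset.sum_nonneg fun _ _ => le_max_right _ _)
    (Finset.sum_nonneg fun _ _ => le_max_right _ _)

theorem Inv.sum_nonneg (hc : c.Valid) (hs : c.Inv s) :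
    0 ≤ ∑ u ∈ s.L, marg c.f u (c.T ∪ s.A) :=
  Finset.sum_nonneg fun u hu => hc.rho_nonneg.trans (hs.large u hu).1

theorem Inv.reject (hc : c.Valid) (hs : c.Inv s) (hV : c.IsMaxSeq s V) :
    c.Inv (c.reject s V) := by
  have hsub := reject_L_subset_L (c := c) (s := s) (V := V)
  refine ⟨hs.indep, hs.A_subset.trans Finset.subset_union_left,
    Finset.union_subset hs.U_subset ((batch_subset hV).trans hs.L_subset),
    hsub.trans hs.L_subset, ?_, ?_, ?_, ?_⟩
  · exact Finset.disjoint_left.2 fun u hu =>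
      (Finset.mem_sdiff.1 (mem_valuable.1 hu).1).2
  · exact fun u hu => (mem_valuable.1 hu).2
  · intro u hu hU hL hind
    have hU' : u ∉ s.U := fun h => hU (Finset.mem_union_left _ h)
    by_cases huL : u ∈ s.L
    · refine lt_of_not_ge fun h => hL (mem_valuable.2 ⟨Finset.mem_sdiff.2 ⟨huL, hU⟩, h, hind⟩)
    · exact hs.small u hu hU' huL hind
  · obtain ⟨W, X, h1, h2, h3, h4⟩ := hs.charge
    refine ⟨W, X, h1, h2, h3.mono_right hsub, le_trans ?_ h4⟩
    refine mul_le_mul_of_nonneg_left (mul_le_mul_of_nonneg_left ?_ hc.eps_pos.le)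
      (Nat.cast_nonneg _)
    exact Finset.sum_le_sum_of_subset_of_nonneg hsub
      fun u hu _ => hc.rho_nonneg.trans (hs.large u hu).1

theorem notMem_accept (hc : c.Valid) (hs : c.Inv s) {u : N} (huL : u ∈ (c.accept s V).L) :
    u ∉ c.T ∪ (s.A ∪ c.batch s V) := by
  have h := Finset.mem_sdiff.1 (mem_valuable.1 huL).1
  intro hu
  rw [← Finset.union_assoc, Finset.mem_union] at hu
  rcases hu with hu | hu
  · exact Finset.disjoint_left.1 (hs.disjoint_base hc) h.1 hu
  · exact h.2 (Finset.mem_union_right _ hu)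

theorem base_subset : c.T ∪ s.A ⊆ c.T ∪ (s.A ∪ c.batch s V) :=
  Finset.union_subset_union_right Finset.subset_union_left

theorem Inv.accept (hc : c.Valid) (hs : c.Inv s) (hL : s.L.Nonempty) (hV : c.IsMaxSeq s V) :
    c.Inv (c.accept s V) := by
  have hsub := accept_L_subset_L (c := c) (s := s) (V := V)
  have hbase := base_subset (c := c) (s := s) (V := V)
  refine ⟨indep_accept hc hV, Finset.union_subset_union_left hs.A_subset,
    Finset.union_subset hs.U_subset ((batch_subset hV).trans hs.L_subset),
    hsub.trans hs.L_subset, ?_, ?_, ?_, ?_⟩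
  · exact Finset.disjoint_left.2 fun u hu =>
      (Finset.mem_sdiff.1 (mem_valuable.1 hu).1).2
  · exact fun u hu => (mem_valuable.1 hu).2
  · intro u hu hU hL hind
    change c.indep (insert u (c.T ∪ (s.A ∪ c.batch s V))) at hind
    change marg c.f u (c.T ∪ (s.A ∪ c.batch s V)) < c.ρ
    have hU' : u ∉ s.U := fun h => hU (Finset.mem_union_left _ h)
    by_cases huL : u ∈ s.L
    · refine lt_of_not_ge fun h => hL (mem_valuable.2 ⟨Finset.mem_sdiff.2 ⟨huL, hU⟩, h, hind⟩)
    · have hnot : u ∉ c.T ∪ (s.A ∪ c.batch s V) := by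
        rw [Finset.mem_union, Finset.mem_union]
        rintro (h | h | h)
        · exact Finset.disjoint_left.1 hc.disjoint hu h
        · exact hU' (hs.A_subset h)
        · exact hU (Finset.mem_union_right _ h)
      exact (hc.submodular.marg_anti hbase hnot).trans_lt
        (hs.small u hu hU' huL (hc.system.subset _ _ (Finset.insert_subset_insert _ hbase) hind))
  · obtain ⟨W, X, h1, h2, h3, h4⟩ := hs.charge
    have hmin := min_searchResult_le (hs.regular hc hL) hc.eps_lt_one hV.2
    obtain ⟨W', X', g1, g2, g3, g4⟩ := exists_charge hc.submodular hV.1 h1 h2 h3 hmin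
    have hset := union_batch (c := c) (s := s) (V := V)
    unfold indices at hset
    rw [← hset] at g1 g2 g3
    refine ⟨W', X', g1, g2, Finset.disjoint_left.2 fun u hu huL => ?_, le_trans ?_ g4⟩
    · rcases g3 u hu (hsub huL) with h | h
      · exact notMem_accept hc hs huL h
      · exact absurd (mem_valuable.1 huL).2.1 (not_le.2 (h.trans_le hc.rho_nonneg))
    -- The value of the remaining candidates only decreases, so all earlier increments stay paid for
    -- at the new, smaller rate. A new increment is paid by `negSum` through the second condition.
    · have hle : ∑ u ∈ (c.accept s V).L, marg c.f u (c.T ∪ (s.A ∪ c.batch s V)) ≤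
          ∑ u ∈ s.L, marg c.f u (c.T ∪ s.A) :=
        (Finset.sum_le_sum fun u hu => hc.submodular.marg_anti hbase
          (notMem_accept hc hs hu)).trans (Finset.sum_le_sum_of_subset_of_nonneg hsub
            fun u hu _ => hc.rho_nonneg.trans (hs.large u hu).1)
      have hold : (s.count : ℝ) * (c.ε * ∑ u ∈ (c.accept s V).L,
          marg c.f u (c.T ∪ (s.A ∪ c.batch s V))) ≤ c.f W - c.f X :=
        (mul_le_mul_of_nonneg_left (mul_le_mul_of_nonneg_left hle hc.eps_pos.le)
          (Nat.cast_nonneg _)).trans h4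
      have hneg := negSum_nonneg c.f (c.T ∪ s.A) V s.L
        (min (c.indices s V).1 (c.indices s V).2)
      by_cases hlt : (c.indices s V).2 < (c.indices s V).1
      · have hcount : (c.accept s V).count = s.count + 1 := if_pos hlt
        have hcond : c.ε * ∑ u ∈ (c.accept s V).L, marg c.f u (c.T ∪ (s.A ∪ c.batch s V)) ≤
            negSum c.f (c.T ∪ s.A) V s.L (min (c.indices s V).1 (c.indices s V).2) := by
          have h5 : (c.indices s V).2 ≤ V.length := by
            rwa [← min_eq_right hlt.le]
          have h6 := leastIndex_spec h5
          rw [cond₂_iff] at h6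
          rw [min_eq_right hlt.le]
          refine le_trans (mul_le_mul_of_nonneg_left ?_ hc.eps_pos.le) h6
          have h7 := accept_L_subset (c := c) (s := s) (V := V)
          have h8 := union_batch (c := c) (s := s) (V := V)
          rw [min_eq_right hlt.le] at h7 h8
          rw [h8]
          exact Finset.sum_le_sum_of_subset_of_nonneg h7
            fun u hu _ => hc.rho_nonneg.trans (mem_valuable.1 hu).2.1
        rw [hcount]
        push_cast
        change ((s.count : ℝ) + 1) * (c.ε * ∑ u ∈ (c.accept s V).L,
          marg c.f u (c.T ∪ (s.A ∪ c.batch s V))) ≤ c.f W - c.f X +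
            negSum c.f (c.T ∪ s.A) V s.L (min (c.indices s V).1 (c.indices s V).2)
        linarith
      · have hcount : (c.accept s V).count = s.count := if_neg hlt
        rw [hcount]
        change (s.count : ℝ) * (c.ε * ∑ u ∈ (c.accept s V).L,
          marg c.f u (c.T ∪ (s.A ∪ c.batch s V))) ≤ c.f W - c.f X +
            negSum c.f (c.T ∪ s.A) V s.L (min (c.indices s V).1 (c.indices s V).2)
        linarith

/-- When the counter has reached `M`, the remaining candidates have little total value. -/
theorem Inv.leftover_le (hc : c.Valid) (hs : c.Inv s) {O : Finset N}
    (hO : IsOptimal c.indep c.f O) {M : ℕ} (hM : M ≤ s.count) :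
    M * (c.ε * ∑ u ∈ s.L, marg c.f u (c.T ∪ s.A)) ≤ c.f O := by
  obtain ⟨W, X, h1, _, _, h4⟩ := hs.charge
  have h5 := hO.2 W (hc.system.subset _ _ h1 hs.indep)
  have h6 := hc.nonneg X
  have h7 : (M : ℝ) * (c.ε * ∑ u ∈ s.L, marg c.f u (c.T ∪ s.A)) ≤
      s.count * (c.ε * ∑ u ∈ s.L, marg c.f u (c.T ∪ s.A)) :=
    mul_le_mul_of_nonneg_right (by exact_mod_cast hM)
      (mul_nonneg hc.eps_pos.le (hs.sum_nonneg hc))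
  linarith

end Batch

/-! ### Running the while-loop: expectation, safety and cost. -/

namespace Batch

variable {N : Type u} [DecidableEq N] {c : Batch N} {s : State N} {V : List N}
  {mode : SearchMode} {M : ℕ} {p : unitInterval}

/-- The while-loop of `RandBatch`, started in the state `s`. -/
def loop (c : Batch N) (mode : SearchMode) (M : ℕ) (p : unitInterval) (t : ℕ) (s : State N) :
    Comp N (Finset N × Finset N × Finset N) :=
  randBatchLoop mode c.indep c.T c.ρ M p c.ε t s.A s.U s.L s.count

theorem loop_succ_of_not (t : ℕ) (h : ¬ (s.L.Nonempty ∧ s.count < M)) :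
    c.loop mode M p (t + 1) s = .pure (s.A, s.U, s.L) := by
  rw [loop, randBatchLoop, if_neg h]

/-- The rest of an iteration, once the batch has been found. -/
def finish (c : Batch N) (p : unitInterval) (s : State N) (V : List N) (τ : ℕ × ℕ)
    (cont : State N → Comp N (Finset N × Finset N × Finset N)) :
    Comp N (Finset N × Finset N × Finset N) :=
  let R := (V.take (min τ.1 τ.2)).toFinset
  .flip p fun x =>
    .ask (margQueries (c.T ∪ if x then s.A ∪ R else s.A) (s.L \ (s.U ∪ R))) fun g =>
      cont ⟨if x then s.A ∪ R else s.A, s.U ∪ R,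
        valuable c.indep g c.ρ (c.T ∪ if x then s.A ∪ R else s.A) (s.L \ (s.U ∪ R)),
        if x ∧ τ.2 < τ.1 then s.count + 1 else s.count⟩

theorem loop_succ (t : ℕ) (h : s.L.Nonempty ∧ s.count < M) :
    c.loop mode M p (t + 1) s =
      (getSEQ c.indep (c.T ∪ s.A) s.L).bind fun V =>
        (search mode c.indep c.ρ c.ε (c.T ∪ s.A) V s.L).bind fun τ =>
          c.finish p s V τ (c.loop mode M p t) := by
  rw [loop, randBatchLoop, if_pos h]
  rfl

theorem ex_finish (cont : State N → Comp N (Finset N × Finset N × Finset N)) (z : ℝ)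
    (h : Finset N × Finset N × Finset N → ℝ) :
    (c.finish p s V (c.indices s V) cont).ex c.f z h =
      p * (cont (c.accept s V)).ex c.f z h + (1 - p) * (cont (c.reject s V)).ex c.f z h := by
  simp only [finish, Comp.ex, valuable_answers, if_true, true_and, Bool.false_eq_true, if_false,
    false_and]
  rfl

theorem cst_finish (cont : State N → Comp N (Finset N × Finset N × Finset N)) {w : ℕ → ℝ}
    (hw : Monotone w) :
    (c.finish p s V (c.indices s V) cont).cst c.f w ≤
      w (s.L.card + 1) +
        (p * (cont (c.accept s V)).cst c.f w + (1 - p) * (cont (c.reject s V)).cst c.f w) := by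
  have hq : ∀ X Y : Finset N, w (margQueries X (s.L \ Y)).card ≤ w (s.L.card + 1) :=
    fun X Y => hw ((card_margQueries_le _ _).trans
      (Nat.succ_le_succ (Finset.card_le_card Finset.sdiff_subset)))
  have h1 := mul_le_mul_of_nonneg_left (hq (c.T ∪ (s.A ∪ c.batch s V)) (s.U ∪ c.batch s V)) p.2.1
  have h2 := mul_le_mul_of_nonneg_left (hq (c.T ∪ s.A) (s.U ∪ c.batch s V)) (sub_nonneg.2 p.2.2)
  have h3 : (c.finish p s V (c.indices s V) cont).cst c.f w =
      p * (w (margQueries (c.T ∪ (s.A ∪ c.batch s V)) (s.L \ (s.U ∪ c.batch s V))).card +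
        (cont (c.accept s V)).cst c.f w) +
      (1 - p) * (w (margQueries (c.T ∪ s.A) (s.L \ (s.U ∪ c.batch s V))).card +
        (cont (c.reject s V)).cst c.f w) := by
    simp only [finish, Comp.cst, valuable_answers, if_true, true_and, Bool.false_eq_true, if_false,
      false_and]
    rfl
  rw [h3]
  linarith

theorem safe_getSEQ_state (hc : c.Valid) (hs : c.Inv s) (b : ℕ) :
    (getSEQ c.indep (c.T ∪ s.A) s.L).Safe c.f b (c.IsMaxSeq s) :=
  safe_getSEQ hc.system b hs.indep fun u hu => (hs.large u hu).2

theorem ex_search_state (hc : c.Valid) (hs : c.Inv s) (hL : s.L.Nonempty) (hV : c.IsMaxSeq s V)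
    (z : ℝ) (h : ℕ × ℕ → ℝ) :
    (search mode c.indep c.ρ c.ε (c.T ∪ s.A) V s.L).ex c.f z h = h (c.indices s V) :=
  ex_search hc.submodular hc.system (hs.regular hc hL) hc.eps_pos.le hV.1 (hs.disjoint_base hc)
    mode z h

theorem ex_loop_succ (hc : c.Valid) (hs : c.Inv s) (t : ℕ) (h : s.L.Nonempty ∧ s.count < M)
    (z : ℝ) (F : Finset N × Finset N × Finset N → ℝ) :
    (c.loop mode M p (t + 1) s).ex c.f z F =
      (getSEQ c.indep (c.T ∪ s.A) s.L).ex c.f z fun V =>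
        p * (c.loop mode M p t (c.accept s V)).ex c.f z F +
          (1 - p) * (c.loop mode M p t (c.reject s V)).ex c.f z F := by
  rw [loop_succ t h, Comp.ex_bind]
  refine Comp.ex_congr (safe_getSEQ_state hc hs 0) fun V hV => ?_
  rw [Comp.ex_bind, ex_search_state hc hs h.1 hV, ex_finish]

/-- The rule for lower bounds on expectations over the while-loop. -/
theorem le_ex_loop (hc : c.Valid) {Ψ : State N → ℝ} {F : Finset N × Finset N × Finset N → ℝ}
    {z : ℝ} (hz : ∀ s, c.Inv s → Ψ s ≤ z)
    (hend : ∀ s, c.Inv s → ¬ (s.L.Nonempty ∧ s.count < M) → Ψ s ≤ F (s.A, s.U, s.L))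
    (hstep : ∀ s, c.Inv s → s.L.Nonempty → Ψ s ≤ (getSEQ c.indep (c.T ∪ s.A) s.L).ex c.f z
      fun V => p * Ψ (c.accept s V) + (1 - p) * Ψ (c.reject s V)) :
    ∀ (t : ℕ) (s : State N), c.Inv s → Ψ s ≤ (c.loop mode M p t s).ex c.f z F := by
  intro t
  induction t with
  | zero => exact fun s hs => hz s hs
  | succ t ih =>
    intro s hs
    by_cases h : s.L.Nonempty ∧ s.count < M
    · rw [ex_loop_succ hc hs t h]
      refine (hstep s hs h.1).trans (Comp.ex_mono le_rfl (safe_getSEQ_state hc hs 0) ?_)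
      intro V hV
      exact add_le_add
        (mul_le_mul_of_nonneg_left (ih _ (hs.accept hc h.1 hV)) p.2.1)
        (mul_le_mul_of_nonneg_left (ih _ (hs.reject hc hV)) (sub_nonneg.2 p.2.2))
    · rw [loop_succ_of_not t h]
      exact hend s hs h

theorem safe_finish (τ : ℕ × ℕ) (hτ : τ = c.indices s V) {b : ℕ} (hb : s.L.card + 1 ≤ b)
    {P : Finset N × Finset N × Finset N → Prop}
    {cont : State N → Comp N (Finset N × Finset N × Finset N)}
    (ha : (cont (c.accept s V)).Safe c.f b P) (hr : (cont (c.reject s V)).Safe c.f b P) :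
    (c.finish p s V τ cont).Safe c.f b P := by
  subst hτ
  have hq : ∀ X Y : Finset N, (margQueries X (s.L \ Y)).card ≤ b := fun X Y =>
    ((card_margQueries_le _ _).trans
      (Nat.succ_le_succ (Finset.card_le_card Finset.sdiff_subset))).trans hb
  intro x
  refine ⟨hq _ _, ?_⟩
  simp only [valuable_answers]
  cases x
  · simp only [Bool.false_eq_true, if_false, false_and]
    exact hr
  · simp only [if_true, true_and]
    exact ha

theorem safe_loop [Fintype N] [Nonempty N] (hc : c.Valid) : ∀ (t : ℕ) (s : State N), c.Inv s →
    (c.loop mode M p t s).Safe c.f ((Fintype.card N + 1) ^ 2) fun r =>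
      ∃ n, c.Inv ⟨r.1, r.2.1, r.2.2, n⟩ ∧ ¬ (r.2.2.Nonempty ∧ n < M) := by
  intro t
  induction t with
  | zero => exact fun _ _ => trivial
  | succ t ih =>
    intro s hs
    by_cases h : s.L.Nonempty ∧ s.count < M
    · rw [loop_succ t h]
      refine (safe_getSEQ_state hc hs _).bind fun V hV => ?_
      have hn : 1 ≤ Fintype.card N := Fintype.card_pos
      have hlen : V.length ≤ Fintype.card N := by
        rw [← List.toFinset_card_of_nodup hV.1.nodup]
        exact Finset.card_le_univ _
      have hL : s.L.card ≤ Fintype.card N := Finset.card_le_univ _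
      refine (safe_search hc.submodular hc.system (hs.regular hc h.1) hc.eps_pos.le hV.1
        (hs.disjoint_base hc) mode hn hL hlen).bind fun τ hτ => ?_
      refine safe_finish τ hτ ?_ (ih _ (hs.accept hc h.1 hV)) (ih _ (hs.reject hc hV))
      nlinarith
    · rw [loop_succ_of_not t h]
      exact ⟨s.count, hs, h⟩

theorem abortsAfter_loop (f : Finset N → ℝ) : ∀ (t : ℕ) (s : State N),
    (c.loop mode M p t s).AbortsAfter f t := by
  intro t
  induction t with
  | zero => exact fun s => rfl
  | succ t ih =>
    intro s
    by_cases h : s.L.Nonempty ∧ s.count < M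
    · rw [loop_succ t h]
      exact (abortsAfter_getSEQ _).bind fun V => (abortsAfter_search _ _).bind fun τ x => ih _
    · rw [loop_succ_of_not t h]
      trivial

/-- A later cut-off only turns aborts, which count `0`, into results. This provides the monotonicity
behind the suprema in `outputProb`. -/
theorem ex_loop_mono (f : Finset N → ℝ) {F : Finset N × Finset N × Finset N → ℝ}
    (hF : ∀ r, 0 ≤ F r) : ∀ (t : ℕ) (s : State N),
    (c.loop mode M p t s).ex f 0 F ≤ (c.loop mode M p (t + 1) s).ex f 0 F := by
  intro t
  induction t with
  | zero => exact fun s => Comp.ex_nonneg _ hF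
  | succ t ih =>
    intro s
    by_cases h : s.L.Nonempty ∧ s.count < M
    · rw [loop_succ t h, loop_succ (t + 1) h, Comp.ex_bind, Comp.ex_bind]
      refine Comp.ex_mono' le_rfl _ fun V => ?_
      rw [Comp.ex_bind, Comp.ex_bind]
      refine Comp.ex_mono' le_rfl _ fun τ => ?_
      simp only [finish, Comp.ex]
      exact add_le_add (mul_le_mul_of_nonneg_left (ih _) p.2.1)
        (mul_le_mul_of_nonneg_left (ih _) (sub_nonneg.2 p.2.2))
    · rw [loop_succ_of_not t h, loop_succ_of_not (t + 1) h]

/-! The expected cost -/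

open Classical in
/-- A bound on the number of accepted batches that are still possible. -/
def progress (c : Batch N) (M : ℕ) (s : State N) : ℝ :=
  ((M : ℝ) - s.count) +
    if s.L.Nonempty then Real.log s.L.card / (-Real.log (1 - c.ε)) + 1 else 0

theorem neg_log_pos {ε : ℝ} (hε : 0 < ε) (hε1 : ε < 1) : 0 < -Real.log (1 - ε) := by
  have := Real.log_neg (x := 1 - ε) (by linarith) (by linarith)
  linarith

theorem progress_L_mono (hc : c.Valid) {A A' U U' L L' : Finset N} {n : ℕ} (h : L' ⊆ L) :
    c.progress M ⟨A', U', L', n⟩ ≤ c.progress M ⟨A, U, L, n⟩ := by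
  have hl := neg_log_pos hc.eps_pos hc.eps_lt_one
  unfold progress
  simp only
  have h0 : ∀ L : Finset N, 0 ≤ Real.log L.card := fun L => Real.log_natCast_nonneg _
  refine add_le_add le_rfl ?_
  split_ifs with h1 h2 h2
  · have : Real.log L'.card ≤ Real.log L.card :=
      Real.log_le_log (by exact_mod_cast h1.card_pos) (by exact_mod_cast Finset.card_le_card h)
    gcongr
  · exact absurd (h1.mono h) h2
  · have := h0 L
    positivity
  · exact le_rfl

theorem progress_reject_le (hc : c.Valid) : c.progress M (c.reject s V) ≤ c.progress M s :=
  progress_L_mono hc reject_L_subset_L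

/-- Either the counter takes the unit, or `|L|` shrinks by the factor `1 - ε` and its logarithm to
the base `1/(1 - ε)` drops by one. The summand `1` for nonempty `L` pays for the batch that empties
`L`. -/
theorem progress_accept_le (hc : c.Valid) (hs : c.Inv s) (hL : s.L.Nonempty)
    (hV : c.IsMaxSeq s V) : c.progress M (c.accept s V) ≤ c.progress M s - 1 := by
  have hl := neg_log_pos hc.eps_pos hc.eps_lt_one
  by_cases hlt : (c.indices s V).2 < (c.indices s V).1
  · have hcount : (c.accept s V).count = s.count + 1 := if_pos hlt
    have h1 : c.progress M ⟨(c.accept s V).A, (c.accept s V).U, (c.accept s V).L, s.count⟩ ≤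
      c.progress M s := progress_L_mono hc accept_L_subset_L
    have h2 : c.progress M (c.accept s V) =
        c.progress M ⟨(c.accept s V).A, (c.accept s V).U, (c.accept s V).L, s.count⟩ - 1 := by
      simp only [progress, hcount]
      push_cast
      ring
    linarith
  · have hcount : (c.accept s V).count = s.count := if_neg hlt
    have hcard := card_accept_L_le hc hs hL hV (not_lt.1 hlt)
    unfold progress
    rw [hcount, if_pos hL]
    have h0 : 0 ≤ Real.log s.L.card := Real.log_natCast_nonneg _
    split_ifs with h1
    · have hpos : (0 : ℝ) < (c.accept s V).L.card := by exact_mod_cast h1.card_pos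
      have hpos' : (0 : ℝ) < s.L.card := by exact_mod_cast hL.card_pos
      have h2 := Real.log_le_log hpos hcard
      rw [Real.log_mul (by linarith [hc.eps_lt_one]) hpos'.ne'] at h2
      have h3 : Real.log (c.accept s V).L.card / (-Real.log (1 - c.ε)) ≤
          Real.log s.L.card / (-Real.log (1 - c.ε)) - 1 := by
        rw [div_sub_one hl.ne']
        gcongr
        linarith
      linarith
    · have : 0 ≤ Real.log s.L.card / (-Real.log (1 - c.ε)) := by positivity
      linarith

theorem progress_nonneg (hc : c.Valid) (h : s.count ≤ M) : 0 ≤ c.progress M s := by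
  have hl := neg_log_pos hc.eps_pos hc.eps_lt_one
  have h0 : 0 ≤ Real.log s.L.card := Real.log_natCast_nonneg _
  have h1 : (s.count : ℝ) ≤ M := by exact_mod_cast h
  unfold progress
  refine add_nonneg (by linarith) ?_
  split_ifs
  · positivity
  · exact le_rfl

theorem accept_count_le (h : s.count < M) : (c.accept s V).count ≤ M := by
  simp only [accept]
  split_ifs <;> omega

/-- With probability `p` the progress measure falls by one, so `b / p` times it falls by `b` in
expectation, which pays for one iteration. -/
theorem cst_loop_le (hc : c.Valid) (hp : 0 < (p : ℝ)) {w : ℕ → ℝ} (hw : Monotone w) {b : ℝ}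
    (hb0 : 0 ≤ b)
    (hb : ∀ s V, c.Inv s → s.L.Nonempty → c.IsMaxSeq s V →
      (search mode c.indep c.ρ c.ε (c.T ∪ s.A) V s.L).cst c.f w + w (s.L.card + 1) ≤ b) :
    ∀ (t : ℕ) (s : State N), c.Inv s → s.count ≤ M →
      (c.loop mode M p t s).cst c.f w ≤ b / p * c.progress M s := by
  intro t
  have hbp : 0 ≤ b / p := by positivity
  induction t with
  | zero => exact fun s hs h => mul_nonneg hbp (progress_nonneg hc h)
  | succ t ih =>
    intro s hs hM
    by_cases h : s.L.Nonempty ∧ s.count < M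
    · rw [loop_succ t h, Comp.cst_bind, cst_getSEQ, zero_add]
      have hpt : ∀ V, c.IsMaxSeq s V →
          ((search mode c.indep c.ρ c.ε (c.T ∪ s.A) V s.L).bind fun τ =>
            c.finish p s V τ (c.loop mode M p t)).cst c.f w ≤ b / p * c.progress M s := by
        intro V hV
        rw [Comp.cst_bind, ex_search_state hc hs h.1 hV]
        have h1 := cst_finish (c := c) (s := s) (V := V) (p := p) (c.loop mode M p t) hw
        have h2 := (ih _ (hs.accept hc h.1 hV) (accept_count_le h.2)).trans
          (mul_le_mul_of_nonneg_left (progress_accept_le (M := M) hc hs h.1 hV) hbp)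
        have h3 := (ih _ (hs.reject hc hV) hM).trans
          (mul_le_mul_of_nonneg_left (progress_reject_le (M := M) (V := V) hc) hbp)
        have h4 := mul_le_mul_of_nonneg_left h2 p.2.1
        have h5 := mul_le_mul_of_nonneg_left h3 (sub_nonneg.2 p.2.2)
        have h6 := hb s V hs h.1 hV
        have h7 : (p : ℝ) * (b / p * (c.progress M s - 1)) = p * (b / p * c.progress M s) - b := by
          field_simp
        linarith
      have hle := Comp.ex_mono (le_refl (0 : ℝ)) (safe_getSEQ_state hc hs 0) hpt
      refine hle.trans ?_
      rw [Comp.ex_eq_of_abortsAfter (fun t => abortsAfter_getSEQ t) 0 (b / p * c.progress M s),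
        Comp.ex_const]
    · rw [loop_succ_of_not t h]
      exact mul_nonneg hbp (progress_nonneg hc hM)

end Batch

/-! ### The potential function -/

section Potential

variable {N : Type u} [DecidableEq N] {f : Finset N → ℝ} {indep : Finset N → Prop}
  {O B J R : Finset N} {κ k σ : ℝ}

open Classical in
/-- The elements of `O \ B` that are no longer in `J` or cannot be added to `B`. -/
def settled (indep : Finset N → Prop) (O B J : Finset N) : Finset N :=
  O.filter fun u => u ∉ B ∧ (u ∉ J ∨ ¬ indep (insert u B))

theorem mem_settled {u : N} : u ∈ settled indep O B J ↔
    u ∈ O ∧ u ∉ B ∧ (u ∉ J ∨ ¬ indep (insert u B)) := by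
  simp [settled]

/-- The potential of a solution `B` and a set `J` of remaining candidates. -/
def potential (f : Finset N → ℝ) (indep : Finset N → Prop) (O : Finset N) (κ k σ : ℝ)
    (B J : Finset N) : ℝ :=
  κ * f B - ∑ u ∈ settled indep O B J, marg f u B -
    σ * (k * B.card - (blocked indep O B).card)

theorem settled_subset_sdiff : settled indep O B J ⊆ settled indep O B (J \ R) := by
  intro u hu
  rw [mem_settled] at hu ⊢
  exact ⟨hu.1, hu.2.1, hu.2.2.imp (fun h h' => h (Finset.mem_sdiff.1 h').1) id⟩

theorem settled_sdiff_subset : settled indep O B (J \ R) \ settled indep O B J ⊆ R := by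
  intro u hu
  rw [Finset.mem_sdiff, mem_settled, mem_settled] at hu
  by_contra hR
  refine hu.2 ⟨hu.1.1, hu.1.2.1, hu.1.2.2.imp (fun h h' => h (Finset.mem_sdiff.2 ⟨h', hR⟩)) id⟩

/-- Discarding `R` settles at most the elements of `R ∩ O`; nonnegativity allows summing over all of
`R`. It is used for rejected batches and for the candidates left over at the end of a phase. -/
theorem potential_sdiff (h0 : ∀ u ∈ R, 0 ≤ marg f u B) :
    potential f indep O κ k σ B J - ∑ u ∈ R, marg f u B ≤
      potential f indep O κ k σ B (J \ R) := by
  have h1 := Finset.sum_sdiff (settled_subset_sdiff (indep := indep) (O := O) (B := B) (J := J)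
    (R := R)) (f := fun u => marg f u B)
  have h2 : ∑ u ∈ settled indep O B (J \ R) \ settled indep O B J, marg f u B ≤
      ∑ u ∈ R, marg f u B :=
    Finset.sum_le_sum_of_subset_of_nonneg settled_sdiff_subset fun u hu _ => h0 u hu
  unfold potential
  linarith

/-- Old settled elements stay settled and their marginals decrease. A newly settled element was a
fitting candidate and is now blocked, so its marginal, at most `σ`, is offset by the growth of
`|blocked|`. Only `σk|R|`, from `|B|`, remains. -/
theorem potential_union (hf : Submodular f) (hI : IsIndependenceSystem indep) (hσ : 0 ≤ σ)
    (hRJ : R ⊆ J) (hRB : Disjoint R B) (hR : ∀ u ∈ R, indep (insert u B))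
    (hJ : ∀ u ∈ J, u ∉ B → indep (insert u B) → marg f u B ≤ σ) :
    potential f indep O κ k σ B J + κ * (f (B ∪ R) - f B) - σ * k * R.card ≤
      potential f indep O κ k σ (B ∪ R) (J \ R) := by
  have hB : B ⊆ B ∪ R := Finset.subset_union_left
  have hsub : settled indep O B J ⊆ settled indep O (B ∪ R) (J \ R) := by
    intro u hu
    rw [mem_settled] at hu ⊢
    have huR : u ∉ R := fun h => hu.2.2.elim (fun h' => h' (hRJ h)) fun h' => h' (hR u h)
    refine ⟨hu.1, by simp [hu.2.1, huR], hu.2.2.imp (fun h h' => h (Finset.mem_sdiff.1 h').1) ?_⟩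
    exact fun h h' => h (hI.subset _ _ (Finset.insert_subset_insert _ hB) h')
  have hbsub : blocked indep O B ⊆ blocked indep O (B ∪ R) := by
    intro u hu
    rw [mem_blocked] at hu ⊢
    have huR : u ∉ R := fun h => hu.2.2 (hR u h)
    refine ⟨hu.1, by simp [hu.2.1, huR], ?_⟩
    exact fun h' => hu.2.2 (hI.subset _ _ (Finset.insert_subset_insert _ hB) h')
  set E := settled indep O (B ∪ R) (J \ R) \ settled indep O B J with hE
  have hmemE : ∀ u ∈ E, u ∈ J ∧ u ∉ B ∪ R ∧ indep (insert u B) ∧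
      u ∈ blocked indep O (B ∪ R) \ blocked indep O B := by
    intro u hu
    rw [hE, Finset.mem_sdiff, mem_settled, mem_settled] at hu
    obtain ⟨⟨huO, huB, hu1⟩, hu2⟩ := hu
    have huB' : u ∉ B := fun h => huB (hB h)
    have huR : u ∉ R := fun h => huB (Finset.mem_union_right _ h)
    have huJ : u ∈ J := by
      by_contra h
      exact hu2 ⟨huO, huB', Or.inl h⟩
    have hind : indep (insert u B) := by
      by_contra h
      exact hu2 ⟨huO, huB', Or.inr h⟩
    refine ⟨huJ, huB, hind, Finset.mem_sdiff.2 ⟨mem_blocked.2 ⟨huO, huB, ?_⟩, ?_⟩⟩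
    · exact hu1.resolve_left fun h => h (Finset.mem_sdiff.2 ⟨huJ, huR⟩)
    · exact fun h => (mem_blocked.1 h).2.2 hind
  have h1 := Finset.sum_sdiff hsub (f := fun u => marg f u (B ∪ R))
  have h2 : ∑ u ∈ settled indep O B J, marg f u (B ∪ R) ≤
      ∑ u ∈ settled indep O B J, marg f u B :=
    Finset.sum_le_sum fun u hu => hf.marg_anti hB (mem_settled.1 (hsub hu)).2.1
  have h3 : ∑ u ∈ E, marg f u (B ∪ R) ≤ E.card * σ := by
    rw [← nsmul_eq_mul]
    refine Finset.sum_le_card_nsmul _ _ _ fun u hu => ?_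
    obtain ⟨huJ, huB, hind, _⟩ := hmemE u hu
    exact (hf.marg_anti hB huB).trans (hJ u huJ (fun h => huB (hB h)) hind)
  have h4 : (E.card : ℝ) ≤ (blocked indep O (B ∪ R)).card - (blocked indep O B).card := by
    have := Finset.card_le_card fun u hu => (hmemE u hu).2.2.2
    rw [Finset.card_sdiff_of_subset hbsub] at this
    have h5 := Finset.card_le_card hbsub
    rw [← Nat.cast_sub h5]
    exact_mod_cast this
  have h5 := mul_le_mul_of_nonneg_right h4 hσ
  have h6 : ((B ∪ R).card : ℝ) = B.card + R.card := by
    rw [Finset.card_union_of_disjoint hRB.symm]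
    push_cast
    rfl
  unfold potential
  rw [h6, ← h1]
  rw [← hE]
  linarith

/-- This is the passage to the next threshold; it needs only that the coefficient `k|B| - |blocked|`
is nonnegative. -/
theorem potential_anti {m : ℕ} (hk : IsKSystem m indep) (hO : indep O) (hB : indep B)
    {σ' : ℝ} (h : σ' ≤ σ) :
    potential f indep O κ m σ B J ≤ potential f indep O κ m σ' B J := by
  have h1 : ((blocked indep O B).card : ℝ) ≤ m * B.card := by
    exact_mod_cast hk.card_blocked_le hO hB
  unfold potential
  nlinarith

/-- A crude bound that serves as the value assigned to aborted runs; each settled marginal is at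
least `-f B ≥ -f O`. -/
theorem potential_le {m : ℕ} (hk : IsKSystem m indep) (hO : IsOptimal indep f O)
    (hf0 : ∀ X, 0 ≤ f X) (hB : indep B) (hσ : 0 ≤ σ) (hκ : 0 ≤ κ) :
    potential f indep O κ m σ B J ≤ (κ + O.card) * f O := by
  have h1 : ((blocked indep O B).card : ℝ) ≤ m * B.card := by
    exact_mod_cast hk.card_blocked_le hO.1 hB
  have h2 : (settled indep O B J).card • (-f B) ≤ ∑ u ∈ settled indep O B J, marg f u B :=
    Finset.card_nsmul_le_sum _ _ _ fun u _ => by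
      have := hf0 (insert u B)
      unfold marg
      linarith
  have h3 : ((settled indep O B J).card : ℝ) ≤ O.card := by
    exact_mod_cast Finset.card_le_card fun u hu => (mem_settled.1 hu).1
  have h4 := hO.2 B hB
  have h5 : (settled indep O B J).card * f B ≤ O.card * f O :=
    mul_le_mul h3 h4 (hf0 _) (Nat.cast_nonneg _)
  have h6 := mul_le_mul_of_nonneg_left h4 hκ
  have h7 : 0 ≤ σ * (m * B.card - (blocked indep O B).card) := mul_nonneg hσ (by linarith)
  rw [nsmul_eq_mul] at h2
  unfold potential
  linarith

/-- Elements of `O \ B` that were never settled still fit, so they are below the final threshold and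
cost at most `σ` each. -/
theorem potential_le_final {m : ℕ} (hk : IsKSystem m indep) (hO : indep O) (hB : indep B)
    (hσ : 0 ≤ σ) (hJ : ∀ u ∈ J, indep (insert u B) → marg f u B ≤ σ) :
    potential f indep O κ m σ B J - O.card * σ ≤ κ * f B - ∑ u ∈ O \ B, marg f u B := by
  have h1 : ((blocked indep O B).card : ℝ) ≤ m * B.card := by
    exact_mod_cast hk.card_blocked_le hO hB
  have h7 : 0 ≤ σ * (m * B.card - (blocked indep O B).card) := mul_nonneg hσ (by linarith)
  have hsub : settled indep O B J ⊆ O \ B := fun u hu =>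
    Finset.mem_sdiff.2 ⟨(mem_settled.1 hu).1, (mem_settled.1 hu).2.1⟩
  have h2 := Finset.sum_sdiff hsub (f := fun u => marg f u B)
  have h3 : ∑ u ∈ (O \ B) \ settled indep O B J, marg f u B ≤
      (((O \ B) \ settled indep O B J).card : ℝ) * σ := by
    rw [← nsmul_eq_mul]
    refine Finset.sum_le_card_nsmul _ _ _ fun u hu => ?_
    rw [Finset.mem_sdiff, Finset.mem_sdiff, mem_settled] at hu
    refine hJ u ?_ ?_
    · by_contra h
      exact hu.2 ⟨hu.1.1, hu.1.2, Or.inl h⟩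
    · by_contra h
      exact hu.2 ⟨hu.1.1, hu.1.2, Or.inr h⟩
  have h4 : (((O \ B) \ settled indep O B J).card : ℝ) * σ ≤ O.card * σ :=
    mul_le_mul_of_nonneg_right (by
      exact_mod_cast Finset.card_le_card (Finset.sdiff_subset.trans Finset.sdiff_subset)) hσ
  unfold potential
  linarith

end Potential

/-! ### One iteration measured by the potential. -/

namespace Batch

variable {N : Type u} [DecidableEq N] {c : Batch N} {s : State N} {V : List N}
  {mode : SearchMode} {M : ℕ} {p : unitInterval}

theorem le_ex_getSEQ_of_forall (hc : c.Valid) (hs : c.Inv s) {x z : ℝ} {Y : List N → ℝ}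
    (h : ∀ V, c.IsMaxSeq s V → x ≤ Y V) :
    x ≤ (getSEQ c.indep (c.T ∪ s.A) s.L).ex c.f z Y := by
  rw [Comp.ex_eq_of_abortsAfter (fun t => abortsAfter_getSEQ t) z x]
  have := Comp.ex_mono (le_refl x) (safe_getSEQ_state hc hs 0) h
  rwa [Comp.ex_const] at this

/-- An iteration of `RandBatch` does not decrease the potential in expectation. -/
theorem potential_step (hc : c.Valid) (hs : c.Inv s) (hL : s.L.Nonempty) {O : Finset N}
    {k κ σ : ℝ} (hp : 0 < (p : ℝ)) (hσ : 0 ≤ σ) (hκ0 : 0 ≤ κ)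
    (hκ : p * κ * ((1 - c.ε) ^ 2 * c.ρ) = σ * (p * k + (1 - p)))
    (hT : ∀ u ∈ c.I, c.indep (insert u c.T) → marg c.f u c.T ≤ σ) (z : ℝ) :
    potential c.f c.indep O κ k σ (c.T ∪ s.A) (c.I \ s.U) ≤
      (getSEQ c.indep (c.T ∪ s.A) s.L).ex c.f z fun V =>
        p * potential c.f c.indep O κ k σ (c.T ∪ (c.accept s V).A) (c.I \ (c.accept s V).U) +
          (1 - p) *
            potential c.f c.indep O κ k σ (c.T ∪ (c.reject s V).A) (c.I \ (c.reject s V).U) := by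
  have hgain := le_ex_getSEQ_batch (ε := c.ε) hc.system (hs.regular hc hL) hc.eps_lt_one 0
    hs.indep fun u hu => (hs.large u hu).2
  have hbound : ∀ u ∈ c.I, u ∉ c.T ∪ s.A → c.indep (insert u (c.T ∪ s.A)) →
      marg c.f u (c.T ∪ s.A) ≤ σ := fun u hu huB hind =>
    (hc.submodular.marg_anti Finset.subset_union_left huB).trans (hT u hu (hc.system.subset _ _
      (Finset.insert_subset_insert _ Finset.subset_union_left) hind))
  set B := c.T ∪ s.A with hB
  set P := potential c.f c.indep O κ k σ B (c.I \ s.U) with hP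
  have hpt : ∀ V, c.IsMaxSeq s V →
      p * κ * (c.f (B ∪ (batchSeq c.indep c.ρ c.ε B s.L c.f V).toFinset) -
        (1 - c.ε) ^ 2 * c.ρ * (batchSeq c.indep c.ρ c.ε B s.L c.f V).length) +
          1 * (P - p * κ * c.f B) ≤
      p * potential c.f c.indep O κ k σ (c.T ∪ (c.accept s V).A) (c.I \ (c.accept s V).U) +
        (1 - p) *
          potential c.f c.indep O κ k σ (c.T ∪ (c.reject s V).A) (c.I \ (c.reject s V).U) := by
    intro V hV
    have hRL := batch_subset hV
    have hRB : Disjoint (c.batch s V) B := (hs.disjoint_base hc).mono_left hRL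
    have hRJ : c.batch s V ⊆ c.I \ s.U := fun u hu => Finset.mem_sdiff.2
      ⟨hs.L_subset (hRL hu), Finset.disjoint_left.1 hs.disjoint (hRL hu)⟩
    have h1 := potential_union (O := O) (κ := κ) (k := k) hc.submodular hc.system hσ hRJ hRB
      (fun u hu => (hs.large u (hRL hu)).2)
      fun u hu => hbound u (Finset.mem_sdiff.1 hu).1
    have h2 := potential_sdiff (indep := c.indep) (O := O) (J := c.I \ s.U) (κ := κ) (k := k)
      (σ := σ) (B := B) (R := c.batch s V)
      fun u hu => hc.rho_nonneg.trans (hs.large u (hRL hu)).1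
    have h3 : ∑ u ∈ c.batch s V, marg c.f u B ≤ (c.batch s V).card * σ := by
      rw [← nsmul_eq_mul]
      exact Finset.sum_le_card_nsmul _ _ _ fun u hu => hbound u (hs.L_subset (hRL hu))
        (Finset.disjoint_left.1 hRB hu) (hs.large u (hRL hu)).2
    have e1 : c.T ∪ (c.accept s V).A = B ∪ c.batch s V := (Finset.union_assoc _ _ _).symm
    have e2 : c.I \ (c.accept s V).U = (c.I \ s.U) \ c.batch s V :=
      (sdiff_sdiff_left (a := c.I) (b := s.U) (c := c.batch s V)).symm
    have e3 : c.T ∪ (c.reject s V).A = B := rfl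
    have e4 : c.I \ (c.reject s V).U = (c.I \ s.U) \ c.batch s V := e2
    rw [e1, e2, e3, e4, ← card_batch hV]
    change p * κ * (c.f (B ∪ c.batch s V) - _) + _ ≤ _
    have h4 := mul_le_mul_of_nonneg_left h1 p.2.1
    have h5 := mul_le_mul_of_nonneg_left (h2.trans' (sub_le_sub_left h3 _)) (sub_nonneg.2 p.2.2)
    have h6 : p * κ * ((1 - c.ε) ^ 2 * c.ρ * (c.batch s V).card) =
        σ * (p * k + (1 - p)) * (c.batch s V).card := by rw [← hκ]; ring
    rw [← hP] at h4 h5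
    linarith
  -- `GetSEQ` never aborts, so the abort value may be chosen freely; this choice has the shape
  -- required by `Comp.ex_linear`.
  rw [Comp.ex_eq_of_abortsAfter (fun t => abortsAfter_getSEQ t) z
    (p * κ * 0 + 1 * (P - p * κ * c.f B))]
  refine le_trans ?_ (Comp.ex_mono le_rfl (safe_getSEQ_state hc hs 0) hpt)
  rw [Comp.ex_linear, Comp.ex_const]
  have := mul_le_mul_of_nonneg_left hgain (mul_nonneg hp.le hκ0)
  linarith

/-- The state in which the while-loop of `RandBatch` starts. -/
def init (c : Batch N) : State N := ⟨∅, ∅, valuable c.indep c.f c.ρ c.T c.I, 0⟩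

theorem inv_init (hc : c.Valid) (hT : c.indep c.T) : c.Inv c.init := by
  have hsub : c.init.L ⊆ c.I := fun u hu => (mem_valuable.1 hu).1
  have hA : c.T ∪ c.init.A = c.T := Finset.union_empty _
  refine ⟨by rwa [hA], subset_rfl, Finset.empty_subset _, hsub, Finset.disjoint_empty_right _,
    ?_, ?_, ?_⟩
  · intro u hu
    rw [hA]
    exact (mem_valuable.1 hu).2
  · intro u hu _ hL hind
    rw [hA] at hind ⊢
    exact lt_of_not_ge fun h => hL (mem_valuable.2 ⟨hu, h, hind⟩)
  · refine ⟨c.T, c.T, hA.ge, hA.le, (hc.disjoint.mono_left hsub).symm, ?_⟩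
    simp [init]

theorem ex_randBatch (z : ℝ) (t : ℕ) (F : Finset N × Finset N × Finset N → ℝ) :
    (randBatch mode c.indep c.T c.ρ c.I M p c.ε t).ex c.f z F =
      (c.loop mode M p t c.init).ex c.f z F := by
  simp only [randBatch, Comp.ex, valuable_answers]
  rfl

end Batch

/-! ### The for-loop of `ParSSP` -/

section Outer

variable {N : Type u} [DecidableEq N]

/-- The standing assumptions on the objective, the constraint and the largest threshold. -/
structure Admissible (f : Finset N → ℝ) (indep : Finset N → Prop) (ε ρmax : ℝ) : Prop where
  submodular : Submodular f
  nonneg : ∀ X, 0 ≤ f X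
  system : IsIndependenceSystem indep
  eps_pos : 0 < ε
  eps_lt_one : ε < 1
  rho_nonneg : 0 ≤ ρmax
  singleton_le : ∀ u, f {u} ≤ ρmax

/-- The data of the call of `RandBatch` in the iteration with index `i`. -/
def stage (f : Finset N → ℝ) (indep : Finset N → Prop) (ε ρmax : ℝ) (i : ℕ) (T I : Finset N) :
    Batch N :=
  ⟨f, indep, ε, ρmax * (1 - ε) ^ i, T, I⟩

/-- The invariant of the for-loop. -/
structure StageInv (f : Finset N → ℝ) (indep : Finset N → Prop) (ε ρmax : ℝ) (i : ℕ)
    (T I : Finset N) : Prop where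
  feasible : indep T
  disjoint : Disjoint I T
  small : ∀ u ∈ I, indep (insert u T) → marg f u T ≤ ρmax * (1 - ε) ^ i / (1 - ε)

variable {f : Finset N → ℝ} {indep : Finset N → Prop} {ε ρmax : ℝ} {i : ℕ} {T I : Finset N}
  {mode : SearchMode} {M : ℕ} {p : unitInterval}

theorem Admissible.valid_stage (h : Admissible f indep ε ρmax) (hd : Disjoint I T) :
    (stage f indep ε ρmax i T I).Valid := by
  have h1 : 0 < 1 - ε := by linarith [h.eps_lt_one]
  refine ⟨h.submodular, h.nonneg, h.system, h.eps_pos, h.eps_lt_one,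
    mul_nonneg h.rho_nonneg (pow_nonneg h1.le _), fun h0 u => ?_, hd⟩
  have h2 : ρmax = 0 := (mul_eq_zero.1 h0).resolve_right (pow_pos h1 _).ne'
  exact le_antisymm (h2 ▸ h.singleton_le u) (h.nonneg _)

theorem Admissible.stageInv_zero [Fintype N] (h : Admissible f indep ε ρmax) :
    StageInv f indep ε ρmax 0 ∅ Finset.univ := by
  refine ⟨h.system.empty, Finset.disjoint_empty_right _, fun u _ _ => ?_⟩
  have h1 : 0 < 1 - ε := by linarith [h.eps_lt_one]
  have h2 : marg f u ∅ = f {u} - f ∅ := rfl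
  have h3 := h.nonneg ∅
  have h4 := h.singleton_le u
  have h5 := h.eps_pos
  have h6 := h.rho_nonneg
  rw [pow_zero, mul_one, le_div_iff₀ h1]
  nlinarith

/-- What remains in `I` and fits has failed the threshold of this phase, which is the next threshold
divided by `1 - ε`. -/
theorem Admissible.stageInv_succ (h : Admissible f indep ε ρmax)
    (hd : Disjoint I T) {A U L : Finset N} {n : ℕ}
    (hs : (stage f indep ε ρmax i T I).Inv ⟨A, U, L, n⟩) :
    StageInv f indep ε ρmax (i + 1) (T ∪ A) (I \ (U ∪ L)) := by
  have h1 : 0 < 1 - ε := by linarith [h.eps_lt_one]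
  refine ⟨hs.indep, ?_, fun u hu hind => ?_⟩
  · rw [Finset.disjoint_union_right]
    refine ⟨hd.mono_left Finset.sdiff_subset, Finset.disjoint_left.2 fun u hu hA => ?_⟩
    exact (Finset.mem_sdiff.1 hu).2 (Finset.mem_union_left _ (hs.A_subset hA))
  · rw [Finset.mem_sdiff, Finset.mem_union, not_or] at hu
    have := (hs.small u hu.1 hu.2.1 hu.2.2 hind).le
    rw [pow_succ, ← mul_assoc, mul_div_assoc, div_self h1.ne', mul_one]
    exact this

theorem ex_parSSPLoop_succ (t m : ℕ) (z : ℝ) (F : Finset N → ℝ) :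
    (parSSPLoop mode indep ρmax M p ε t (m + 1) i T I).ex f z F =
      ((stage f indep ε ρmax i T I).loop mode M p t (stage f indep ε ρmax i T I).init).ex f z
        fun r => (parSSPLoop mode indep ρmax M p ε t m (i + 1) (T ∪ r.1)
          (I \ (r.2.1 ∪ r.2.2))).ex f z F := by
  rw [parSSPLoop, Comp.ex_bind]
  exact Batch.ex_randBatch (c := stage f indep ε ρmax i T I) z t _

theorem safe_randBatch [Fintype N] [Nonempty N] (h : Admissible f indep ε ρmax) (t : ℕ)
    (hs : StageInv f indep ε ρmax i T I) :
    (randBatch mode indep T (ρmax * (1 - ε) ^ i) I M p ε t).Safe f ((Fintype.card N + 1) ^ 2)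
      fun r => ∃ n, (stage f indep ε ρmax i T I).Inv ⟨r.1, r.2.1, r.2.2, n⟩ ∧
        ¬ (r.2.2.Nonempty ∧ n < M) := by
  have hv := h.valid_stage (i := i) hs.disjoint
  refine ⟨?_, ?_⟩
  · have h1 := card_margQueries_le T I
    have h2 := Finset.card_le_univ I
    nlinarith
  · have h1 := Batch.safe_loop (mode := mode) (M := M) (p := p) hv t _
      (Batch.inv_init hv hs.feasible)
    simp only [valuable_answers]
    exact h1

theorem safe_parSSPLoop [Fintype N] [Nonempty N] (h : Admissible f indep ε ρmax) (t : ℕ) :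
    ∀ (m i : ℕ) (T I : Finset N), StageInv f indep ε ρmax i T I →
      (parSSPLoop mode indep ρmax M p ε t m i T I).Safe f ((Fintype.card N + 1) ^ 2) indep := by
  intro m
  induction m with
  | zero => exact fun i T I hs => hs.feasible
  | succ m ih =>
    intro i T I hs
    rw [parSSPLoop]
    refine (safe_randBatch h t hs).bind fun r hr => ?_
    obtain ⟨n, hn, -⟩ := hr
    exact ih _ _ _ (h.stageInv_succ hs.disjoint hn)

theorem abortsAfter_parSSPLoop (t : ℕ) : ∀ (m i : ℕ) (T I : Finset N),
    (parSSPLoop mode indep ρmax M p ε t m i T I).AbortsAfter f t := by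
  intro m
  induction m with
  | zero => exact fun i T I => trivial
  | succ m ih =>
    intro i T I
    rw [parSSPLoop]
    refine Comp.AbortsAfter.bind ?_ fun r => ih _ _ _
    rw [randBatch, Comp.AbortsAfter]
    exact Comp.AbortsAfter.mono (Nat.sub_le t 1) (Batch.abortsAfter_loop
      (c := stage f indep ε ρmax i T I) f t ⟨∅, ∅, _, 0⟩)

theorem ex_parSSPLoop_mono {F : Finset N → ℝ} (hF : ∀ S, 0 ≤ F S) (t : ℕ) :
    ∀ (m i : ℕ) (T I : Finset N),
      (parSSPLoop mode indep ρmax M p ε t m i T I).ex f 0 F ≤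
        (parSSPLoop mode indep ρmax M p ε (t + 1) m i T I).ex f 0 F := by
  intro m
  induction m with
  | zero => exact fun i T I => le_rfl
  | succ m ih =>
    intro i T I
    rw [ex_parSSPLoop_succ, ex_parSSPLoop_succ]
    exact (Batch.ex_loop_mono f (fun r => Comp.ex_nonneg _ hF) t _).trans
      (Comp.ex_mono' le_rfl _ fun r => ih _ _ _)

theorem progress_init_le [Fintype N] (h : Admissible f indep ε ρmax) (hd : Disjoint I T) :
    (stage f indep ε ρmax i T I).progress M (stage f indep ε ρmax i T I).init ≤
      M + (Real.log (Fintype.card N) / (-Real.log (1 - ε)) + 1) := by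
  have hl := Batch.neg_log_pos h.eps_pos h.eps_lt_one
  have h1 := Batch.progress_L_mono (h.valid_stage (i := i) hd) (M := M) (A := ∅) (A' := ∅)
    (U := ∅) (U' := ∅) (n := 0)
    (Finset.subset_univ (stage f indep ε ρmax i T I).init.L)
  refine h1.trans ?_
  have h0 : 0 ≤ Real.log (Fintype.card N) / (-Real.log (1 - ε)) :=
    div_nonneg (Real.log_natCast_nonneg _) hl.le
  unfold Batch.progress
  simp only [Nat.cast_zero, sub_zero, Finset.card_univ]
  refine add_le_add le_rfl ?_
  split_ifs
  · exact le_rfl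
  · linarith

theorem cst_parSSPLoop_le [Fintype N] [Nonempty N] (h : Admissible f indep ε ρmax)
    (hp : 0 < (p : ℝ)) {w : ℕ → ℝ} (hw : Monotone w) (hw0 : ∀ q, 0 ≤ w q) {b : ℝ} (hb0 : 0 ≤ b)
    (hb : ∀ ρ B L V, IsSeq indep B L V →
      (search mode indep ρ ε B V L).cst f w + w (L.card + 1) ≤ b) (t : ℕ) :
    ∀ (m i : ℕ) (T I : Finset N), StageInv f indep ε ρmax i T I →
      (parSSPLoop mode indep ρmax M p ε t m i T I).cst f w ≤
        m * (w (Fintype.card N + 1) +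
          b / p * (M + (Real.log (Fintype.card N) / (-Real.log (1 - ε)) + 1))) := by
  intro m
  induction m with
  | zero => intro i T I _; simp [parSSPLoop, Comp.cst]
  | succ m ih =>
    intro i T I hs
    have hv := h.valid_stage (i := i) hs.disjoint
    rw [parSSPLoop, Comp.cst_bind]
    have h1 : (randBatch mode indep T (ρmax * (1 - ε) ^ i) I M p ε t).cst f w ≤
        w (Fintype.card N + 1) +
          b / p * (M + (Real.log (Fintype.card N) / (-Real.log (1 - ε)) + 1)) := by
      rw [randBatch, Comp.cst]
      refine add_le_add (hw ((card_margQueries_le _ _).trans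
        (Nat.succ_le_succ (Finset.card_le_univ _)))) ?_
      rw [valuable_answers]
      refine (Batch.cst_loop_le hv hp hw hb0 (fun s V _ _ hV => hb _ _ _ _ hV.1) t _
        (Batch.inv_init hv hs.feasible) (Nat.zero_le _)).trans ?_
      exact mul_le_mul_of_nonneg_left (progress_init_le h hs.disjoint) (by positivity)
    have hsafe := safe_randBatch (mode := mode) (M := M) (p := p) h t hs
    set K := w (Fintype.card N + 1) +
      b / p * (M + (Real.log (Fintype.card N) / (-Real.log (1 - ε)) + 1)) with hK
    have hl := Batch.neg_log_pos h.eps_pos h.eps_lt_one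
    have hmK : 0 ≤ (m : ℝ) * K := by
      have h3 : 0 ≤ Real.log (Fintype.card N) := Real.log_natCast_nonneg _
      have h4 := hw0 (Fintype.card N + 1)
      positivity
    have h2 := Comp.ex_mono hmK hsafe (h := fun r => (parSSPLoop mode indep ρmax M p ε t m (i + 1)
      (T ∪ r.1) (I \ (r.2.1 ∪ r.2.2))).cst f w) (h' := fun _ => m * K) fun r hr => by
        obtain ⟨n, hn, -⟩ := hr
        exact ih _ _ _ (h.stageInv_succ hs.disjoint hn)
    rw [Comp.ex_const] at h2
    push_cast
    linarith

/-- The potential does not decrease in expectation, up to the value of discarded elements. -/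
theorem le_ex_parSSPLoop [Fintype N] [Nonempty N] (h : Admissible f indep ε ρmax) {k : ℕ}
    {O : Finset N} (hk : IsKSystem k indep) (hO : IsOptimal indep f O) (hp : 0 < (p : ℝ))
    (hM : 0 < M) {κ : ℝ} (hκ0 : 0 ≤ κ) (hκ : p * κ * (1 - ε) ^ 3 = p * k + (1 - p)) (t : ℕ) :
    ∀ (m i : ℕ) (T I : Finset N), StageInv f indep ε ρmax i T I →
      potential f indep O κ k (ρmax * (1 - ε) ^ i / (1 - ε)) T I - m * (f O / (M * ε)) -
          O.card * (ρmax * (1 - ε) ^ (i + m) / (1 - ε)) ≤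
        (parSSPLoop mode indep ρmax M p ε t m i T I).ex f ((κ + O.card) * f O)
          fun S => κ * f S - ∑ u ∈ O \ S, marg f u S := by
  have h1 : 0 < 1 - ε := by linarith [h.eps_lt_one]
  have hε := h.eps_pos
  have hσ : ∀ i, 0 ≤ ρmax * (1 - ε) ^ i / (1 - ε) := fun i =>
    div_nonneg (mul_nonneg h.rho_nonneg (pow_nonneg h1.le _)) h1.le
  have hMε : 0 < (M : ℝ) * ε := mul_pos (by exact_mod_cast hM) hε
  have hδ : 0 ≤ f O / (M * ε) := div_nonneg (h.nonneg _) hMε.le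
  intro m
  induction m with
  | zero =>
    intro i T I hs
    have := potential_le_final (κ := κ) hk hO.1 hs.feasible (hσ i) hs.small
    simpa [parSSPLoop, Comp.ex] using this
  | succ m ih =>
    intro i T I hs
    have hv := h.valid_stage (i := i) hs.disjoint
    have hinit := Batch.inv_init hv hs.feasible
    have hlast := hσ (i + 1 + m)
    have hadd : i + (m + 1) = i + 1 + m := by omega
    rw [ex_parSSPLoop_succ, hadd]
    set last := (O.card : ℝ) * (ρmax * (1 - ε) ^ (i + 1 + m) / (1 - ε)) with hlast'
    have hlast0 : 0 ≤ last := mul_nonneg (Nat.cast_nonneg _) hlast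
    have hmδ : 0 ≤ (m : ℝ) * (f O / (M * ε)) := mul_nonneg (Nat.cast_nonneg _) hδ
    refine le_trans ?_ (Comp.ex_mono le_rfl (Batch.safe_loop hv t _ hinit)
      (h := fun r => potential f indep O κ k (ρmax * (1 - ε) ^ (i + 1) / (1 - ε)) (T ∪ r.1)
        (I \ (r.2.1 ∪ r.2.2)) - m * (f O / (M * ε)) - last)
      fun r hr => by
        obtain ⟨n, hn, -⟩ := hr
        exact ih _ _ _ (h.stageInv_succ hs.disjoint hn))
    have key := Batch.le_ex_loop (mode := mode) (M := M) (p := p) hv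
      (Ψ := fun s => potential f indep O κ k (ρmax * (1 - ε) ^ i / (1 - ε)) (T ∪ s.A) (I \ s.U) -
        ((m + 1 : ℕ) * (f O / (M * ε)) + last))
      (F := fun r => potential f indep O κ k (ρmax * (1 - ε) ^ (i + 1) / (1 - ε)) (T ∪ r.1)
        (I \ (r.2.1 ∪ r.2.2)) - m * (f O / (M * ε)) - last)
      (z := (κ + O.card) * f O) ?_ ?_ ?_ t _ hinit
    · refine le_trans (le_of_eq ?_) key
      simp only [Batch.init, Finset.union_empty, Finset.sdiff_empty]
      ring
    · intro s hs'
      have := potential_le (J := I \ s.U) hk hO h.nonneg hs'.indep (hσ i) hκ0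
      push_cast
      change potential f indep O κ k (ρmax * (1 - ε) ^ i / (1 - ε)) (T ∪ s.A) (I \ s.U) - _ ≤ _
      have e : potential f indep O κ k (ρmax * (1 - ε) ^ i / (1 - ε)) (T ∪ s.A) (I \ s.U) ≤
        (κ + O.card) * f O := this
      linarith
    -- End of a phase: the leftover `L` is discarded at a cost of at most `f O / (M ε)`, and `σ` is
    -- lowered to its next value.
    · intro s hs' hend
      have h2 : (∑ u ∈ s.L, marg f u (T ∪ s.A)) ≤ f O / (M * ε) := by
        rcases s.L.eq_empty_or_nonempty with hL | hL
        · simpa [hL] using hδ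
        · have hcount : M ≤ s.count := by
            by_contra hlt
            exact hend ⟨hL, not_le.1 hlt⟩
          have h3 : M * (ε * ∑ u ∈ s.L, marg f u (T ∪ s.A)) ≤ f O := hs'.leftover_le hv hO hcount
          rw [le_div_iff₀ hMε]
          linarith
      have h3 : potential f indep O κ k (ρmax * (1 - ε) ^ i / (1 - ε)) (T ∪ s.A) (I \ s.U) -
          ∑ u ∈ s.L, marg f u (T ∪ s.A) ≤
          potential f indep O κ k (ρmax * (1 - ε) ^ i / (1 - ε)) (T ∪ s.A) ((I \ s.U) \ s.L) :=
        potential_sdiff fun u hu => hv.rho_nonneg.trans (hs'.large u hu).1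
      have h4 : potential f indep O κ k (ρmax * (1 - ε) ^ i / (1 - ε)) (T ∪ s.A)
            ((I \ s.U) \ s.L) ≤
          potential f indep O κ k (ρmax * (1 - ε) ^ (i + 1) / (1 - ε)) (T ∪ s.A)
            ((I \ s.U) \ s.L) := by
        refine potential_anti hk hO.1 hs'.indep ?_
        refine div_le_div_of_nonneg_right (mul_le_mul_of_nonneg_left ?_ h.rho_nonneg) h1.le
        exact pow_le_pow_of_le_one h1.le (by linarith) (Nat.le_succ i)
      have e : I \ (s.U ∪ s.L) = (I \ s.U) \ s.L :=
        (sdiff_sdiff_left (a := I) (b := s.U) (c := s.L)).symm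
      simp only [e]
      push_cast
      linarith
    · intro s hs' hL
      have hstep := Batch.potential_step (O := O) (k := k) (κ := κ) hv hs' hL hp (hσ i) hκ0 ?_
        hs.small ((κ + O.card) * f O)
      · have h5 := (getSEQ indep (T ∪ s.A) s.L).ex_add (f := f) (fun V =>
          p * potential f indep O κ k (ρmax * (1 - ε) ^ i / (1 - ε))
            (T ∪ ((stage f indep ε ρmax i T I).accept s V).A)
            (I \ ((stage f indep ε ρmax i T I).accept s V).U) +
          (1 - p) * potential f indep O κ k (ρmax * (1 - ε) ^ i / (1 - ε))
            (T ∪ ((stage f indep ε ρmax i T I).reject s V).A)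
            (I \ ((stage f indep ε ρmax i T I).reject s V).U))
          (fun _ => -((m + 1 : ℕ) * (f O / (M * ε)) + last)) ((κ + O.card) * f O)
          (-((m + 1 : ℕ) * (f O / (M * ε)) + last))
        rw [Comp.ex_const, Comp.ex_eq_of_abortsAfter (fun t => abortsAfter_getSEQ t)
          _ ((κ + O.card) * f O)] at h5
        refine (sub_le_sub_right hstep _).trans (le_of_eq ?_)
        refine (sub_eq_add_neg _ _).trans (h5.symm.trans ?_)
        congr 1
        funext V
        ring
      -- The balance between accepting and rejecting. Two factors `1 - ε` come from the expected
      -- gain and the third from `σ = ρ/(1 - ε)`.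
      · change p * κ * ((1 - ε) ^ 2 * (ρmax * (1 - ε) ^ i)) = _
        rw [← hκ]
        field_simp

/-- Every element is in the solution with probability at most `p`. -/
theorem ex_parSSPLoop_mem_le [Fintype N] [Nonempty N] (h : Admissible f indep ε ρmax) (u : N)
    (t : ℕ) : ∀ (m i : ℕ) (T I : Finset N), StageInv f indep ε ρmax i T I →
      -(if u ∈ T then (1 : ℝ) else if u ∈ I then p else 0) ≤
        (parSSPLoop mode indep ρmax M p ε t m i T I).ex f 0
          fun S => -(if u ∈ S then (1 : ℝ) else 0) := by
  have hp0 := p.2.1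
  have hp1 := p.2.2
  intro m
  induction m with
  | zero =>
    intro i T I _
    simp only [parSSPLoop, Comp.ex]
    split_ifs <;> linarith
  | succ m ih =>
    intro i T I hs
    have hv := h.valid_stage (i := i) hs.disjoint
    have hinit := Batch.inv_init hv hs.feasible
    rw [ex_parSSPLoop_succ]
    refine le_trans ?_ (Comp.ex_mono le_rfl (Batch.safe_loop hv t _ hinit)
      (h := fun r => -(if u ∈ T ∪ r.1 then (1 : ℝ) else if u ∈ I \ (r.2.1 ∪ r.2.2) then p else 0))
      fun r hr => by
        obtain ⟨n, hn, -⟩ := hr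
        exact ih _ _ _ (h.stageInv_succ hs.disjoint hn))
    -- The conditional probability of ending up in the solution is bounded by `1` for chosen
    -- elements, `p` for those not yet considered and `0` for all others. The sign is reversed to
    -- use the rule for lower bounds.
    have key := Batch.le_ex_loop (mode := mode) (M := M) (p := p) hv
      (Ψ := fun s => -(if u ∈ T ∪ s.A then (1 : ℝ) else if u ∈ I \ s.U then p else 0))
      (F := fun r => -(if u ∈ T ∪ r.1 then (1 : ℝ) else if u ∈ I \ (r.2.1 ∪ r.2.2) then p else 0))
      (z := 0) ?_ ?_ ?_ t _ hinit
    · simpa only [Batch.init, Finset.union_empty, Finset.sdiff_empty] using key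
    · intro s _
      split_ifs <;> linarith
    · intro s _ _
      by_cases h1 : u ∈ T ∪ s.A
      · simp only [h1, if_true, le_refl]
      · by_cases h2 : u ∈ I \ (s.U ∪ s.L)
        · have h3 : u ∈ I \ s.U := Finset.sdiff_subset_sdiff subset_rfl
            Finset.subset_union_left h2
          simp only [h1, if_false, h2, h3, if_true, le_refl]
        · simp only [h1, if_false, h2]
          split_ifs <;> linarith
    · intro s hs' _
      refine Batch.le_ex_getSEQ_of_forall hv hs' fun V hV => ?_
      set R := (stage f indep ε ρmax i T I).batch s V with hR
      have e1 : ((stage f indep ε ρmax i T I).accept s V).A = s.A ∪ R := rfl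
      have e2 : ((stage f indep ε ρmax i T I).accept s V).U = s.U ∪ R := rfl
      have e3 : ((stage f indep ε ρmax i T I).reject s V).A = s.A := rfl
      have e4 : ((stage f indep ε ρmax i T I).reject s V).U = s.U ∪ R := rfl
      rw [e1, e2, e3, e4]
      have hRL : R ⊆ s.L := Batch.batch_subset hV
      by_cases h1 : u ∈ T ∪ s.A
      · have h2 : u ∈ T ∪ (s.A ∪ R) := by
          rw [← Finset.union_assoc]
          exact Finset.mem_union_left _ h1
        simp only [h1, h2, if_true]
        linarith
      · by_cases h2 : u ∈ R
        · have h3 : u ∈ T ∪ (s.A ∪ R) := by simp [h2]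
          have h4 : u ∈ I \ s.U := Finset.mem_sdiff.2
            ⟨hs'.L_subset (hRL h2), Finset.disjoint_left.1 hs'.disjoint (hRL h2)⟩
          have h5 : u ∉ I \ (s.U ∪ R) := by simp [h2]
          simp only [h1, h3, h4, h5, if_true, if_false]
          linarith
        · have h3 : u ∉ T ∪ (s.A ∪ R) := by
            rw [← Finset.union_assoc, Finset.mem_union, not_or]
            exact ⟨h1, h2⟩
          have h4 : u ∈ I \ (s.U ∪ R) ↔ u ∈ I \ s.U := by
            simp [h2]
          simp only [h1, h3, h4, if_false]
          linarith

end Outer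

/-! ### Random sampling -/

/-- If a random set contains every element with probability at most `q`, its expected value under a
nonnegative submodular function is at least `1 - q` times the value of the empty set. -/
theorem Submodular.sampling {N : Type u} [Fintype N] [DecidableEq N] {g : Finset N → ℝ}
    (hg : Submodular g) (hg0 : ∀ X, 0 ≤ g X) {μ : Finset N → ℝ} (hμ : ∀ S, 0 ≤ μ S) {q : ℝ}
    (hq : 0 ≤ q) (hμq : ∀ u, ∑ S, μ S * (if u ∈ S then 1 else 0) ≤ q) :
    (∑ S, μ S - q) * g ∅ ≤ ∑ S, μ S * g S := by
  set P : N → ℝ := fun u => ∑ S, μ S * (if u ∈ S then 1 else 0) with hP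
  have hP0 : ∀ u, 0 ≤ P u := fun u => Finset.sum_nonneg fun S _ =>
    mul_nonneg (hμ S) (by split_ifs <;> norm_num)
  -- Elements are inserted in order of decreasing probability. The new element contributes `P a`
  -- times its marginal at `s`, which turns `P a * g s` into `P a * g (insert a s)`; nonnegativity
  -- then permits lowering the coefficient to any `x ≤ P a`.
  have key : ∀ s : Finset N, ∀ x ≤ q, (∀ u ∈ s, x ≤ P u) →
      (∑ S, μ S - q) * g ∅ + x * g s ≤ ∑ S, μ S * g (S ∩ s) := by
    intro s
    induction s using Finset.induction_on_min_value P with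
    | empty =>
      intro x hx _
      simp only [Finset.inter_empty, ← Finset.sum_mul]
      have := mul_le_mul_of_nonneg_right hx (hg0 ∅)
      linarith
    | insert a s ha hmin ih =>
      intro x hx hxP
      have h1 := ih (P a) (hμq a) hmin
      have h2 : ∀ S, μ S * g (S ∩ s) + μ S * (if a ∈ S then 1 else 0) * (g (insert a s) - g s) ≤
          μ S * g (S ∩ insert a s) := by
        intro S
        by_cases haS : a ∈ S
        · rw [if_pos haS, Finset.inter_insert_of_mem haS, mul_one, ← mul_add]
          refine mul_le_mul_of_nonneg_left ?_ (hμ S)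
          have := hg.marg_anti (Finset.inter_subset_right (s₁ := S) (s₂ := s)) ha
          unfold marg at this
          linarith
        · rw [if_neg haS, Finset.inter_insert_of_notMem haS]
          simp
      have h3 := Finset.sum_le_sum fun S (_ : S ∈ Finset.univ) => h2 S
      rw [Finset.sum_add_distrib, ← Finset.sum_mul] at h3
      have h4 := mul_le_mul_of_nonneg_right (hxP a (Finset.mem_insert_self _ _))
        (hg0 (insert a s))
      change _ + P a * _ ≤ _ at h3
      linarith
  have := key Finset.univ 0 hq fun u _ => hP0 u
  simpa using this

/-! ### Output probabilities -/

section Output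

variable {N : Type u} [DecidableEq N] {f : Finset N → ℝ}

theorem Comp.ex_eq_sum {α : Type v} [Fintype α] [DecidableEq α] (c : Comp N α) (h : α → ℝ) :
    c.ex f 0 h = ∑ a, c.ex f 0 (fun b => if b = a then 1 else 0) * h a := by
  have h1 : ∀ a, c.ex f 0 (fun b => if b = a then 1 else 0) * h a =
      c.ex f 0 (fun b => h a * if b = a then 1 else 0) := by
    intro a
    have := Comp.ex_mul (f := f) c (fun b => if b = a then 1 else 0) 0 (h a)
    rw [mul_zero] at this
    rw [this, mul_comm]
  simp only [h1]
  rw [← Comp.ex_finset_sum]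
  congr 1
  funext b
  simp

theorem outputProb_eq {α : Type v} [DecidableEq α] (prog : ℕ → Comp N α) (a : α) :
    outputProb f prog a =
      ⨆ t, ENNReal.ofReal ((prog t).ex f 0 fun b => if b = a then 1 else 0) := by
  refine iSup_congr fun t => ?_
  rw [← Comp.tsum_run_result (prog t) _ (fun b => by split_ifs <;> norm_num), ENNReal.tsum_prod',
    tsum_eq_single (some a)]
  · refine tsum_congr fun x => ?_
    simp
  · intro o ho
    rw [ENNReal.tsum_eq_zero]
    intro x
    cases o with
    | none => simp
    | some b =>
      have : b ≠ a := fun h => ho (by rw [h])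
      simp [this]

theorem ex_indicator_le_one {α : Type v} [DecidableEq α] (c : Comp N α) (a : α) :
    (c.ex f 0 fun b => if b = a then 1 else 0) ≤ 1 := by
  have h := Comp.ex_mono' (f := f) (zero_le_one (α := ℝ)) c
    (h := fun b => if b = a then (1 : ℝ) else 0) (h' := fun _ => 1)
    fun b => by split_ifs <;> norm_num
  rwa [Comp.ex_const] at h

theorem le_outputProb_toReal {α : Type v} [DecidableEq α] (prog : ℕ → Comp N α) (a : α) (t : ℕ) :
    ((prog t).ex f 0 fun b => if b = a then 1 else 0) ≤ (outputProb f prog a).toReal := by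
  have h1 : outputProb f prog a ≤ 1 := by
    rw [outputProb_eq]
    exact iSup_le fun t => ENNReal.ofReal_le_one.2 (ex_indicator_le_one _ _)
  have h2 : ENNReal.ofReal ((prog t).ex f 0 fun b => if b = a then 1 else 0) ≤
      outputProb f prog a := by
    rw [outputProb_eq]
    exact le_iSup (fun t => ENNReal.ofReal ((prog t).ex f 0 fun b => if b = a then 1 else 0)) t
  exact (ENNReal.ofReal_le_iff_le_toReal (ne_top_of_le_ne_top ENNReal.one_ne_top h1)).1 h2

theorem ex_le_sum_outputProb {α : Type v} [Fintype α] (prog : ℕ → Comp N α)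
    {h : α → ℝ} (hh : ∀ a, 0 ≤ h a) (t : ℕ) :
    (prog t).ex f 0 h ≤ ∑ a, (outputProb f prog a).toReal * h a := by
  classical
  rw [Comp.ex_eq_sum]
  exact Finset.sum_le_sum fun a _ =>
    mul_le_mul_of_nonneg_right (le_outputProb_toReal prog a t) (hh a)

theorem abort_le {α : Type v} {prog : ℕ → Comp N α} (ha : ∀ t, (prog t).AbortsAfter f t) {E : ℝ}
    (hE : ∀ t, ((prog t).cst f fun _ => 1) ≤ E) (t : ℕ) :
    ((prog (t + 1)).ex f 1 fun _ => 0) ≤ E * (1 / ((t : ℝ) + 1)) := by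
  have h1 := (ha (t + 1)).mul_ex_le.trans (hE (t + 1))
  rw [mul_one_div, le_div_iff₀ (by positivity)]
  push_cast at h1
  linarith

/-- A computation with a bounded expected number of rounds terminates almost surely. -/
theorem sum_outputProb_eq_one {α : Type v} [Fintype α] {prog : ℕ → Comp N α}
    (ha : ∀ t, (prog t).AbortsAfter f t) {E : ℝ} (hE : ∀ t, ((prog t).cst f fun _ => 1) ≤ E)
    (hmono : ∀ h : α → ℝ, (∀ a, 0 ≤ h a) → ∀ t, (prog t).ex f 0 h ≤ (prog (t + 1)).ex f 0 h) :
    ∑ a, outputProb f prog a = 1 := by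
  classical
  have h01 : ∀ a b : α, (0 : ℝ) ≤ if b = a then 1 else 0 := fun a b => by
    split_ifs <;> norm_num
  simp only [outputProb_eq]
  -- Sum and limit are interchanged, and the total output probability of a truncated program is one
  -- minus its abort probability, which tends to `0`.
  rw [ENNReal.finsetSum_iSup_of_monotone fun a => monotone_nat_of_le_succ fun t =>
    ENNReal.ofReal_le_ofReal (hmono _ (h01 a) t)]
  have h1 : ∀ t, ∑ a, ENNReal.ofReal ((prog t).ex f 0 fun b => if b = a then 1 else 0) =
      ENNReal.ofReal (1 - (prog t).ex f 1 fun _ => 0) := by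
    intro t
    rw [← ENNReal.ofReal_sum_of_nonneg fun a _ => Comp.ex_nonneg _ (h01 a)]
    congr 1
    have h2 := Comp.ex_eq_sum (f := f) (prog t) fun _ => 1
    have h3 := Comp.ex_one_add_abort (f := f) (prog t)
    simp only [mul_one] at h2
    linarith
  simp only [h1]
  refine le_antisymm (iSup_le fun t => ?_) ?_
  · have := Comp.ex_abort_nonneg (f := f) (prog t)
    exact ENNReal.ofReal_le_one.2 (by linarith)
  · have h2 : Filter.Tendsto (fun t : ℕ => ENNReal.ofReal (1 - E * (1 / ((t : ℝ) + 1))))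
        Filter.atTop (nhds 1) := by
      have h3 := (tendsto_one_div_add_atTop_nhds_zero_nat (𝕜 := ℝ)).const_mul E
      have h4 := ENNReal.tendsto_ofReal (h3.const_sub 1)
      simpa using h4
    refine le_of_tendsto' h2 fun t => ?_
    refine le_trans (ENNReal.ofReal_le_ofReal ?_)
      (le_iSup (fun t => ENNReal.ofReal (1 - (prog t).ex f 1 fun _ => 0)) (t + 1))
    have := abort_le ha hE t
    linarith

theorem property_of_outputProb_ne_zero {α : Type v} {prog : ℕ → Comp N α} {b : ℕ} {P : α → Prop}
    (hs : ∀ t, (prog t).Safe f b P) {a : α} (ha : outputProb f prog a ≠ 0) : P a := by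
  unfold outputProb at ha
  rw [Ne, ENNReal.iSup_eq_zero, not_forall] at ha
  obtain ⟨t, ht⟩ := ha
  rw [ENNReal.tsum_eq_zero, not_forall] at ht
  obtain ⟨x, hx⟩ := ht
  exact ((hs t).of_mem_support (some a, x) ((PMF.mem_support_iff _ _).2 hx)).2 a rfl

theorem expectedCost_rounds_le {α : Type v} {prog : ℕ → Comp N α} {E : ℝ}
    (h : ∀ t, ((prog t).cst f fun _ => 1) ≤ E) :
    expectedCost f prog Cost.rounds ≤ ENNReal.ofReal E := by
  refine iSup_le fun t => ?_
  rw [Comp.tsum_run_cost Cost.rounds (fun _ => 1) rfl fun q x => Nat.add_comm _ _]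
  exact ENNReal.ofReal_le_ofReal (by simpa using h t)

theorem expectedCost_queries_le {α : Type v} {prog : ℕ → Comp N α} {E : ℝ}
    (h : ∀ t, ((prog t).cst f fun q => (q : ℝ)) ≤ E) :
    expectedCost f prog Cost.queries ≤ ENNReal.ofReal E := by
  refine iSup_le fun t => ?_
  rw [Comp.tsum_run_cost Cost.queries (fun q => q) rfl fun q x => Nat.add_comm _ _]
  exact ENNReal.ofReal_le_ofReal (h t)

end Output

/-! ### The algorithm `ParSSP` -/

section Main

variable {N : Type u} [Fintype N] [DecidableEq N] [Nonempty N] {f : Finset N → ℝ}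
  {indep : Finset N → Prop} {ε : ℝ} {k : ℕ} {O : Finset N} {p : unitInterval} {mode : SearchMode}

/-- The element `u*` found by the algorithm with an oracle for `f`. -/
def ustar (f : Finset N → ℝ) : N :=
  bestElement (answers f (Finset.univ.image fun u : N => {u}))

theorem answers_singleton {N : Type u} [Fintype N] [DecidableEq N] {f : Finset N → ℝ} (u : N) :
    answers f (Finset.univ.image fun u : N => {u}) {u} = f {u} :=
  answers_of_mem (Finset.mem_image_of_mem _ (Finset.mem_univ u))

theorem singleton_le_ustar (u : N) : f {u} ≤ f {ustar f} := by
  have h := (Finite.exists_max fun u : N =>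
    answers f (Finset.univ.image fun u : N => {u}) {u}).choose_spec u
  change answers f _ {u} ≤ answers f _ {ustar f} at h
  rwa [answers_singleton, answers_singleton] at h

/-- The for-loop as it is called by `ParSSP`. -/
def mainLoop (mode : SearchMode) (indep : Finset N → Prop) (f : Finset N → ℝ) (p : unitInterval)
    (ε : ℝ) (t : ℕ) : Comp N (Finset N) :=
  parSSPLoop mode indep (f {ustar f}) (paramM (rank indep) ε) p ε t (paramL (rank indep) ε) 0 ∅
    Finset.univ

open Classical in
/-- The better of `T` and `{u*}`. -/
def better (f : Finset N → ℝ) (T : Finset N) : Finset N :=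
  if f {ustar f} ≤ f T then T else {ustar f}

theorem ex_parSSP (z : ℝ) (h : Finset N → ℝ) (t : ℕ) :
    (parSSP mode indep p ε t).ex f z h =
      (mainLoop mode indep f p ε t).ex f z fun T => h (better f T) := by
  simp only [parSSP, Comp.ex, Comp.ex_bind]
  rw [answers_singleton]
  have h1 : ∀ T : Finset N, answers f {T, {ustar f}} {ustar f} = f {ustar f} :=
    fun T => answers_of_mem (by simp)
  have h2 : ∀ T : Finset N, answers f {T, {ustar f}} T = f T := fun T => answers_of_mem (by simp)
  change (mainLoop mode indep f p ε t).ex f z (fun T =>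
    h (if answers f {T, {ustar f}} {ustar f} ≤ answers f {T, {ustar f}} T then T
      else {ustar f})) = _
  simp only [h1, h2]
  rfl

theorem cst_parSSP_le {w : ℕ → ℝ} (hw : Monotone w) (hw0 : ∀ q, 0 ≤ w q) (t : ℕ) :
    (parSSP mode indep p ε t).cst f w ≤
      w (Fintype.card N) + ((mainLoop mode indep f p ε t).cst f w + w 2) := by
  simp only [parSSP, Comp.cst, Comp.cst_bind]
  rw [answers_singleton]
  refine add_le_add (hw (Finset.card_image_le.trans (Finset.card_univ).le)) ?_
  refine add_le_add le_rfl ?_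
  refine (Comp.ex_mono' (hw0 2) _ (h' := fun _ => w 2) fun T => ?_).trans (Comp.ex_const _ _).le
  rw [add_zero]
  exact hw Finset.card_le_two

theorem abortsAfter_parSSP (t : ℕ) : (parSSP mode indep p ε t).AbortsAfter f t := by
  rw [parSSP, Comp.AbortsAfter]
  exact ((abortsAfter_parSSPLoop t _ _ _ _).mono (Nat.sub_le t 1)).bind fun T => trivial

theorem admissible (hf : Submodular f) (hf0 : ∀ X, 0 ≤ f X) (hI : IsIndependenceSystem indep)
    (hε : 0 < ε) (hε1 : ε < 1) : Admissible f indep ε (f {ustar f}) :=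
  ⟨hf, hf0, hI, hε, hε1, hf0 _, singleton_le_ustar⟩

theorem ex_parSSP_mono (h : Finset N → ℝ) (hh : ∀ S, 0 ≤ h S) (t : ℕ) :
    (parSSP mode indep p ε t).ex f 0 h ≤ (parSSP mode indep p ε (t + 1)).ex f 0 h := by
  rw [ex_parSSP, ex_parSSP]
  exact ex_parSSPLoop_mono (fun S => hh _) t _ _ _ _

theorem safe_parSSP (hf : Submodular f) (hf0 : ∀ X, 0 ≤ f X) (hI : IsIndependenceSystem indep)
    (hsing : ∀ u, indep {u}) (hε : 0 < ε) (hε1 : ε < 1) (t : ℕ) :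
    (parSSP mode indep p ε t).Safe f ((Fintype.card N + 1) ^ 2) indep := by
  have hadm := admissible hf hf0 hI hε hε1
  have hn : 1 ≤ Fintype.card N := Fintype.card_pos
  refine ⟨?_, ?_⟩
  · refine (Finset.card_image_le.trans (Finset.card_univ (α := N)).le).trans ?_
    nlinarith
  · dsimp only
    rw [answers_singleton]
    refine (safe_parSSPLoop hadm t _ _ _ _ hadm.stageInv_zero).bind fun T hT => ⟨?_, ?_⟩
    · refine Finset.card_le_two.trans ?_
      nlinarith
    · simp only [Comp.Safe]
      split_ifs
      exacts [hT, hsing _]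

theorem le_better (T : Finset N) : f T ≤ f (better f T) ∧ f {ustar f} ≤ f (better f T) := by
  unfold better
  split_ifs with h
  · exact ⟨le_rfl, h⟩
  · exact ⟨(not_le.1 h).le, le_rfl⟩

theorem one_le_rank {N : Type u} [Fintype N] [Nonempty N] {indep : Finset N → Prop}
    (hsing : ∀ u, indep {u}) : 1 ≤ rank indep := by
  obtain ⟨u⟩ := ‹Nonempty N›
  simpa using card_le_rank (hsing u)

/-- The cost of `ParSSP` in terms of the cost `b` of an iteration of `RandBatch`. -/
theorem cst_parSSP_le_of_step (hf : Submodular f) (hf0 : ∀ X, 0 ≤ f X)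
    (hI : IsIndependenceSystem indep) (hε : 0 < ε) (hε1 : ε < 1) (hp : 0 < (p : ℝ)) {w : ℕ → ℝ}
    (hw : Monotone w) (hw0 : ∀ q, 0 ≤ w q) {b : ℝ} (hwb : w (Fintype.card N + 1) ≤ b)
    (hb : ∀ ρ B L V, IsSeq indep B L V →
      (search mode indep ρ ε B V L).cst f w + w (L.card + 1) ≤ b) (t : ℕ) :
    (parSSP mode indep p ε t).cst f w ≤
      2 * b + paramL (rank indep) ε * (b + b / p * (paramM (rank indep) ε +
        (Real.log (Fintype.card N) / (-Real.log (1 - ε)) + 1))) := by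
  have hadm := admissible hf hf0 hI hε hε1
  have hn : 1 ≤ Fintype.card N := Fintype.card_pos
  have hb0 : 0 ≤ b := (hw0 _).trans hwb
  have h1 := cst_parSSP_le (f := f) (mode := mode) (indep := indep) (p := p) (ε := ε) hw hw0 t
  have h2 := cst_parSSPLoop_le (mode := mode) (M := paramM (rank indep) ε) hadm hp hw hw0 hb0 hb t
    (paramL (rank indep) ε) 0 ∅ Finset.univ hadm.stageInv_zero
  have h3 := (hw (Nat.le_succ (Fintype.card N))).trans hwb
  have h4 := (hw (by omega : 2 ≤ Fintype.card N + 1)).trans hwb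
  have h5 := mul_le_mul_of_nonneg_left
    (add_le_add_left hwb (b / p * (paramM (rank indep) ε +
      (Real.log (Fintype.card N) / (-Real.log (1 - ε)) + 1))))
    (Nat.cast_nonneg (α := ℝ) (paramL (rank indep) ε))
  unfold mainLoop at h1
  linarith

theorem logb_param_nonneg (hε : 0 < ε) (hε1 : ε < 1) {r : ℕ} (hr : 1 ≤ r) :
    0 ≤ Real.logb (1 - ε) (ε / r) := by
  have hr' : (1 : ℝ) ≤ r := by exact_mod_cast hr
  refine div_nonneg_of_nonpos (Real.log_nonpos (by positivity) ?_)
    (Real.log_nonpos (by linarith) (by linarith))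
  rw [div_le_one (by linarith)]
  linarith

theorem paramL_le (hε : 0 < ε) (hε1 : ε < 1) {r : ℕ} (hr : 1 ≤ r) :
    (paramL r ε : ℝ) ≤ Real.logb (1 - ε) (ε / r) + 2 := by
  have := Nat.ceil_lt_add_one (logb_param_nonneg hε hε1 hr)
  unfold paramL
  push_cast
  linarith

/-- The summand `2` in `M` absorbs the rounding in `ℓ` and its extra `1`. This makes the total loss
from leftovers, `ℓ f(O)/(Mε)`, at most `ε f(O)`. -/
theorem paramL_le_mul_paramM (hε : 0 < ε) (hε1 : ε < 1) {r : ℕ} (hr : 1 ≤ r) :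
    (paramL r ε : ℝ) ≤ paramM r ε * ε ^ 2 := by
  refine (paramL_le hε hε1 hr).trans ?_
  rw [← div_le_iff₀ (by positivity)]
  exact Nat.le_ceil _

theorem pow_paramL_le (hε : 0 < ε) (hε1 : ε < 1) {r : ℕ} (hr : 1 ≤ r) :
    (1 - ε) ^ paramL r ε / (1 - ε) ≤ ε / r := by
  have h1 : 0 < 1 - ε := by linarith
  have hr' : (0 : ℝ) < r := by exact_mod_cast hr
  rw [paramL, pow_succ, mul_div_assoc, div_self h1.ne', mul_one, ← Real.rpow_natCast]
  calc (1 - ε) ^ (⌈Real.logb (1 - ε) (ε / r)⌉₊ : ℝ) ≤ (1 - ε) ^ Real.logb (1 - ε) (ε / r) :=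
        Real.rpow_le_rpow_of_exponent_ge h1 (by linarith) (Nat.le_ceil _)
    _ = ε / r := Real.rpow_logb h1 (by linarith) (by positivity)

/-- The approximation guarantee for the approximations of the algorithm. -/
theorem approx_of_cutoff (hf : Submodular f) (hf0 : ∀ X, 0 ≤ f X) (hk : IsKSystem k indep)
    (hsing : ∀ u, indep {u}) (hO : IsOptimal indep f O) (hε : 0 < ε) (hε1 : ε < 1)
    (hp : 0 < (p : ℝ)) {κ : ℝ} (hκ0 : 0 ≤ κ) (hκ : p * κ * (1 - ε) ^ 3 = p * k + (1 - p)) (t : ℕ) :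
    (1 - p - ε) * f O -
        ((κ + O.card) * f O + f O + ε * f {ustar f}) *
          ((parSSP mode indep p ε t).ex f 1 fun _ => 0) ≤
      (1 + κ + ε) * (parSSP mode indep p ε t).ex f 0 f := by
  have hadm := admissible hf hf0 hk.system hε hε1
  have hr := one_le_rank hsing
  have hr' : (0 : ℝ) < rank indep := by exact_mod_cast hr
  have hL := paramL_le_mul_paramM hε hε1 hr
  have hL1 : (1 : ℝ) ≤ paramL (rank indep) ε := by
    unfold paramL
    push_cast
    linarith [Nat.cast_nonneg (α := ℝ) ⌈Real.logb (1 - ε) (ε / rank indep)⌉₊]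
  have hM : 0 < paramM (rank indep) ε := by
    refine Nat.pos_of_ne_zero fun h => ?_
    rw [h] at hL
    rw [Nat.cast_zero, zero_mul] at hL
    linarith
  have hM' : (0 : ℝ) < paramM (rank indep) ε := by exact_mod_cast hM
  have hpot := le_ex_parSSPLoop (mode := mode) hadm hk hO hp hM hκ0 hκ t (paramL (rank indep) ε)
    0 ∅ Finset.univ hadm.stageInv_zero
  -- Since singletons are independent, nothing is settled or blocked at the start, and the potential
  -- is `κ f(∅)`.
  have hstart : 0 ≤ potential f indep O κ k (f {ustar f} * (1 - ε) ^ 0 / (1 - ε)) ∅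
      Finset.univ := by
    have h1 : settled indep O ∅ Finset.univ = ∅ := by
      refine Finset.eq_empty_of_forall_notMem fun u hu => ?_
      have := (mem_settled.1 hu).2.2
      simp [hsing] at this
    have h2 : blocked indep O ∅ = ∅ := by
      refine Finset.eq_empty_of_forall_notMem fun u hu => ?_
      have := (mem_blocked.1 hu).2.2
      simp [hsing] at this
    simp only [potential, h1, h2, Finset.sum_empty, Finset.card_empty, Nat.cast_zero, mul_zero,
      sub_zero]
    exact mul_nonneg hκ0 (hf0 _)
  have hdisc : (paramL (rank indep) ε : ℝ) * (f O / (paramM (rank indep) ε * ε)) ≤ ε * f O := by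
    rw [mul_div_assoc', div_le_iff₀ (by positivity)]
    have := mul_le_mul_of_nonneg_right hL (hf0 O)
    linarith
  -- At most `r` elements of `O` survive all phases, each with marginal at most `ε f(u*)/r`, which
  -- is what `ℓ` was chosen for.
  have hlast : (O.card : ℝ) * (f {ustar f} * (1 - ε) ^ (0 + paramL (rank indep) ε) / (1 - ε)) ≤
      ε * f {ustar f} := by
    have h1 : (O.card : ℝ) ≤ rank indep := by exact_mod_cast card_le_rank hO.1
    have h2 := pow_paramL_le hε hε1 hr
    have h3 : 0 ≤ (1 - ε) ^ paramL (rank indep) ε / (1 - ε) :=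
      div_nonneg (pow_nonneg (by linarith) _) (by linarith)
    have h4 := mul_le_mul h1 h2 h3 hr'.le
    rw [mul_div_cancel₀ _ hr'.ne'] at h4
    have h5 := mul_le_mul_of_nonneg_right h4 (hf0 {ustar f})
    rw [zero_add, mul_div_assoc]
    linarith
  change _ ≤ (mainLoop mode indep f p ε t).ex f _ _ at hpot
  set c := mainLoop mode indep f p ε t with hc
  have habort : ((parSSP mode indep p ε t).ex f 1 fun _ => 0) = c.ex f 1 fun _ => 0 :=
    ex_parSSP _ _ _
  have hval : (parSSP mode indep p ε t).ex f 0 f = c.ex f 0 fun T => f (better f T) :=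
    ex_parSSP _ _ _
  rw [habort, hval]
  set a := c.ex f 1 fun _ => 0 with ha
  rw [Comp.ex_eq_add_abort, ← ha] at hpot
  have hsum := Comp.ex_one_add_abort (f := f) c
  rw [← ha] at hsum
  have hsample : (1 - a - p) * f O ≤ c.ex f 0 fun T => f (O ∪ T) := by
    have hg : Submodular fun T => f (O ∪ T) := by
      intro X Y
      have := hf (O ∪ X) (O ∪ Y)
      rwa [← Finset.union_union_distrib_left, ← Finset.union_inter_distrib_left] at this
    have h1 := hg.sampling (fun X => hf0 _)
      (μ := fun S => c.ex f 0 fun T => if T = S then 1 else 0)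
      (fun S => Comp.ex_nonneg _ fun T => by split_ifs <;> norm_num) hp.le ?_
    · rw [← Comp.ex_eq_sum (f := f) c fun T => f (O ∪ T)] at h1
      have h2 := Comp.ex_eq_sum (f := f) c fun _ => 1
      simp only [mul_one] at h2
      rw [← h2, Finset.union_empty] at h1
      have h3 : (c.ex f 0 fun _ => 1) = 1 - a := by linarith
      rwa [h3] at h1
    · intro u
      rw [← Comp.ex_eq_sum (f := f) c fun T => if u ∈ T then 1 else 0]
      have h2 := ex_parSSPLoop_mem_le (mode := mode) (M := paramM (rank indep) ε) (p := p) hadm u t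
        (paramL (rank indep) ε) 0 ∅ Finset.univ hadm.stageInv_zero
      have h3 := Comp.ex_mul (f := f) c (fun S => if u ∈ S then (1 : ℝ) else 0) 0 (-1)
      simp only [neg_one_mul, neg_zero] at h3
      simp only [Finset.notMem_empty, if_false, Finset.mem_univ, if_true] at h2
      change _ ≤ c.ex f 0 _ at h2
      linarith
  have hsub : (c.ex f 0 fun T => f (O ∪ T)) + (c.ex f 0 fun S => κ * f S - ∑ u ∈ O \ S, marg f u S) ≤
      (1 + κ) * c.ex f 0 fun T => f (better f T) := by
    have h1 := Comp.ex_add (f := f) c (fun T => f (O ∪ T))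
      (fun S => κ * f S - ∑ u ∈ O \ S, marg f u S) 0 0
    have h2 := Comp.ex_mul (f := f) c (fun T => f (better f T)) 0 (1 + κ)
    rw [← h2, ← h1, add_zero, mul_zero]
    refine Comp.ex_mono' le_rfl _ fun T => ?_
    have h3 := hf.union_le T O
    rw [Finset.union_comm] at h3
    have h4 := mul_le_mul_of_nonneg_left (le_better (f := f) T).1 (by linarith : 0 ≤ 1 + κ)
    linarith
  -- Returning the better of `T` and `{u*}` lets the loss `ε f(u*)` be absorbed by the output; hence
  -- the `ε` in the factor `1 + κ + ε`.
  have hu : (1 - a) * f {ustar f} ≤ c.ex f 0 fun T => f (better f T) := by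
    have h1 := Comp.ex_mul (f := f) c (fun _ => 1) 0 (f {ustar f})
    have h3 : (c.ex f 0 fun _ => 1) = 1 - a := by linarith
    rw [h3, mul_zero] at h1
    rw [mul_comm, ← h1]
    refine Comp.ex_mono' le_rfl _ fun T => ?_
    rw [mul_one]
    exact (le_better T).2
  have hu' := mul_le_mul_of_nonneg_left hu hε.le
  linarith

end Main

/-! ### Constants -/

section Constants

theorem half_lt_log_two : (1 / 2 : ℝ) < Real.log 2 := by
  have := Real.log_two_gt_d9
  linarith

theorem one_le_two_mul_log_succ {n : ℕ} (hn : 1 ≤ n) : 1 ≤ 2 * Real.log ((n : ℝ) + 1) := by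
  have h1 : (1 : ℝ) ≤ n := by exact_mod_cast hn
  have h2 := Real.log_le_log (by norm_num : (0 : ℝ) < 2) (by linarith : (2 : ℝ) ≤ n + 1)
  have := half_lt_log_two
  linarith

/-- The constant in the bounds on the parameters of `ParSSP`. -/
def paramConst (ε : ℝ) : ℝ :=
  ((1 + 2 * -Real.log ε) / (-Real.log (1 - ε)) + 4) / ε ^ 2 + 1 / (-Real.log (1 - ε)) + 4

theorem paramConst_pos {ε : ℝ} (hε : 0 < ε) (hε1 : ε < 1) : 0 < paramConst ε := by
  have hl := Batch.neg_log_pos hε hε1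
  have he : 0 < -Real.log ε := by linarith [Real.log_neg hε hε1]
  unfold paramConst
  positivity

theorem param_bounds {ε : ℝ} (hε : 0 < ε) (hε1 : ε < 1) {r n : ℕ} (hr : 1 ≤ r) (hrn : r ≤ n) :
    (paramL r ε : ℝ) ≤ paramConst ε * Real.log ((n : ℝ) + 1) ∧
      paramM r ε + (Real.log n / (-Real.log (1 - ε)) + 1) ≤
        paramConst ε * Real.log ((n : ℝ) + 1) ∧
      1 ≤ paramConst ε * Real.log ((n : ℝ) + 1) := by
  have hl := Batch.neg_log_pos hε hε1
  have he : 0 < -Real.log ε := by linarith [Real.log_neg hε hε1]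
  have hy := one_le_two_mul_log_succ (hr.trans hrn)
  have hr' : (0 : ℝ) < r := by exact_mod_cast hr
  have hn' : (0 : ℝ) < n := by exact_mod_cast hr.trans hrn
  have hrn' : (r : ℝ) ≤ n := by exact_mod_cast hrn
  have h1 : Real.log r ≤ Real.log ((n : ℝ) + 1) := Real.log_le_log hr' (by linarith)
  have h2 : Real.log n ≤ Real.log ((n : ℝ) + 1) := Real.log_le_log hn' (by linarith)
  have hL := paramL_le hε hε1 hr
  have hx0 := logb_param_nonneg hε hε1 hr
  have hM : (paramM r ε : ℝ) ≤ (Real.logb (1 - ε) (ε / r) + 2) / ε ^ 2 + 1 :=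
    (Nat.ceil_lt_add_one (by positivity)).le
  have hx : Real.logb (1 - ε) (ε / r) = (Real.log r + -Real.log ε) / (-Real.log (1 - ε)) := by
    rw [Real.logb, Real.log_div hε.ne' hr'.ne', ← neg_div_neg_eq]
    ring_nf
  set y := Real.log ((n : ℝ) + 1) with hy'
  set e := -Real.log ε with he'
  set l := -Real.log (1 - ε) with hl'
  set x := Real.logb (1 - ε) (ε / r) with hx'
  have hxy : x + 2 ≤ ((1 + 2 * e) / l + 4) * y := by
    have h3 : x ≤ ((1 + 2 * e) / l) * y := by
      rw [hx, div_mul_eq_mul_div]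
      refine div_le_div_of_nonneg_right ?_ hl.le
      nlinarith
    linarith
  have hD : paramConst ε = ((1 + 2 * e) / l + 4) / ε ^ 2 + 1 / l + 4 := rfl
  have hsq : ε ^ 2 ≤ 1 := pow_le_one₀ hε.le hε1.le
  have hy0 : 0 ≤ y := by linarith
  have hA : 0 ≤ (1 + 2 * e) / l + 4 := by positivity
  have hdiv : (1 + 2 * e) / l + 4 ≤ ((1 + 2 * e) / l + 4) / ε ^ 2 := by
    rw [le_div_iff₀ (by positivity)]
    nlinarith
  have hl1 : 0 ≤ 1 / l := by positivity
  refine ⟨?_, ?_, ?_⟩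
  · refine (hL.trans hxy).trans (mul_le_mul_of_nonneg_right ?_ hy0)
    rw [hD]
    linarith
  · have h4 : (x + 2) / ε ^ 2 ≤ ((1 + 2 * e) / l + 4) / ε ^ 2 * y := by
      rw [div_mul_eq_mul_div]
      exact div_le_div_of_nonneg_right hxy (by positivity)
    have h5 : Real.log n / l ≤ 1 / l * y := by
      rw [div_mul_eq_mul_div, one_mul]
      exact div_le_div_of_nonneg_right h2 hl.le
    rw [hD, add_mul, add_mul]
    linarith
  · have h6 : 2 ≤ paramConst ε := by
      rw [hD]
      have : 0 ≤ ((1 + 2 * e) / l + 4) / ε ^ 2 := by positivity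
      linarith
    exact hy.trans (mul_le_mul_of_nonneg_right h6 hy0)

theorem cost_bound {D y b s P ℓ Φ : ℝ} (hb : 0 ≤ b) (hs : 1 ≤ s) (hP : P ≤ 3 * s) (hP0 : 0 ≤ P)
    (hℓ0 : 0 ≤ ℓ) (hℓ : ℓ ≤ D * y) (hΦ : Φ ≤ D * y) (h1 : 1 ≤ D * y) :
    2 * b + ℓ * (b + b * P * Φ) ≤ 6 * D ^ 2 * (s * y ^ 2) * b := by
  have hx0 : 0 ≤ D * y := by linarith
  set x := D * y with hx
  have h2 : b * P * Φ ≤ b * (3 * s) * x :=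
    (mul_le_mul_of_nonneg_left hΦ (mul_nonneg hb hP0)).trans
      (mul_le_mul_of_nonneg_right (mul_le_mul_of_nonneg_left hP hb) hx0)
  have h3 : ℓ * (b + b * P * Φ) ≤ x * (b + b * (3 * s) * x) :=
    (mul_le_mul_of_nonneg_left (add_le_add_right h2 b) hℓ0).trans
      (mul_le_mul_of_nonneg_right hℓ (by positivity))
  have h4 : 1 ≤ s * x ^ 2 := by nlinarith
  have h5 : x ≤ s * x ^ 2 := by nlinarith
  have h6 : 6 * D ^ 2 * (s * y ^ 2) * b = 6 * (s * x ^ 2) * b := by rw [hx]; ring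
  rw [h6]
  nlinarith [mul_le_mul_of_nonneg_right h4 hb, mul_le_mul_of_nonneg_right h5 hb]

theorem inv_prob_le {k : ℕ} (hk : 1 ≤ k) : 1 + √((k : ℝ) + 1) ≤ 3 * √k ∧ 1 ≤ √(k : ℝ) := by
  have hk' : (1 : ℝ) ≤ k := by exact_mod_cast hk
  have h1 : 1 ≤ √(k : ℝ) := Real.one_le_sqrt.2 hk'
  have h2 : √((k : ℝ) + 1) ≤ 2 * √k := by
    rw [Real.sqrt_le_left (by positivity), mul_pow, Real.sq_sqrt (by linarith)]
    linarith
  exact ⟨by linarith, h1⟩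

theorem binary_steps_le {r : ℕ} (hr : 1 ≤ r) :
    ((Nat.log 2 (r + 1) + 1 : ℕ) : ℝ) ≤ 4 * Real.log ((r : ℝ) + 1) := by
  have h1 := one_le_two_mul_log_succ hr
  have h2 := Real.natLog_le_logb (r + 1) 2
  have h3 := half_lt_log_two
  have h4 : Real.logb (2 : ℕ) ((r + 1 : ℕ) : ℝ) ≤ 2 * Real.log ((r : ℝ) + 1) := by
    rw [Real.logb]
    push_cast
    rw [div_le_iff₀ (by linarith)]
    nlinarith
  push_cast
  linarith

theorem ratio_bound {ε s κ p q F : ℝ} (hε : 0 < ε) (hε' : ε < 2 / 5) (hs : 2 ≤ s ^ 2) (hs0 : 0 ≤ s)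
    (hp : p = (1 + s)⁻¹) (hκ0 : 0 ≤ κ) (hκ : κ * (1 - ε) ^ 3 = s ^ 2 + s - 1) (hF : 0 ≤ F)
    (h : (1 - p - ε) * F ≤ (1 + κ + ε) * q) :
    (1 - ε) ^ 5 * ((s + 1) ^ 2)⁻¹ * F ≤ q := by
  have hs1 : 1 ≤ s := by nlinarith
  have h1 : (1 - p - ε) * (s + 1) ^ 2 = s * (s + 1) - ε * (s + 1) ^ 2 := by
    rw [hp]
    field_simp
    ring
  have h2 : (1 - ε) ^ 5 * (1 + κ + ε) ≤ s * (s + 1) - ε * (s + 1) ^ 2 := by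
    have e1 : (1 - ε) ^ 5 * (1 + κ + ε) =
        (1 - ε) ^ 5 * (1 + ε) + (1 - ε) ^ 2 * (s ^ 2 + s - 1) := by
      rw [← hκ]; ring
    have e2 : s * (s + 1) - ε * (s + 1) ^ 2 -
        ((1 - ε) ^ 5 * (1 + ε) + (1 - ε) ^ 2 * (s ^ 2 + s - 1)) =
        ε * ((1 - ε) * s ^ 2 - ε * s + 1 - 4 * ε + 5 * ε ^ 3 - 4 * ε ^ 4 + ε ^ 5) := by ring
    have e3 : 0 ≤ (1 - ε) * s ^ 2 - ε * s + 1 - 4 * ε + 5 * ε ^ 3 - 4 * ε ^ 4 + ε ^ 5 := by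
      -- The tangent at `7/5`, close to the smallest possible `s = √2`, makes the bracket linear in
      -- `s ^ 2`. At `s ^ 2 = 2` its part of degree at most one in `ε` becomes `3 - (6 + 99/70) ε`,
      -- which is still positive at `ε = 2/5`.
      have a1 : s ≤ s ^ 2 / (14 / 5) + 7 / 10 := by nlinarith [sq_nonneg (s - 7 / 5)]
      have a2 := mul_le_mul_of_nonneg_left a1 hε.le
      have a3 : 0 ≤ (1 - ε - ε / (14 / 5)) * (s ^ 2 - 2) := mul_nonneg (by linarith) (by linarith)
      have a4 : 0 ≤ ε ^ 3 * (5 - 4 * ε) := mul_nonneg (by positivity) (by linarith)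
      have a5 : 0 ≤ ε ^ 5 := by positivity
      linarith
    have := mul_nonneg hε.le e3
    linarith
  have h3 : (1 - ε) ^ 5 * (1 + κ + ε) * ((s + 1) ^ 2)⁻¹ ≤ 1 - p - ε := by
    rw [mul_inv_le_iff₀ (by positivity), h1]
    exact h2
  have h4 := (mul_le_mul_of_nonneg_right h3 hF).trans h
  have h5 : 0 < 1 + κ + ε := by linarith
  refine le_of_mul_le_mul_left ?_ h5
  linarith

end Constants

/-! ### The final bounds on cost and value. -/

theorem IsSeq.length_le {N : Type u} [Fintype N] [DecidableEq N] {indep : Finset N → Prop}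
    (hI : IsIndependenceSystem indep) {B L : Finset N} {V : List N}
    (hV : IsSeq indep B L V) : V.length ≤ rank indep := by
  rw [← List.toFinset_card_of_nodup hV.nodup]
  exact card_le_rank (hI.subset _ _ Finset.subset_union_right hV.indep)

section Bounds

variable {N : Type u} [Fintype N] [DecidableEq N] [Nonempty N] {f : Finset N → ℝ}
  {indep : Finset N → Prop} {ε : ℝ} {k : ℕ} {O : Finset N} {p : unitInterval} {mode : SearchMode}

/-- Of the two logarithmic factors one counts the phases and the other the accepted batches per
phase; `√k` comes from `1/p`. The four bounds below differ only in the cost `b` of one iteration. -/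
theorem cst_parSSP_le_of_bound (hf : Submodular f) (hf0 : ∀ X, 0 ≤ f X) (hk : IsKSystem k indep)
    (hsing : ∀ u, indep {u}) (hε : 0 < ε) (hε1 : ε < 1)
    (hp : (p : ℝ) = (1 + √((k : ℝ) + 1))⁻¹) {w : ℕ → ℝ}
    (hw : Monotone w) (hw0 : ∀ q, 0 ≤ w q) {b : ℝ} (hwb : w (Fintype.card N + 1) ≤ b)
    (hb : ∀ ρ B L V, IsSeq indep B L V →
      (search mode indep ρ ε B V L).cst f w + w (L.card + 1) ≤ b) (t : ℕ) :
    (parSSP mode indep p ε t).cst f w ≤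
      6 * paramConst ε ^ 2 * (√k * Real.log (Fintype.card N + 1) ^ 2) * b := by
  have hp0 : 0 < (p : ℝ) := by rw [hp]; positivity
  have h1 := cst_parSSP_le_of_step hf hf0 hk.system hε hε1 hp0 hw hw0 hwb hb t
  obtain ⟨hL, hM, hone⟩ := param_bounds hε hε1 (one_le_rank hsing) (rank_le_card indep)
  obtain ⟨hP, hs⟩ := inv_prob_le hk.one_le
  refine h1.trans ?_
  rw [div_eq_mul_inv, hp, inv_inv]
  exact cost_bound ((hw0 _).trans hwb) hs hP (by positivity) (Nat.cast_nonneg _) hL hM hone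

theorem parallel_rounds_le (hf : Submodular f) (hf0 : ∀ X, 0 ≤ f X) (hk : IsKSystem k indep)
    (hsing : ∀ u, indep {u}) (hε : 0 < ε) (hε1 : ε < 1)
    (hp : (p : ℝ) = (1 + √((k : ℝ) + 1))⁻¹) (t : ℕ) :
    ((parSSP .parallel indep p ε t).cst f fun _ => 1) ≤
      216 * paramConst ε ^ 2 * (√k * Real.log (Fintype.card N + 1) ^ 2) := by
  have h := cst_parSSP_le_of_bound (mode := .parallel) hf hf0 hk hsing hε hε1 hp (w := fun _ => 1)
    monotone_const (fun _ => zero_le_one) (b := 2) (by norm_num) (fun ρ B L V _ => by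
      have := cst_search_parallel_le (f := f) (indep := indep) (ρ := ρ) (ε := ε) (B := B) (V := V)
        (L := L) (w := fun _ => 1) monotone_const
      linarith) t
  refine h.trans ?_
  have h2 : 0 ≤ paramConst ε ^ 2 * (√k * Real.log (Fintype.card N + 1) ^ 2) := by positivity
  linarith

theorem parallel_queries_le (hf : Submodular f) (hf0 : ∀ X, 0 ≤ f X) (hk : IsKSystem k indep)
    (hsing : ∀ u, indep {u}) (hε : 0 < ε) (hε1 : ε < 1)
    (hp : (p : ℝ) = (1 + √((k : ℝ) + 1))⁻¹) (t : ℕ) :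
    ((parSSP .parallel indep p ε t).cst f fun q => (q : ℝ)) ≤
      216 * paramConst ε ^ 2 * (√k * Fintype.card N * rank indep *
        Real.log (Fintype.card N + 1) ^ 2) := by
  have hr : (1 : ℝ) ≤ rank indep := by exact_mod_cast one_le_rank hsing
  have hn : (1 : ℝ) ≤ Fintype.card N := by exact_mod_cast Fintype.card_pos (α := N)
  have h := cst_parSSP_le_of_bound (mode := .parallel) hf hf0 hk hsing hε hε1 hp
    (w := fun q => (q : ℝ)) Nat.mono_cast (fun q => Nat.cast_nonneg q)
    (b := 6 * (Fintype.card N * rank indep)) (by push_cast; nlinarith) (fun ρ B L V hV => by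
      have h1 := cst_search_parallel_le (f := f) (indep := indep) (ρ := ρ) (ε := ε) (B := B)
        (V := V) (L := L) (w := fun q => (q : ℝ)) Nat.mono_cast
      have h2 : (V.length : ℝ) ≤ rank indep := by exact_mod_cast hV.length_le hk.system
      have h3 : (L.card : ℝ) ≤ Fintype.card N := by exact_mod_cast Finset.card_le_univ L
      push_cast at h1 ⊢
      have h4 : ((V.length : ℝ) + 1) * (L.card + 1) ≤ (rank indep + 1) * (Fintype.card N + 1) := by
        gcongr
      nlinarith) t
  refine h.trans ?_
  have h2 : 0 ≤ paramConst ε ^ 2 * (√k * Real.log (Fintype.card N + 1) ^ 2) *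
    (Fintype.card N * rank indep) := by positivity
  linarith

theorem binary_rounds_le (hf : Submodular f) (hf0 : ∀ X, 0 ≤ f X) (hk : IsKSystem k indep)
    (hsing : ∀ u, indep {u}) (hε : 0 < ε) (hε1 : ε < 1)
    (hp : (p : ℝ) = (1 + √((k : ℝ) + 1))⁻¹) (t : ℕ) :
    ((parSSP .binary indep p ε t).cst f fun _ => 1) ≤
      216 * paramConst ε ^ 2 * (√k * Real.log (Fintype.card N + 1) ^ 2 *
        Real.log (rank indep + 1)) := by
  have hz := one_le_two_mul_log_succ (one_le_rank hsing)
  have hj := binary_steps_le (one_le_rank hsing)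
  have h := cst_parSSP_le_of_bound (mode := .binary) hf hf0 hk hsing hε hε1 hp (w := fun _ => 1)
    monotone_const (fun _ => zero_le_one) (b := 10 * Real.log ((rank indep : ℝ) + 1))
    (by linarith) (fun ρ B L V hV => by
      have h1 := cst_search_binary_le (f := f) (indep := indep) (ρ := ρ) (ε := ε) (B := B)
        (V := V) (L := L) (w := fun _ => 1) monotone_const (fun _ => zero_le_one)
        (n := Nat.log 2 (rank indep + 1) + 1)
        ((Nat.succ_le_succ (hV.length_le hk.system)).trans_lt
          (Nat.lt_pow_succ_log_self (by norm_num) _))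
      linarith) t
  refine h.trans ?_
  have h2 : 0 ≤ paramConst ε ^ 2 * (√k * Real.log (Fintype.card N + 1) ^ 2) *
    Real.log ((rank indep : ℝ) + 1) := mul_nonneg (by positivity) (by linarith)
  linarith

theorem binary_queries_le (hf : Submodular f) (hf0 : ∀ X, 0 ≤ f X) (hk : IsKSystem k indep)
    (hsing : ∀ u, indep {u}) (hε : 0 < ε) (hε1 : ε < 1)
    (hp : (p : ℝ) = (1 + √((k : ℝ) + 1))⁻¹) (t : ℕ) :
    ((parSSP .binary indep p ε t).cst f fun q => (q : ℝ)) ≤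
      216 * paramConst ε ^ 2 * (√k * Fintype.card N * Real.log (Fintype.card N + 1) ^ 2 *
        Real.log (rank indep + 1)) := by
  have hr : (rank indep : ℝ) ≤ Fintype.card N := by exact_mod_cast rank_le_card indep
  have hn : (1 : ℝ) ≤ Fintype.card N := by exact_mod_cast Fintype.card_pos (α := N)
  have hz := one_le_two_mul_log_succ (one_le_rank hsing)
  have hj := binary_steps_le (one_le_rank hsing)
  have h := cst_parSSP_le_of_bound (mode := .binary) hf hf0 hk hsing hε hε1 hp
    (w := fun q => (q : ℝ)) Nat.mono_cast (fun q => Nat.cast_nonneg q)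
    -- Two searches with at most `4 log (r + 1)` rounds of at most `4n` queries give `32`, and the
    -- final update at most `4`. This is the largest of the four costs, whence `216 = 6 * 36`.
    (b := 36 * (Fintype.card N * Real.log ((rank indep : ℝ) + 1))) (by push_cast; nlinarith)
    (fun ρ B L V hV => by
      have h1 := cst_search_binary_le (f := f) (indep := indep) (ρ := ρ) (ε := ε) (B := B)
        (V := V) (L := L) (w := fun q => (q : ℝ)) Nat.mono_cast (fun q => Nat.cast_nonneg q)
        (n := Nat.log 2 (rank indep + 1) + 1)
        ((Nat.succ_le_succ (hV.length_le hk.system)).trans_lt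
          (Nat.lt_pow_succ_log_self (by norm_num) _))
      have h2 : (V.length : ℝ) ≤ rank indep := by exact_mod_cast hV.length_le hk.system
      have h3 : (L.card : ℝ) ≤ Fintype.card N := by exact_mod_cast Finset.card_le_univ L
      have h4 : ((L.card + 1 + (V.length + 1) : ℕ) : ℝ) ≤ 4 * Fintype.card N := by
        push_cast
        linarith
      have h5 := mul_le_mul hj h4 (Nat.cast_nonneg _) (by linarith)
      push_cast at h1 h5 ⊢
      nlinarith) t
  refine h.trans ?_
  have h2 : 0 ≤ paramConst ε ^ 2 * (√k * Real.log (Fintype.card N + 1) ^ 2) *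
    (Fintype.card N * Real.log ((rank indep : ℝ) + 1)) :=
    mul_nonneg (by positivity) (mul_nonneg (by linarith) (by linarith))
  linarith

theorem rounds_le (mode : SearchMode) (hf : Submodular f) (hf0 : ∀ X, 0 ≤ f X)
    (hk : IsKSystem k indep) (hsing : ∀ u, indep {u}) (hε : 0 < ε) (hε1 : ε < 1)
    (hp : (p : ℝ) = (1 + √((k : ℝ) + 1))⁻¹) :
    ∃ E : ℝ, ∀ t, ((parSSP mode indep p ε t).cst f fun _ => 1) ≤ E := by
  cases mode with
  | parallel => exact ⟨_, parallel_rounds_le hf hf0 hk hsing hε hε1 hp⟩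
  | binary => exact ⟨_, binary_rounds_le hf hf0 hk hsing hε hε1 hp⟩

theorem approx_parSSP (mode : SearchMode) (hf : Submodular f) (hf0 : ∀ X, 0 ≤ f X)
    (hk : IsKSystem k indep) (hsing : ∀ u, indep {u}) (hO : IsOptimal indep f O) (hε : 0 < ε)
    (hε' : ε < 2 / 5) (hp : (p : ℝ) = (1 + √((k : ℝ) + 1))⁻¹) :
    (1 - ε) ^ 5 * ((√((k : ℝ) + 1) + 1) ^ 2)⁻¹ * f O ≤
      ∑ S, (outputProb f (parSSP mode indep p ε) S).toReal * f S := by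
  have hε1 : ε < 1 := by linarith
  have h1 : 0 < 1 - ε := by linarith
  have hp0 : 0 < (p : ℝ) := by rw [hp]; positivity
  have hk1 : (1 : ℝ) ≤ k := by exact_mod_cast hk.one_le
  have hs2 : √((k : ℝ) + 1) ^ 2 = k + 1 := Real.sq_sqrt (by linarith)
  have hs0 : 0 ≤ √((k : ℝ) + 1) := Real.sqrt_nonneg _
  obtain ⟨E, hE⟩ := rounds_le (p := p) mode hf hf0 hk hsing hε hε1 hp
  set s := √((k : ℝ) + 1) with hs
  set κ := (s ^ 2 + s - 1) / (1 - ε) ^ 3 with hκdef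
  have hκ0 : 0 ≤ κ := div_nonneg (by linarith) (by positivity)
  have hκ1 : κ * (1 - ε) ^ 3 = s ^ 2 + s - 1 := div_mul_cancel₀ _ (by positivity)
  have hκ : p * κ * (1 - ε) ^ 3 = p * k + (1 - p) := by
    have h2 : (p : ℝ) * (1 + s) = 1 := by
      rw [hp]
      exact inv_mul_cancel₀ (by positivity)
    rw [mul_assoc, hκ1, hs2]
    linarith
  refine ratio_bound hε hε' (by linarith) hs0 hp hκ0 hκ1 (hf0 O) ?_
  set K := (κ + O.card) * f O + f O + ε * f {ustar f} with hK
  have hK0 : 0 ≤ K := by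
    have := hf0 O
    have := hf0 {ustar f}
    positivity
  have hbound : ∀ t : ℕ, (1 - p - ε) * f O - K * (E * (1 / ((t : ℝ) + 1))) ≤
      (1 + κ + ε) * ∑ S, (outputProb f (parSSP mode indep p ε) S).toReal * f S := by
    intro t
    have h2 := approx_of_cutoff (mode := mode) (p := p) hf hf0 hk hsing hO hε hε1 hp0 hκ0 hκ (t + 1)
    have h3 := mul_le_mul_of_nonneg_left
      (abort_le (f := f) (fun t => abortsAfter_parSSP t) hE t) hK0
    have h4 := mul_le_mul_of_nonneg_left
      (ex_le_sum_outputProb (f := f) (parSSP mode indep p ε) hf0 (t + 1))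
      (by linarith : 0 ≤ 1 + κ + ε)
    linarith
  -- Aborted runs enter with a fixed bound `K` and probability at most `E/(t + 1)`, so their
  -- contribution vanishes in the limit.
  have hlim : Filter.Tendsto (fun t : ℕ => (1 - p - ε) * f O - K * (E * (1 / ((t : ℝ) + 1))))
      Filter.atTop (nhds ((1 - p - ε) * f O)) := by
    have h3 := ((tendsto_one_div_add_atTop_nhds_zero_nat (𝕜 := ℝ)).const_mul E).const_mul K
    simpa using h3.const_sub ((1 - p - ε) * f O)
  exact le_of_tendsto' hlim hbound

end Bounds

end ParSSP

end

theorem mainTheorem3 (ε : ℝ) (hε : 0 < ε) (hε1 : ε < 1) :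
    ∃ C : ℝ, 0 < C ∧
      ∀ (N : Type*) [Fintype N] [DecidableEq N] [Nonempty N]
        (f : Finset N → ℝ) (indep : Finset N → Prop) (k : ℕ) (O : Finset N) (p : unitInterval),
        ParSSP.Submodular f → (∀ X, 0 ≤ f X) →
        ParSSP.IsKSystem k indep → (∀ u, indep {u}) →
        ParSSP.IsOptimal indep f O →
        (p : ℝ) = (1 + √((k : ℝ) + 1))⁻¹ →
        -- in both modes: almost sure termination with a feasible solution, polynomially many
        -- queries per round, and the approximation guarantee
        (∀ mode : ParSSP.SearchMode,
          ∑ S, ParSSP.outputProb f (ParSSP.parSSP mode indep p ε) S = 1 ∧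
          (∀ S, ParSSP.outputProb f (ParSSP.parSSP mode indep p ε) S ≠ 0 → indep S) ∧
          ParSSP.WidthAtMost f (ParSSP.parSSP mode indep p ε) ((Fintype.card N + 1) ^ 2) ∧
          (ε < 2 / 5 →
            (1 - ε) ^ 5 * ((√((k : ℝ) + 1) + 1) ^ 2)⁻¹ * f O ≤
              ∑ S, (ParSSP.outputProb f (ParSSP.parSSP mode indep p ε) S).toReal * f S)) ∧
        -- adaptivity and queries, testing all indices in parallel
        (ParSSP.expectedCost f (ParSSP.parSSP .parallel indep p ε) ParSSP.Cost.rounds ≤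
            ENNReal.ofReal (C * (√k * Real.log (Fintype.card N + 1) ^ 2)) ∧
          ParSSP.expectedCost f (ParSSP.parSSP .parallel indep p ε) ParSSP.Cost.queries ≤
            ENNReal.ofReal (C * (√k * Fintype.card N * ParSSP.rank indep *
              Real.log (Fintype.card N + 1) ^ 2))) ∧
        -- adaptivity and queries, with binary search
        (ParSSP.expectedCost f (ParSSP.parSSP .binary indep p ε) ParSSP.Cost.rounds ≤
            ENNReal.ofReal (C * (√k * Real.log (Fintype.card N + 1) ^ 2 *
              Real.log (ParSSP.rank indep + 1))) ∧
          ParSSP.expectedCost f (ParSSP.parSSP .binary indep p ε) ParSSP.Cost.queries ≤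
            ENNReal.ofReal (C * (√k * Fintype.card N * Real.log (Fintype.card N + 1) ^ 2 *
              Real.log (ParSSP.rank indep + 1)))) := by
  have hD := ParSSP.paramConst_pos hε hε1
  refine ⟨216 * ParSSP.paramConst ε ^ 2, by positivity, ?_⟩
  intro N _ _ _ f indep k O p hf hf0 hk hsing hO hp
  refine ⟨fun mode => ⟨?_, fun S => ?_, fun t ω hω => ?_, fun hε' => ?_⟩, ⟨?_, ?_⟩, ?_, ?_⟩
  · obtain ⟨E, hE⟩ := ParSSP.rounds_le (p := p) mode hf hf0 hk hsing hε hε1 hp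
    exact ParSSP.sum_outputProb_eq_one (fun t => ParSSP.abortsAfter_parSSP t) hE
      ParSSP.ex_parSSP_mono
  · exact ParSSP.property_of_outputProb_ne_zero
      (ParSSP.safe_parSSP hf hf0 hk.system hsing hε hε1)
  · exact ((ParSSP.safe_parSSP hf hf0 hk.system hsing hε hε1 t).of_mem_support ω hω).1
  · exact ParSSP.approx_parSSP mode hf hf0 hk hsing hO hε hε' hp
  · exact ParSSP.expectedCost_rounds_le (ParSSP.parallel_rounds_le hf hf0 hk hsing hε hε1 hp)
  · exact ParSSP.expectedCost_queries_le (ParSSP.parallel_queries_le hf hf0 hk hsing hε hε1 hp)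
  · exact ParSSP.expectedCost_rounds_le (ParSSP.binary_rounds_le hf hf0 hk hsing hε hε1 hp)
  · exact ParSSP.expectedCost_queries_le (ParSSP.binary_queries_le hf hf0 hk hsing hε hε1 hp)
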